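/- Let $W=\{W(x)\}_{x\in\mathbb R}$ be a standard two-sided Brownian motion on a probability space $(\Omega,\mathcal F,\mathbb P)$. For $(t,\theta)\in\mathbb R\times(0,1)$ let $B(t,\theta)$ be the Wiener integral $$B(t,\theta)=\int_{\mathbb R}\Big\{(t-x)_+^{\theta-1/2}-(-x)_+^{\theta-1/2}\Big\}\,dW(x),$$ where $(u)_+^{p}=u^{p}$ if $u>0$ and $(u)_+^{p}=0$ if $u\le 0$. The pointwise Hölder exponent of $f:\mathbb R\to\mathbb R$ at $s$ is $$\alpha_f(s)=\sup\Big\{\alpha\ge 0:\ \limsup_{h\to0}\frac{|f(s+h)-f(s)|}{|h|^{\alpha}}=0\Big\}\in[0,\infty],$$ with the convention $\sup\emptyset=0$. A pair $(\widetilde B,\Omega^*)$ is called regular if $\widetilde B$ is a modification of the field $B$ on $\mathbb R\times(0,1)$, $\Omega^*$ is an event of probability $1$, and for every $\omega\in\Omega^*$: (R1) $(t,\theta)\mapsto\widetilde B(t,\theta,\omega)$ is continuous on $\mathbb R\times(0,1)$; (R2) for all $\varepsilon>0$ and $(s,\theta)\in\mathbb R\times(0,1)$, $$\limsup_{h\to0}\frac{|\widetilde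 B(s+h,\theta,\omega)-\widetilde B(s,\theta,\omega)|}{|h|^{\theta-\varepsilon}}=0\quad\text{and}\quad \limsup_{h\to0}\frac{|\widetilde B(s+h,\theta,\omega)-\widetilde B(s,\theta,\omega)|}{|h|^{\theta+\varepsilon}}=+\infty;$$ (R3) for each $t\in\mathbb R$ the function $\theta\mapsto\widetilde B(t,\theta,\omega)$ is $C^\infty$ on $(0,1)$; (R4) for all integers $n\ge0$ and reals $\varepsilon>0$, $M>0$, $0<a<c<1$ there is $C(\omega)>0$ such that, for all $t_1,t_2\in[-M,M]$ and $\theta_1,\theta_2\in[a,c]$, $$|\partial_\theta^n\widetilde B(t_1,\theta_1,\omega)-\partial_\theta^n\widetilde B(t_2,\theta_2,\omega)|\le C(\omega)\big(|t_1-t_2|^{\max\{\theta_1,\theta_2\}-\varepsilon}+|\theta_1-\theta_2|\big).$$ **Theorem.** A regular pair exists. Moreover, let $(\widetilde B,\Omega^*)$ be any regular pair, let $H:\mathbb R\to(0,1)$ be continuous, let $\mathcal J\subseteq(0,+\infty)$ be a non-empty open interval on which $H$ is nowhere differentiable and satisfies $$\alpha_H(s)<H(s)<2\alpha_H(s)\qquad\text{for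 each } s\in\mathcal J,$$ and let $X(t,\omega)=\widetilde B(t,H(t),\omega)$ be the multifractional Brownian motion with functional parameter $H$, with pointwise Hölder exponent $\alpha_X(s,\omega)$ at $s$. Then the following hold. (i) For all $\omega\in\Omega^*$ and $s\in\mathcal J$ with $(\partial_\theta\widetilde B)(s,H(s),\omega)\neq0$, one has $\alpha_X(s,\omega)=\alpha_H(s)$. (ii) For all $\omega\in\Omega^*$ and $s\in\mathcal J$ with $(\partial_\theta\widetilde B)(s,H(s),\omega)=0$, one has $\alpha_X(s,\omega)=H(s)$. Furthermore there is an event $\Omega^{**}\subseteq\Omega^*$ of probability $1$ such that (iii) and (iv) hold, where $\dim_{\mathcal H}$ denotes Hausdorff dimension. (iii) For all $\omega\in\Omega^{**}$, $$\dim_{\mathcal H}\{s\in\mathcal J:(\partial_\theta\widetilde B)(s,H(s),\omega)\neq0\}=\dim_{\mathcal H}\{s\in\mathcal J:\alpha_X(s,\omega)=\alpha_H(s)\}=1.$$ (iv) One has $1-\inf_{\mathcal J}H>0$, and for every $\eta>0$ there is an event $D\subseteq\Omega^{**}$ of strictly positive probability such that, for all $\omega\in D$, $$\dim_{\mathcal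 H}\{s\in\mathcal J:(\partial_\theta\widetilde B)(s,H(s),\omega)=0\}\ge1-\eta-\inf_{\mathcal J}H,\qquad \dim_{\mathcal H}\{s\in\mathcal J:\alpha_X(s,\omega)=H(s)\}\ge1-\eta-\inf_{\mathcal J}H;$$ the lower bound is strictly positive as soon as $\eta<1-\inf_{\mathcal J}H$. Consequently the pointwise Hölder regularity of $X$ is random: there is no deterministic function $a:\mathcal J\to[0,\infty]$ such that, almost surely, $\alpha_X(s)=a(s)$ for all $s\in\mathcal J$. -/

import Mathlib

open MeasureTheory ProbabilityTheory Filter Set Topology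
open scoped ENNReal NNReal

/-- `limsup_{h → 0, h ≠ 0} |f (s + h) - f s| / |h| ^ α`, computed in `[0, ∞]`. -/
noncomputable def limsupQuotient (f : ℝ → ℝ) (s α : ℝ) : ℝ≥0∞ :=
  limsup (fun h : ℝ => ENNReal.ofReal (|f (s + h) - f s| / |h| ^ α)) (𝓝[≠] 0)

/-- The pointwise Hölder exponent of `f` at `s`: the supremum, in `[0, ∞]`, of the `α ≥ 0` with
`limsup_{h → 0} |f (s + h) - f s| / |h| ^ α = 0`. -/
noncomputable def pointwiseHolderExponent (f : ℝ → ℝ) (s : ℝ) : ℝ≥0∞ :=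
  ⨆ (α : ℝ≥0) (_ : limsupQuotient f s α = 0), (α : ℝ≥0∞)

/-- `W` is a standard Brownian motion indexed by the whole real line: a centered Gaussian process
with covariance `(|s| + |t| - |s - t|) / 2` (in particular `W 0 = 0` almost surely) and almost
surely continuous paths. -/
structure IsTwoSidedBrownianMotion {Ω : Type*} [MeasurableSpace Ω] (P : Measure Ω)
    (W : ℝ → Ω → ℝ) : Prop where
  isGaussianProcess : IsGaussianProcess W P
  integral_eq_zero : ∀ t : ℝ, ∫ ω, W t ω ∂P = 0
  covariance_eq : ∀ s t : ℝ, covariance (W s) (W t) P = (|s| + |t| - |s - t|) / 2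
  continuous_paths : ∀ᵐ ω ∂P, Continuous fun t : ℝ => W t ω

/-- `Z` is (a version of) the Wiener integral `∫ f dW` of the deterministic square integrable
function `f`: the value at `f` of the continuous linear map from `L²(ℝ)` to `L²(P)` which sends the
indicator function of `(a, b]` to `W b - W a`. There is at most one such map, since the indicator
functions of bounded intervals span a dense subspace of `L²(ℝ)`. -/
def IsWienerIntegral {Ω : Type*} [MeasurableSpace Ω] (P : Measure Ω) (W : ℝ → Ω → ℝ)
    (f : ℝ → ℝ) (Z : Ω → ℝ) : Prop :=
  ∃ I : Lp ℝ 2 (volume : Measure ℝ) →L[ℝ] Lp ℝ 2 P,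
    (∀ a b : ℝ, a ≤ b →
      I (indicatorConstLp 2 (measurableSet_Ioc : MeasurableSet (Ioc a b))
        measure_Ioc_lt_top.ne (1 : ℝ)) =ᵐ[P] fun ω => W b ω - W a ω) ∧
    ∃ hf : MemLp f 2 (volume : Measure ℝ), Z =ᵐ[P] I (hf.toLp f)

/-- `(u)_+ ^ p`, with the convention that it vanishes for `u ≤ 0` whatever the sign of `p`. -/
noncomputable def posPartPow (u p : ℝ) : ℝ := if 0 < u then u ^ p else 0

/-- `x ↦ (t - x)_+ ^ (θ - 1/2) - (-x)_+ ^ (θ - 1/2)`. -/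
noncomputable def fieldKernel (t θ x : ℝ) : ℝ :=
  posPartPow (t - x) (θ - 1 / 2) - posPartPow (-x) (θ - 1 / 2)

/-- `B` is, on `ℝ × (0, 1)`, a modification of the Gaussian field
`(t, θ) ↦ ∫ ((t - x)_+ ^ (θ - 1/2) - (-x)_+ ^ (θ - 1/2)) dW(x)`. -/
def IsFieldModification {Ω : Type*} [MeasurableSpace Ω] (P : Measure Ω) (W : ℝ → Ω → ℝ)
    (B : ℝ → ℝ → Ω → ℝ) : Prop :=
  ∀ t : ℝ, ∀ θ ∈ Ioo (0 : ℝ) 1, IsWienerIntegral P W (fieldKernel t θ) (B t θ)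

/-- The partial derivative `∂_θ^n b (t, θ)`. -/
noncomputable def partialTheta (n : ℕ) (b : ℝ → ℝ → ℝ) (t θ : ℝ) : ℝ :=
  iteratedDeriv n (fun θ' : ℝ => b t θ') θ

/-- The regularity properties of one realization `b = B(·, ·, ω)` on `ℝ × (0, 1)`. -/
structure IsRegularRealization (b : ℝ → ℝ → ℝ) : Prop where
  continuousOn : ContinuousOn (fun p : ℝ × ℝ => b p.1 p.2) (univ ×ˢ Ioo (0 : ℝ) 1)
  limsup_eq_zero : ∀ ε > 0, ∀ s : ℝ, ∀ θ ∈ Ioo (0 : ℝ) 1,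
    limsupQuotient (fun t => b t θ) s (θ - ε) = 0
  limsup_eq_top : ∀ ε > 0, ∀ s : ℝ, ∀ θ ∈ Ioo (0 : ℝ) 1,
    limsupQuotient (fun t => b t θ) s (θ + ε) = ⊤
  contDiffOn : ∀ t : ℝ, ContDiffOn ℝ ((⊤ : ℕ∞) : WithTop ℕ∞) (fun θ => b t θ) (Ioo (0 : ℝ) 1)
  holder : ∀ (n : ℕ) (ε M a c : ℝ), 0 < ε → 0 < M → 0 < a → a < c → c < 1 →
    ∃ C > 0, ∀ t₁ ∈ Icc (-M) M, ∀ t₂ ∈ Icc (-M) M, ∀ θ₁ ∈ Icc a c, ∀ θ₂ ∈ Icc a c,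
      |partialTheta n b t₁ θ₁ - partialTheta n b t₂ θ₂| ≤
        C * (|t₁ - t₂| ^ (max θ₁ θ₂ - ε) + |θ₁ - θ₂|)

/-- `B` is a modification of the Gaussian field, and all of its realizations are regular on the
event `E` of probability one. -/
structure IsRegularModification {Ω : Type*} [MeasurableSpace Ω] (P : Measure Ω) (W : ℝ → Ω → ℝ)
    (B : ℝ → ℝ → Ω → ℝ) (E : Set Ω) : Prop where
  isFieldModification : IsFieldModification P W B
  measurableSet : MeasurableSet E
  measure_eq_one : P E = 1
  regular : ∀ ω ∈ E, IsRegularRealization fun t θ => B t θ ω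

/-- The multifractional process `X(t) = B(t, H(t))`, as a trajectory for each `ω`. -/
def mBm {Ω : Type*} (B : ℝ → ℝ → Ω → ℝ) (H : ℝ → ℝ) (ω : Ω) (t : ℝ) : ℝ := B t (H t) ω

/-- `(∂_θ B)(s, H(s), ω)`. -/
noncomputable def thetaDerivAlong {Ω : Type*} (B : ℝ → ℝ → Ω → ℝ) (H : ℝ → ℝ) (ω : Ω) (s : ℝ) :
    ℝ :=
  partialTheta 1 (fun t θ => B t θ ω) s (H s)

/-! The Wiener integral is an isonormal map `I` from `L²(ℝ)` to `L²(P)`, so every probability about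
the field becomes a statement about norms and inner products of kernels.

Existence of a regular pair. Expanding `u ^ (θ - 1/2)` in powers of `(θ - 1/2) * log u` turns the
kernel into a power series in `θ - 1/2` whose `L²` coefficients are `O(r ^ (-n))` for every `r <
1/2` (`exists_kernelCoeff_bound`). Hence `θ` may be replaced by a complex `z` in the disc of
diameter `(0, 1)`. Over a dyadic interval, self-similarity extracts the factor `mesh ^ z` from the
increment, and moment bounds control all remaining random coefficients at once
(`IsIsonormal.ae_isGoodCoeff`). Kolmogorov chaining in `t`, uniform in `z`, produces random
holomorphic functions with increments of order `|h| ^ (Re z - ε)` (`IsGoodCoeff.isHolomorphicPath`).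
Cauchy's estimate carries this order over to all derivatives in `θ`. The roughness of the paths
comes from causality: each increment contains white noise that earlier ones do not, so a run of
small increments is very unlikely (`IsIsonormal.measure_small_ball_le`), and Borel–Cantelli over a
grid in `(t, θ)` treats all points simultaneously.

Parts (i) and (ii) are deterministic. Split `X(s+h) - X(s)` into `B(s+h, H(s+h)) - B(s+h, H(s))` and
`B(s+h, H(s)) - B(s, H(s))`. The second piece has exponent exactly `H(s)`. The first is `p * (H(s+h)
- H(s))` plus a second order error, with `p` the `θ`-derivative at `(s, H(s))`. If `p ≠ 0`, the
roughness of `H` wins because `α_H < H`; if `p = 0`, the first piece is negligible because `H < 2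
α_H`.

For (iii), the derivative `Y(s)` along `H` is continuous in `s` and almost surely nonzero at any
fixed `s > 0`, so it is nonzero on an open set. For (iv), `Y` satisfies `P(|Y(s)| < 1/N) ≥ c/N` and
`P(|Y(s)|, |Y(t)| < 1/N) ≤ C N⁻² |s - t| ^ (-h)` on an interval where `H < h`. A second moment
argument then gives, with positive probability and for infinitely many `N`, that `N` times Lebesgue
measure on `{|Y| < 1/N}` has mass bounded below and bounded `γ`-energy, for `γ < 1 - h`
(`exists_frequently_energy`). By Frostman's method the zero set has dimension at least `γ`
(`hausdorffMeasure_ne_zero_of_energy`). The exponent is random because a zero occurs with positive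
probability somewhere, but with probability zero at any prescribed point. -/

theorem Lp_coeFn_sum_smul {α : Type*} [MeasurableSpace α] {μ : Measure α} {ι : Type*}
    (s : Finset ι) (c : ι → ℝ) (g : ι → Lp ℝ 2 μ) :
    (∑ i ∈ s, c i • g i : Lp ℝ 2 μ) =ᵐ[μ] fun ω => ∑ i ∈ s, c i * g i ω := by
  classical
  induction s using Finset.induction_on with
  | empty =>
    filter_upwards [Lp.coeFn_zero ℝ 2 μ] with ω hω
    simpa using hω
  | insert a s ha ih =>
    rw [Finset.sum_insert ha]
    filter_upwards [Lp.coeFn_add (c a • g a) (∑ i ∈ s, c i • g i), Lp.coeFn_smul (c a) (g a), ih]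
      with ω h1 h2 h3
    rw [h1, Finset.sum_insert ha, Pi.add_apply, h2, h3]
    simp

/-! ### Isonormal Gaussian maps and small ball estimates. -/

section Isonormal

variable {Ω : Type*} [MeasurableSpace Ω] {P : Measure Ω}
  {E : Type*} [NormedAddCommGroup E] [InnerProductSpace ℝ E]

/-- A continuous linear map `I` into `L²(P)` is isonormal if `I f` is a centered Gaussian variable
of variance `‖f‖²` for each `f`. -/
def IsIsonormal (I : E →L[ℝ] Lp ℝ 2 P) : Prop :=
  ∀ f, P.map (I f) = gaussianReal 0 (‖f‖₊ ^ 2)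

/-- A linear functional of the vector `(I f)` over `f ∈ J` is `I` of the corresponding linear
combination, which is Gaussian by assumption. -/
theorem IsIsonormal.isGaussianProcess {I : E →L[ℝ] Lp ℝ 2 P} (hI : IsIsonormal I) :
    IsGaussianProcess (fun (f : E) ω => I f ω) P where
  hasGaussianLaw J := by
    classical
    have hm : ∀ g : E, AEMeasurable (I g) P := fun g =>
      (Lp.aestronglyMeasurable (I g)).aemeasurable
    constructor
    refine isGaussian_of_map_eq_gaussianReal fun L => ?_
    refine ⟨0, ‖∑ i : J, L (Pi.single i 1) • (i : E)‖₊ ^ 2, ?_⟩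
    rw [← hI]
    have hX : AEMeasurable (fun ω => J.restrict (fun f : E => I f ω)) P :=
      aemeasurable_pi_lambda _ fun i => hm i
    rw [AEMeasurable.map_map_of_aemeasurable (by fun_prop) hX]
    refine Measure.map_congr ?_
    rw [map_sum]
    simp only [map_smul]
    filter_upwards [Lp_coeFn_sum_smul Finset.univ (fun i : J => L (Pi.single i 1))
      (fun i : J => I i)] with ω hω
    rw [hω]
    simp only [Function.comp_apply]
    conv_lhs => rw [← Finset.univ_sum_single (J.restrict fun f : E => I f ω)]
    rw [map_sum]
    refine Finset.sum_congr rfl fun i _ => ?_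
    have : (Pi.single i (J.restrict (fun f : E => I f ω) i) : J → ℝ)
        = (I i ω) • (Pi.single i (1 : ℝ) : J → ℝ) := by
      rw [← Pi.single_smul]; simp
    rw [this, map_smul, smul_eq_mul, mul_comm]

theorem IsIsonormal.integral_eq_zero {I : E →L[ℝ] Lp ℝ 2 P} (hI : IsIsonormal I) (f : E) :
    ∫ ω, I f ω ∂P = 0 := by
  have hm : AEMeasurable (I f) P := (Lp.aestronglyMeasurable (I f)).aemeasurable
  have := integral_map hm (f := fun x : ℝ => x) (by fun_prop)
  rw [hI f, integral_id_gaussianReal] at this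
  exact this.symm

theorem IsIsonormal.norm_eq {I : E →L[ℝ] Lp ℝ 2 P} (hI : IsIsonormal I) (f : E) :
    ‖I f‖ = ‖f‖ := by
  have hm : AEMeasurable (I f) P := (Lp.aestronglyMeasurable (I f)).aemeasurable
  have h1 : Var[I f; P] = ‖f‖ ^ 2 := by
    have := variance_map (X := id) (μ := P) (Y := I f) (by fun_prop) hm
    rw [hI f, variance_id_gaussianReal] at this
    simpa using this.symm
  rw [variance_of_integral_eq_zero hm (hI.integral_eq_zero f)] at h1
  have h2 : ‖I f‖ ^ 2 = ‖f‖ ^ 2 := by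
    rw [← h1, ← real_inner_self_eq_norm_sq, L2.inner_def]
    refine integral_congr_ae (Eventually.of_forall fun ω => ?_)
    simp [pow_two]
  exact (sq_eq_sq₀ (norm_nonneg _) (norm_nonneg _)).1 h2

variable [IsProbabilityMeasure P]

/-- Centered Gaussian laws survive `L²` limits: along an almost everywhere convergent subsequence
the characteristic functions converge, and the variances converge with the norms. -/
theorem IsIsonormal.of_dense {I : E →L[ℝ] Lp ℝ 2 P} {S : Set E} (hS : Dense S)
    (h : ∀ f ∈ S, P.map (I f) = gaussianReal 0 (‖f‖₊ ^ 2)) : IsIsonormal I := by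
  intro f
  obtain ⟨u, huS, hu⟩ := mem_closure_iff_seq_limit.1 (hS f)
  have hI : Tendsto (fun n => I (u n)) atTop (𝓝 (I f)) := (I.continuous.tendsto f).comp hu
  obtain ⟨ns, hns, hae⟩ := (tendstoInMeasure_of_tendsto_Lp hI).exists_seq_tendsto_ae
  have hm : ∀ g : E, AEMeasurable (I g) P := fun g => (Lp.aestronglyMeasurable (I g)).aemeasurable
  have : ∀ g : E, IsProbabilityMeasure (P.map (I g)) := fun g =>
    Measure.isProbabilityMeasure_map (hm g)
  refine Measure.ext_of_charFun ?_
  ext t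
  have hc : ∀ g : E, charFun (P.map (I g)) t = ∫ ω, Complex.exp (t * I g ω * Complex.I) ∂P := by
    intro g
    rw [charFun_apply_real, integral_map (hm g) (by fun_prop)]
  have h1 : Tendsto (fun n => charFun (P.map (I (u (ns n)))) t) atTop
      (𝓝 (charFun (P.map (I f)) t)) := by
    simp only [hc]
    refine tendsto_integral_of_dominated_convergence (fun _ => 1) ?_ (integrable_const _) ?_ ?_
    · intro n
      have := hm (u (ns n))
      refine AEMeasurable.aestronglyMeasurable ?_
      fun_prop
    · intro n
      refine Eventually.of_forall fun ω => ?_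
      rw [← Complex.ofReal_mul, Complex.norm_exp_ofReal_mul_I]
    · filter_upwards [hae] with ω hω
      have h2 : Continuous fun x : ℝ => Complex.exp (t * x * Complex.I) := by fun_prop
      exact (h2.tendsto _).comp hω
  have h2 : Tendsto (fun n => charFun (P.map (I (u (ns n)))) t) atTop
      (𝓝 (charFun (gaussianReal 0 (‖f‖₊ ^ 2)) t)) := by
    simp only [h _ (huS _), charFun_gaussianReal]
    have h3 : Tendsto (fun n => ‖u (ns n)‖) atTop (𝓝 ‖f‖) :=
      (hu.comp hns.tendsto_atTop).norm
    have h4 : Continuous fun x : ℝ =>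
        Complex.exp (t * (0 : ℝ) * Complex.I - (x : ℂ) ^ 2 * t ^ 2 / 2) := by fun_prop
    have h5 := (h4.tendsto _).comp h3
    simpa [Function.comp_def] using h5
  exact tendsto_nhds_unique h1 h2

theorem IsIsonormal.covariance_eq {I : E →L[ℝ] Lp ℝ 2 P} (hI : IsIsonormal I) (f g : E) :
    cov[I f, I g; P] = inner ℝ f g := by
  have h2 : inner ℝ (I f) (I g) = inner ℝ f g := by
    rw [real_inner_eq_norm_add_mul_self_sub_norm_mul_self_sub_norm_mul_self_div_two,
      real_inner_eq_norm_add_mul_self_sub_norm_mul_self_sub_norm_mul_self_div_two, ← map_add,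
      hI.norm_eq, hI.norm_eq, hI.norm_eq]
  rw [← h2, covariance_eq_sub (Lp.memLp _) (Lp.memLp _), hI.integral_eq_zero, L2.inner_def]
  simp [mul_comm]

/-- The density is at most `1 / (2σ)` because `2π ≥ 4`, and the interval has length `2r`. -/
theorem gaussianReal_interval_le {σ : ℝ≥0} (hσ : 0 < σ) (u r : ℝ) :
    gaussianReal 0 (σ ^ 2) {x | |x + u| < r} ≤ ENNReal.ofReal (r / σ) := by
  have hv : σ ^ 2 ≠ 0 := pow_ne_zero 2 hσ.ne'
  rw [gaussianReal_apply 0 hv]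
  have hb : ∀ x, gaussianPDF 0 (σ ^ 2) x ≤ ENNReal.ofReal (1 / (2 * σ)) := by
    intro x
    rw [gaussianPDF]
    refine ENNReal.ofReal_le_ofReal ?_
    rw [gaussianPDFReal]
    have h1 : Real.exp (-(x - 0) ^ 2 / (2 * ((σ ^ 2 : ℝ≥0) : ℝ))) ≤ 1 := by
      rw [Real.exp_le_one_iff]
      apply div_nonpos_of_nonpos_of_nonneg <;> [nlinarith [sq_nonneg (x - 0)]; positivity]
    have hs : (0 : ℝ) < σ := hσ
    have h2 : 2 * (σ : ℝ) ≤ √(2 * Real.pi * ((σ ^ 2 : ℝ≥0) : ℝ)) := by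
      apply Real.le_sqrt_of_sq_le
      push_cast
      nlinarith [Real.pi_gt_three, sq_nonneg (σ : ℝ)]
    calc (√(2 * Real.pi * ((σ ^ 2 : ℝ≥0) : ℝ)))⁻¹ * _
        ≤ (√(2 * Real.pi * ((σ ^ 2 : ℝ≥0) : ℝ)))⁻¹ * 1 := by gcongr
      _ ≤ 1 / (2 * σ) := by
        rw [mul_one, ← one_div]
        exact one_div_le_one_div_of_le (by positivity) h2
  calc ∫⁻ x in {x | |x + u| < r}, gaussianPDF 0 (σ ^ 2) x
      ≤ ∫⁻ x in {x | |x + u| < r}, ENNReal.ofReal (1 / (2 * σ)) := lintegral_mono hb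
    _ = ENNReal.ofReal (1 / (2 * σ)) * volume {x : ℝ | |x + u| < r} := by simp
    _ = ENNReal.ofReal (r / σ) := by
      have : {x : ℝ | |x + u| < r} = Ioo (-u - r) (-u + r) := by
        ext x; simp only [mem_ofPred_eq, abs_lt, mem_Ioo]; constructor <;> rintro ⟨h1, h2⟩ <;>
          constructor <;> linarith
      rw [this, Real.volume_Ioo, ← ENNReal.ofReal_mul (by positivity)]
      congr 1
      field_simp
      ring

/-- Small ball estimate for finitely many Gaussian variables `I (f i)`, each of which has a
component `I (v i)` that is independent of its predecessors. -/
theorem IsIsonormal.measure_small_ball_le {I : E →L[ℝ] Lp ℝ 2 P} (hI : IsIsonormal I)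
    (f v : ℕ → E) (σ : ℕ → ℝ≥0) (r : ℝ) (L : ℕ)
    (h1 : ∀ l < L, ∀ i < l, inner ℝ (v l) (f i) = 0)
    (h2 : ∀ l < L, inner ℝ (v l) (f l - v l) = 0)
    (hσ : ∀ l < L, 0 < σ l) (h3 : ∀ l < L, σ l ≤ ‖v l‖₊) :
    P {ω | ∀ l < L, |I (f l) ω| < r} ≤ ∏ l ∈ Finset.range L, ENNReal.ofReal (r / σ l) := by
  have hm : ∀ g : E, AEMeasurable (I g) P := fun g => (Lp.aestronglyMeasurable (I g)).aemeasurable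
  induction L with
  | zero => simp
  | succ L ih =>
    have ih' := ih (fun l hl => h1 l (by omega)) (fun l hl => h2 l (by omega))
      (fun l hl => hσ l (by omega)) (fun l hl => h3 l (by omega))
    rw [Finset.prod_range_succ]
    refine le_trans ?_ (mul_le_mul_left ih' _)
    -- the process of predecessors
    let X : Option (Fin L) → Ω → ℝ := fun o => o.elim (I (f L - v L)) fun i => I (f i)
    let Y : Unit → Ω → ℝ := fun _ => I (v L)
    have hX : ∀ o, AEMeasurable (X o) P := by rintro (_ | i) <;> exact hm _
    have hind : IndepFun (fun ω o => X o ω) (fun ω t => Y t ω) P := by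
      refine IsGaussianProcess.indepFun_of_covariance_eq_zero ?_ hX (fun _ => hm _) ?_
      · have := hI.isGaussianProcess.comp_right (S := Option (Fin L) ⊕ Unit)
          (Sum.elim (fun o => o.elim (f L - v L) fun i => f i) fun _ => v L)
        refine this.congr fun t => ?_
        rcases t with (_ | i) | t <;> exact EventuallyEq.rfl
      · rintro (_ | i) t
        · change cov[I (f L - v L), I (v L); P] = 0
          rw [hI.covariance_eq, real_inner_comm]; exact h2 L (by omega)
        · change cov[I (f i), I (v L); P] = 0
          rw [hI.covariance_eq, real_inner_comm]; exact h1 L (by omega) i i.2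
    have hind2 : IndepFun (fun ω o => X o ω) (I (v L)) P :=
      hind.comp measurable_id (measurable_pi_apply ())
    have hXm : AEMeasurable (fun ω o => X o ω) P := aemeasurable_pi_lambda _ hX
    rw [indepFun_iff_map_prod_eq_prod_map_map hXm (hm _)] at hind2
    let A : Set ((Option (Fin L) → ℝ)) := {x | ∀ i : Fin L, |x (some i)| < r}
    have hA : MeasurableSet A := by
      have : A = ⋂ i : Fin L, {x | |x (some i)| < r} := by ext; simp [A]
      rw [this]
      exact MeasurableSet.iInter fun i =>
        measurableSet_lt (measurable_pi_apply (some i)).norm measurable_const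
    let T : Set ((Option (Fin L) → ℝ) × ℝ) := {p | p.1 ∈ A ∧ |p.2 + p.1 none| < r}
    have hT : MeasurableSet T := by
      refine MeasurableSet.inter (measurable_fst hA) ?_
      exact measurableSet_lt (measurable_snd.add
        ((measurable_pi_apply none).comp measurable_fst)).norm measurable_const
    have e1 : P {ω | ∀ l < L + 1, |I (f l) ω| < r}
        = P.map (fun ω => ((fun o => X o ω), I (v L) ω)) T := by
      rw [Measure.map_apply_of_aemeasurable (hXm.prodMk (hm _)) hT]
      refine measure_congr ?_
      have hs : I (f L) = I (f L - v L) + I (v L) := by rw [← map_add]; simp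
      filter_upwards [Lp.coeFn_add (I (f L - v L)) (I (v L))] with ω hω
      rw [← hs] at hω
      refine propext ?_
      change (∀ l < L + 1, |I (f l) ω| < r) ↔
        ((∀ i : Fin L, |I (f i) ω| < r) ∧ |I (v L) ω + I (f L - v L) ω| < r)
      rw [Pi.add_apply] at hω
      rw [add_comm (I (v L) ω), ← hω]
      constructor
      · exact fun h => ⟨fun i => h i (by omega), h L (by omega)⟩
      · rintro ⟨h, h'⟩ l hl
        rcases Nat.lt_succ_iff_lt_or_eq.1 hl with h'' | rfl
        exacts [h ⟨l, h''⟩, h']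
    have e2 : P {ω | ∀ l < L, |I (f l) ω| < r} = P.map (fun ω o => X o ω) A := by
      rw [Measure.map_apply_of_aemeasurable hXm hA]
      congr 1
      ext ω
      change (∀ l < L, |I (f l) ω| < r) ↔ (∀ i : Fin L, |I (f i) ω| < r)
      exact ⟨fun h i => h i i.2, fun h l hl => h ⟨l, hl⟩⟩
    rw [e1, e2, hind2, Measure.prod_apply hT]
    have hv : 0 < ‖v L‖₊ := (hσ L (by omega)).trans_le (h3 L (by omega))
    -- With the predecessors and the residual frozen, the new condition confines the Gaussian `I (v
    -- L)` to an interval of length `2r`, wherever its centre lies.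
    calc ∫⁻ x, P.map (I (v L)) (Prod.mk x ⁻¹' T) ∂P.map (fun ω o => X o ω)
        ≤ ∫⁻ x, A.indicator (fun _ => ENNReal.ofReal (r / σ L)) x ∂P.map (fun ω o => X o ω) := by
          refine lintegral_mono fun x => ?_
          by_cases hx : x ∈ A
          · have : Prod.mk x ⁻¹' T = {y | |y + x none| < r} := by
              ext y; simp [T, hx]
            rw [this, hI, indicator_of_mem hx]
            rcases le_or_gt r 0 with hr | hr
            · have : {y : ℝ | |y + x none| < r} = ∅ := by
                ext y; simp only [mem_ofPred_eq, mem_empty_iff_false, iff_false, not_lt]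
                exact hr.trans (abs_nonneg _)
              simp [this]
            refine (gaussianReal_interval_le hv _ _).trans (ENNReal.ofReal_le_ofReal ?_)
            have := hσ L (by omega)
            have h4 : (σ L : ℝ) ≤ ‖v L‖ := h3 L (by omega)
            exact div_le_div_of_nonneg_left hr.le this h4
          · have : Prod.mk x ⁻¹' T = ∅ := by
              ext y; simp [T, hx]
            rw [this]; simp
      _ = _ := by
          rw [lintegral_indicator_const hA, mul_comm]

end Isonormal


/-! ### Construction of an isonormal map from a Gaussian process. -/

section Isonormal

variable {Ω : Type*} [MeasurableSpace Ω] {P : Measure Ω} [IsProbabilityMeasure P]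
  {E : Type*} [NormedAddCommGroup E] [InnerProductSpace ℝ E]

/-- The families `v` and `w` have the same Gram matrix, so sending one to the other is isometric on
spans and extends by density. On the span the images are finite combinations of the Gaussian
process. -/
theorem exists_isIsonormal {ι : Type*} (v : ι → E) (w : ι → Ω → ℝ) (hw : IsGaussianProcess w P)
    (hmean : ∀ i, ∫ ω, w i ω ∂P = 0) (hcov : ∀ i j, cov[w i, w j; P] = inner ℝ (v i) (v j))
    (hdense : DenseRange (Finsupp.linearCombination ℝ v)) :
    ∃ I : E →L[ℝ] Lp ℝ 2 P, (∀ i, I (v i) =ᵐ[P] w i) ∧ IsIsonormal I := by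
  classical
  have hL : ∀ i, MemLp (w i) 2 P := fun i => (hw.hasGaussianLaw_eval i).memLp_two
  let wL : ι → Lp ℝ 2 P := fun i => (hL i).toLp
  have hin : ∀ i j, inner ℝ (wL i) (wL j) = inner ℝ (v i) (v j) := by
    intro i j
    rw [← hcov, covariance_eq_sub (hL i) (hL j), hmean, L2.inner_def]
    simp only [zero_mul, sub_zero]
    refine integral_congr_ae ?_
    filter_upwards [(hL i).coeFn_toLp, (hL j).coeFn_toLp] with ω h1 h2
    simp [wL, h1, h2, mul_comm]
  have hnorm : ∀ c : ι →₀ ℝ, ‖Finsupp.linearCombination ℝ wL c‖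
      = ‖Finsupp.linearCombination ℝ v c‖ := by
    intro c
    rw [← sq_eq_sq₀ (norm_nonneg _) (norm_nonneg _), ← real_inner_self_eq_norm_sq,
      ← real_inner_self_eq_norm_sq]
    simp only [Finsupp.linearCombination_apply, Finsupp.sum, sum_inner, inner_sum,
      real_inner_smul_left, real_inner_smul_right, hin]
  let I : E →L[ℝ] Lp ℝ 2 P :=
    (Finsupp.linearCombination ℝ wL).extendOfNorm (Finsupp.linearCombination ℝ v)
  have hI : ∀ c, I (Finsupp.linearCombination ℝ v c) = Finsupp.linearCombination ℝ wL c :=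
    LinearMap.extendOfNorm_eq hdense ⟨1, fun x => by rw [one_mul, hnorm]⟩
  refine ⟨I, fun i => ?_, ?_⟩
  · have := hI (Finsupp.single i 1)
    simp only [Finsupp.linearCombination_single, one_smul] at this
    rw [this]
    exact (hL i).coeFn_toLp
  · refine IsIsonormal.of_dense hdense ?_
    rintro _ ⟨c, rfl⟩
    have hg : HasGaussianLaw (fun ω => ∑ i ∈ c.support, c i • w i ω) P :=
      (hw.smul c).hasGaussianLaw_fun_sum
    have hae : (I (Finsupp.linearCombination ℝ v c) : Ω → ℝ)
        =ᵐ[P] fun ω => ∑ i ∈ c.support, c i • w i ω := by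
      rw [hI, Finsupp.linearCombination_apply, Finsupp.sum]
      have h1 : ∀ᵐ ω ∂P, ∀ i ∈ c.support, wL i ω = w i ω :=
        (ae_ball_iff c.support.countable_toSet).2 fun i _ => (hL i).coeFn_toLp
      filter_upwards [Lp_coeFn_sum_smul c.support c wL, h1] with ω h2 h3
      rw [h2]
      exact Finset.sum_congr rfl fun i hi => by rw [h3 i hi, smul_eq_mul]
    rw [Measure.map_congr hae, hg.map_eq_gaussianReal]
    have hmean' : ∫ ω, ∑ i ∈ c.support, c i • w i ω ∂P = 0 := by
      simp only [smul_eq_mul]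
      rw [integral_finsetSum _ fun i _ => ((hL i).integrable one_le_two).const_mul (c i)]
      simp [integral_const_mul, hmean]
    rw [hmean', variance_of_integral_eq_zero hg.aemeasurable hmean']
    congr 1
    rw [← NNReal.coe_inj, Real.coe_toNNReal _ (integral_nonneg fun ω => sq_nonneg _)]
    push_cast
    rw [← hnorm, ← hI, ← real_inner_self_eq_norm_sq, L2.inner_def]
    refine integral_congr_ae ?_
    filter_upwards [hae] with ω hω
    simp only [hω]
    simp [pow_two]

end Isonormal

/-! ### The Wiener integral. -/

section Wiener

/-- The indicator function of `(p.1, p.2]` as an element of `L²(ℝ)`. -/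
noncomputable def indicatorIoc (p : {p : ℝ × ℝ // p.1 ≤ p.2}) : Lp ℝ 2 (volume : Measure ℝ) :=
  indicatorConstLp 2 (measurableSet_Ioc : MeasurableSet (Ioc p.1.1 p.1.2))
    measure_Ioc_lt_top.ne (1 : ℝ)

/-- A function orthogonal to all these indicators has vanishing primitive, hence is zero by Lebesgue
differentiation. -/
theorem span_indicatorIoc_dense :
    (Submodule.span ℝ (range indicatorIoc)).topologicalClosure = ⊤ := by
  rw [Submodule.topologicalClosure_eq_top_iff, Submodule.eq_bot_iff]
  intro f hf
  have h1 : ∀ a b : ℝ, a ≤ b → ∫ x in Ioc a b, f x = 0 := by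
    intro a b hab
    have := (Submodule.mem_orthogonal _ _).1 hf (indicatorIoc ⟨(a, b), hab⟩)
      (Submodule.subset_span ⟨_, rfl⟩)
    rwa [indicatorIoc, L2.inner_indicatorConstLp_one] at this
  have hloc : LocallyIntegrable f volume :=
    (Lp.memLp f).locallyIntegrable one_le_two
  rw [← sub_eq_zero, sub_zero]
  refine (Lp.eq_zero_iff_ae_eq_zero).2 ?_
  filter_upwards [LocallyIntegrable.ae_hasDerivAt_integral hloc] with x hx
  have h2 : (fun y => ∫ t in (0 : ℝ)..y, f t) = fun _ => 0 := by
    ext y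
    rcases le_total 0 y with h | h
    · rw [intervalIntegral.integral_of_le h, h1 _ _ h]
    · rw [intervalIntegral.integral_of_ge h, h1 _ _ h, neg_zero]
  have h3 := hx 0
  rw [h2] at h3
  exact h3.unique (hasDerivAt_const x 0)

theorem volume_Ioc_inter_Ioc {a b c d : ℝ} (hab : a ≤ b) (hcd : c ≤ d) :
    (volume : Measure ℝ).real (Ioc a b ∩ Ioc c d)
      = (|b - c| + |a - d| - |b - d| - |a - c|) / 2 := by
  rw [Ioc_inter_Ioc, Measure.real, Real.volume_Ioc]
  rcases le_total (min b d - max a c) 0 with h | h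
  · rw [ENNReal.ofReal_of_nonpos h, ENNReal.toReal_zero]
    grind
  · rw [ENNReal.toReal_ofReal h]
    grind

variable {Ω : Type*} [MeasurableSpace Ω] {P : Measure Ω} [IsProbabilityMeasure P] {W : ℝ → Ω → ℝ}

/-- The map in `IsWienerIntegral` is existentially quantified for each integrand; density of the
interval indicators forces all these witnesses to coincide with one isonormal `I`. -/
theorem IsTwoSidedBrownianMotion.exists_wiener (hW : IsTwoSidedBrownianMotion P W) :
    ∃ I : Lp ℝ 2 (volume : Measure ℝ) →L[ℝ] Lp ℝ 2 P, IsIsonormal I ∧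
      ∀ (f : ℝ → ℝ) (Z : Ω → ℝ), IsWienerIntegral P W f Z ↔
        ∃ hf : MemLp f 2 (volume : Measure ℝ), Z =ᵐ[P] I (hf.toLp f) := by
  classical
  have hL : ∀ t, MemLp (W t) 2 P := fun t => (hW.isGaussianProcess.hasGaussianLaw_eval t).memLp_two
  have h1 : IsGaussianProcess (fun (p : {p : ℝ × ℝ // p.1 ≤ p.2}) ω => W p.1.2 ω - W p.1.1 ω) P :=
    hW.isGaussianProcess.of_isGaussianProcess fun p => ⟨{p.1.1, p.1.2},
      ContinuousLinearMap.proj (⟨p.1.2, by simp⟩ : ({p.1.1, p.1.2} : Finset ℝ)) -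
        ContinuousLinearMap.proj (⟨p.1.1, by simp⟩ : ({p.1.1, p.1.2} : Finset ℝ)), fun ω => by
          rw [sub_apply]; rfl⟩
  have h2 : ∀ p : {p : ℝ × ℝ // p.1 ≤ p.2}, ∫ ω, W p.1.2 ω - W p.1.1 ω ∂P = 0 := fun p => by
    rw [integral_sub ((hL _).integrable one_le_two) ((hL _).integrable one_le_two),
      hW.integral_eq_zero, hW.integral_eq_zero, sub_zero]
  have h3 : ∀ p q : {p : ℝ × ℝ // p.1 ≤ p.2},
      cov[W p.1.2 - W p.1.1, W q.1.2 - W q.1.1; P] = inner ℝ (indicatorIoc p) (indicatorIoc q) := by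
    intro p q
    rw [covariance_sub_left (hL _) (hL _) ((hL _).sub (hL _)),
      covariance_sub_right (hL _) (hL _) (hL _), covariance_sub_right (hL _) (hL _) (hL _),
      indicatorIoc, indicatorIoc, L2.inner_indicatorConstLp_one_indicatorConstLp_one _ _
        measure_Ioc_lt_top.ne measure_Ioc_lt_top.ne, volume_Ioc_inter_Ioc p.2 q.2]
    simp only [hW.covariance_eq, RCLike.ofReal_real_eq_id, id_eq]
    ring
  have h4 : DenseRange (Finsupp.linearCombination ℝ indicatorIoc) := by
    rw [DenseRange, ← LinearMap.coe_range, Finsupp.range_linearCombination]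
    exact Submodule.dense_iff_topologicalClosure_eq_top.2 span_indicatorIoc_dense
  obtain ⟨I, hI1, hI2⟩ := exists_isIsonormal indicatorIoc _ h1 h2 h3 h4
  refine ⟨I, hI2, fun f Z => ⟨?_, ?_⟩⟩
  · rintro ⟨I', hI', hf, hZ⟩
    refine ⟨hf, ?_⟩
    have : I' = I := by
      refine ContinuousLinearMap.ext_on (s := range indicatorIoc) ?_ ?_
      · exact Submodule.dense_iff_topologicalClosure_eq_top.2 span_indicatorIoc_dense
      · rintro _ ⟨p, rfl⟩
        exact Lp.ext ((hI' p.1.1 p.1.2 p.2).trans (hI1 p).symm)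
    rwa [← this]
  · rintro ⟨hf, hZ⟩
    exact ⟨I, fun a b hab => hI1 ⟨(a, b), hab⟩, hf, hZ⟩

end Wiener


/-! ### Parts (i) and (ii): pointwise exponents of a single regular realization. -/

section Pointwise

open Asymptotics

/-- This moves the comparison of exponents into little-o calculus. -/
theorem limsupQuotient_eq_zero_iff (f : ℝ → ℝ) (s α : ℝ) :
    limsupQuotient f s α = 0 ↔
      (fun h => f (s + h) - f s) =o[𝓝[≠] 0] fun h : ℝ => |h| ^ α := by
  have h1 : ((fun h => f (s + h) - f s) =o[𝓝[≠] 0] fun h : ℝ => |h| ^ α) ↔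
      Tendsto (fun h => |f (s + h) - f s| / |h| ^ α) (𝓝[≠] 0) (𝓝 0) := by
    rw [← isLittleO_norm_left, isLittleO_iff_tendsto']
    · rfl
    · filter_upwards [self_mem_nhdsWithin] with h hh h0
      exact absurd h0 (Real.rpow_pos_of_pos (abs_pos.2 hh) α).ne'
  rw [h1, limsupQuotient]
  have hnn : ∀ h : ℝ, 0 ≤ |f (s + h) - f s| / |h| ^ α := fun h => by positivity
  constructor
  · intro h
    have h2 : Tendsto (fun h : ℝ => ENNReal.ofReal (|f (s + h) - f s| / |h| ^ α)) (𝓝[≠] 0) (𝓝 0) :=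
      tendsto_of_le_liminf_of_limsup_le zero_le h.le
    have h3 := (ENNReal.tendsto_toReal ENNReal.zero_ne_top).comp h2
    simpa [Function.comp_def, ENNReal.toReal_ofReal (hnn _)] using h3
  · intro h
    have := (ENNReal.continuous_ofReal.tendsto 0).comp h
    rw [ENNReal.ofReal_zero] at this
    exact this.limsup_eq

theorem isLittleO_rpow_abs {α β : ℝ} (h : β < α) :
    (fun h : ℝ => |h| ^ α) =o[𝓝[≠] 0] fun h : ℝ => |h| ^ β := by
  rw [isLittleO_iff_tendsto']
  · have h1 : Tendsto (fun h : ℝ => |h| ^ (α - β)) (𝓝[≠] 0) (𝓝 0) := by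
      have : ContinuousAt (fun h : ℝ => |h| ^ (α - β)) 0 :=
        (Real.continuousAt_rpow_const _ _ (Or.inr (by linarith))).comp continuous_abs.continuousAt
      have h2 := this.tendsto
      rw [abs_zero, Real.zero_rpow (by linarith)] at h2
      exact h2.mono_left nhdsWithin_le_nhds
    refine h1.congr' ?_
    filter_upwards [self_mem_nhdsWithin] with h hh
    rw [Real.rpow_sub (abs_pos.2 hh)]
  · filter_upwards [self_mem_nhdsWithin] with h hh h0
    exact absurd h0 (Real.rpow_pos_of_pos (abs_pos.2 hh) β).ne'

theorem le_pointwiseHolderExponent {f : ℝ → ℝ} {s : ℝ} {β : ℝ≥0}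
    (h : (fun h => f (s + h) - f s) =o[𝓝[≠] 0] fun h : ℝ => |h| ^ (β : ℝ)) :
    (β : ℝ≥0∞) ≤ pointwiseHolderExponent f s :=
  le_iSup₂_of_le (f := fun (α : ℝ≥0) (_ : limsupQuotient f s α = 0) => (α : ℝ≥0∞)) β
    ((limsupQuotient_eq_zero_iff f s β).2 h) le_rfl

theorem isLittleO_of_lt_pointwiseHolderExponent {f : ℝ → ℝ} {s : ℝ} {β : ℝ≥0}
    (h : (β : ℝ≥0∞) < pointwiseHolderExponent f s) :
    (fun h => f (s + h) - f s) =o[𝓝[≠] 0] fun h : ℝ => |h| ^ (β : ℝ) := by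
  rw [pointwiseHolderExponent, lt_iSup_iff] at h
  obtain ⟨α, h⟩ := h
  rw [lt_iSup_iff] at h
  obtain ⟨h1, h2⟩ := h
  have h3 : (β : ℝ) < α := by exact_mod_cast h2
  exact ((limsupQuotient_eq_zero_iff f s α).1 h1).trans (isLittleO_rpow_abs h3)

variable {b : ℝ → ℝ → ℝ} {H : ℝ → ℝ} {s : ℝ}

theorem IsRegularRealization.isLittleO (hb : IsRegularRealization b) {θ β : ℝ}
    (hθ : θ ∈ Ioo (0 : ℝ) 1) (hβ : β < θ) :
    (fun h => b (s + h) θ - b s θ) =o[𝓝[≠] 0] fun h : ℝ => |h| ^ β := by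
  have := hb.limsup_eq_zero (θ - β) (by linarith) s θ hθ
  rw [sub_sub_cancel] at this
  exact (limsupQuotient_eq_zero_iff (fun t => b t θ) s β).1 this

theorem IsRegularRealization.not_isLittleO (hb : IsRegularRealization b) {θ β : ℝ}
    (hθ : θ ∈ Ioo (0 : ℝ) 1) (hβ : θ < β) :
    ¬ (fun h => b (s + h) θ - b s θ) =o[𝓝[≠] 0] fun h : ℝ => |h| ^ β := by
  intro h
  have := hb.limsup_eq_top (β - θ) (by linarith) s θ hθ
  rw [add_sub_cancel, (limsupQuotient_eq_zero_iff (fun t => b t θ) s β).2 h] at this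
  exact ENNReal.zero_ne_top this

theorem IsRegularRealization.hasDerivAt (hb : IsRegularRealization b) (t : ℝ) {θ : ℝ}
    (hθ : θ ∈ Ioo (0 : ℝ) 1) : HasDerivAt (b t) (partialTheta 1 b t θ) θ := by
  have h1 : DifferentiableAt ℝ (b t) θ :=
    (((hb.contDiffOn t).differentiableOn (by simp)) θ hθ).differentiableAt
      (isOpen_Ioo.mem_nhds hθ)
  simpa [partialTheta, iteratedDeriv_one] using h1.hasDerivAt

/-- First order expansion in the second variable. -/
theorem IsRegularRealization.exists_expansion (hb : IsRegularRealization b) (hH : Continuous H)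
    (hH1 : ∀ t, H t ∈ Ioo (0 : ℝ) 1) (s : ℝ) {ε : ℝ} (hε : 0 < ε) :
    ∃ C > 0, ∀ᶠ h in 𝓝[≠] (0 : ℝ),
      |b (s + h) (H (s + h)) - b (s + h) (H s) - partialTheta 1 b s (H s) * (H (s + h) - H s)|
        ≤ C * (|h| ^ (H s - ε) + |H (s + h) - H s|) * |H (s + h) - H s| := by
  obtain ⟨h0, h1⟩ := hH1 s
  obtain ⟨C, hC, hb'⟩ := hb.holder 1 ε (|s| + 1) (H s / 2) ((1 + H s) / 2) hε (by positivity)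
    (by linarith) (by linarith) (by linarith)
  refine ⟨C, hC, ?_⟩
  have hcont : Tendsto (fun h => H (s + h)) (𝓝[≠] 0) (𝓝 (H s)) := by
    have : Continuous fun h => H (s + h) := by fun_prop
    have h2 := this.tendsto 0
    rw [add_zero] at h2
    exact h2.mono_left nhdsWithin_le_nhds
  have hnear : ∀ᶠ h in 𝓝[≠] (0 : ℝ), |h| < 1 := by
    have : ∀ᶠ h in 𝓝 (0 : ℝ), |h| < 1 :=
      continuous_abs.tendsto' 0 0 abs_zero |>.eventually (gt_mem_nhds one_pos)
    exact this.filter_mono nhdsWithin_le_nhds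
  filter_upwards [self_mem_nhdsWithin, hnear,
    hcont (Ioo_mem_nhds (show H s / 2 < H s by linarith) (show H s < (1 + H s) / 2 by linarith))]
    with h hh hh1 hhH
  have hhpos : 0 < |h| := abs_pos.2 hh
  have hseg : segment ℝ (H s) (H (s + h)) ⊆ Icc (H s / 2) ((1 + H s) / 2) :=
    (convex_Icc _ _).segment_subset ⟨by linarith, by linarith⟩ ⟨hhH.1.le, hhH.2.le⟩
  -- Mean value inequality after subtracting the linear function with slope the derivative at `(s, H
  -- s)`; the Hölder property with `n = 1` bounds the difference of the slopes.
  have hmvt := (convex_segment (H s) (H (s + h))).norm_image_sub_le_of_norm_hasDerivWithin_le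
    (f := fun θ => b (s + h) θ - partialTheta 1 b s (H s) * θ)
    (f' := fun θ => partialTheta 1 b (s + h) θ - partialTheta 1 b s (H s))
    (C := C * (|h| ^ (H s - ε) + |H (s + h) - H s|)) (x := H s) (y := H (s + h)) ?_ ?_
    (left_mem_segment _ _ _) (right_mem_segment _ _ _)
  · rw [Real.norm_eq_abs, Real.norm_eq_abs] at hmvt
    convert hmvt using 2
    ring
  · intro θ hθ
    obtain ⟨h3, h4⟩ := hseg hθ
    have h5 := (hb.hasDerivAt (s + h) (θ := θ) ⟨by linarith, by linarith⟩).sub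
      ((hasDerivAt_id θ).const_mul (partialTheta 1 b s (H s)))
    simpa using! h5.hasDerivWithinAt
  · intro θ hθ
    have h3 := hb' (s + h) (abs_le.1 ((abs_add_le _ _).trans (by linarith))) s
      (abs_le.1 (by linarith)) θ (hseg hθ) (H s) ⟨by linarith, by linarith⟩
    rw [Real.norm_eq_abs]
    refine h3.trans ?_
    have h6 : |θ - H s| ≤ |H (s + h) - H s| := by
      rw [segment_eq_uIcc] at hθ
      exact abs_sub_left_of_mem_uIcc hθ
    have h7 : |s + h - s| ^ (max θ (H s) - ε) ≤ |h| ^ (H s - ε) := by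
      rw [add_sub_cancel_left]
      exact Real.rpow_le_rpow_of_exponent_ge hhpos hh1.le (by linarith [le_max_right θ (H s)])
    gcongr

theorem tendsto_increment_zero (hH : Continuous H) (s : ℝ) :
    Tendsto (fun h => H (s + h) - H s) (𝓝[≠] 0) (𝓝 0) := by
  have : Continuous fun h => H (s + h) - H s := by fun_prop
  have h2 := this.tendsto 0
  rw [add_zero, sub_self] at h2
  exact h2.mono_left nhdsWithin_le_nhds

theorem tendsto_rpow_abs_zero {α : ℝ} (hα : 0 < α) :
    Tendsto (fun h : ℝ => |h| ^ α) (𝓝[≠] 0) (𝓝 0) := by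
  have := isLittleO_rpow_abs hα
  simpa using this

/-- The part of the increment due to the change of parameter has the same order as the increment
`dH` of `H`, while the part at frozen parameter is `o(|h| ^ β)` for each `β < H s`. For such `β` the
increments of `X` and of `H` are therefore `o(|h| ^ β)` together, and the exponent of `H` lies in
this range. -/
theorem IsRegularRealization.pointwiseHolderExponent_of_ne_zero (hb : IsRegularRealization b)
    (hH : Continuous H) (hH1 : ∀ t, H t ∈ Ioo (0 : ℝ) 1)
    (hlt : pointwiseHolderExponent H s < ENNReal.ofReal (H s))
    (hne : partialTheta 1 b s (H s) ≠ 0) :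
    pointwiseHolderExponent (fun t => b t (H t)) s = pointwiseHolderExponent H s := by
  obtain ⟨h0, h1⟩ := hH1 s
  obtain ⟨C, hC, hexp⟩ := hb.exists_expansion hH hH1 s (ε := H s / 2) (by linarith)
  set p := partialTheta 1 b s (H s)
  set dH : ℝ → ℝ := fun h => H (s + h) - H s with hdH
  set D1 : ℝ → ℝ := fun h => b (s + h) (H (s + h)) - b (s + h) (H s) with hD1
  have hR : (fun h => D1 h - p * dH h) =o[𝓝[≠] 0] dH := by
    have h2 : (fun h => D1 h - p * dH h) =O[𝓝[≠] 0]
        fun h => (C * (|h| ^ (H s - H s / 2) + |dH h|)) * dH h := by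
      refine IsBigO.of_bound 1 ?_
      filter_upwards [hexp] with h hh
      rw [one_mul, norm_mul, Real.norm_eq_abs, Real.norm_eq_abs, Real.norm_eq_abs,
        abs_of_nonneg (a := C * _) (by positivity)]
      exact hh
    refine h2.trans_isLittleO ?_
    have h3 : Tendsto (fun h => C * (|h| ^ (H s - H s / 2) + |dH h|)) (𝓝[≠] 0) (𝓝 0) := by
      have := ((tendsto_rpow_abs_zero (α := H s - H s / 2) (by linarith)).add
        (tendsto_increment_zero hH s).abs).const_mul C
      simpa using this
    have := ((isLittleO_one_iff ℝ).2 h3).mul_isBigO (isBigO_refl dH (𝓝[≠] 0))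
    simpa using this
  have hpH : (fun h => p * dH h) =O[𝓝[≠] 0] dH := isBigO_const_mul_self p dH _
  have hHp : dH =O[𝓝[≠] 0] fun h => p * dH h := isBigO_self_const_mul hne dH _
  have hD1H : D1 =O[𝓝[≠] 0] dH := by
    have := hR.isBigO.add hpH
    simpa using this
  have hHD1 : dH =O[𝓝[≠] 0] D1 := by
    have h2 : (fun h => D1 h - p * dH h) =o[𝓝[≠] 0] fun h => p * dH h := hR.trans_isBigO hHp
    exact hHp.trans h2.right_isBigO_add |>.trans (by simpa using isBigO_refl _ _)
  have hkey : ∀ β : ℝ, β < H s →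
      ((fun h => b (s + h) (H (s + h)) - b s (H s)) =o[𝓝[≠] 0] (fun h : ℝ => |h| ^ β) ↔
        dH =o[𝓝[≠] 0] fun h : ℝ => |h| ^ β) := by
    intro β hβ
    have h2 := hb.isLittleO (s := s) (hH1 s) hβ
    constructor
    · intro h3
      refine hHD1.trans_isLittleO ?_
      have := h3.sub h2
      simpa [hD1] using this
    · intro h3
      have := (hD1H.trans_isLittleO h3).add h2
      simpa [hD1] using this
  have hltβ : ∀ β : ℝ≥0, (β : ℝ≥0∞) < ENNReal.ofReal (H s) → (β : ℝ) < H s := by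
    intro β hβ
    have := (ENNReal.lt_ofReal_iff_toReal_lt ENNReal.coe_ne_top).1 hβ
    simpa using this
  apply le_antisymm
  · by_contra! hcon
    obtain ⟨β, hβ1, hβ2⟩ := ENNReal.lt_iff_exists_nnreal_btwn.1 (lt_min hcon hlt)
    have h3 := isLittleO_of_lt_pointwiseHolderExponent (hβ2.trans_le (min_le_left _ _))
    have h4 := (hkey β (hltβ β (hβ2.trans_le (min_le_right _ _)))).1 h3
    exact absurd (le_pointwiseHolderExponent h4) (not_le.2 hβ1)
  · refine ENNReal.le_of_forall_nnreal_lt fun β hβ => ?_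
    have h3 := isLittleO_of_lt_pointwiseHolderExponent hβ
    exact le_pointwiseHolderExponent ((hkey β (hltβ β (hβ.trans hlt))).2 h3)

/-- Without a linear term the change of parameter contributes at most `(|h| ^ (H s - ε) + |dH|) *
|dH|`, where `dH = o(|h| ^ α)` for some `α > H s / 2`. This is of order beyond `|h| ^ (H s)`, so the
exact exponent of the frozen field decides. -/
theorem IsRegularRealization.pointwiseHolderExponent_of_eq_zero (hb : IsRegularRealization b)
    (hH : Continuous H) (hH1 : ∀ t, H t ∈ Ioo (0 : ℝ) 1)
    (hlt : ENNReal.ofReal (H s) < 2 * pointwiseHolderExponent H s)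
    (hz : partialTheta 1 b s (H s) = 0) :
    pointwiseHolderExponent (fun t => b t (H t)) s = ENNReal.ofReal (H s) := by
  obtain ⟨h0, h1⟩ := hH1 s
  obtain ⟨α, hα1, hα2⟩ : ∃ α : ℝ≥0, H s < 2 * α ∧ (α : ℝ≥0∞) < pointwiseHolderExponent H s := by
    have h2 : ENNReal.ofReal (H s / 2) < pointwiseHolderExponent H s := by
      rw [ENNReal.ofReal_div_of_pos two_pos, ENNReal.ofReal_ofNat]
      exact ENNReal.div_lt_of_lt_mul' hlt
    obtain ⟨α, h3, h4⟩ := ENNReal.lt_iff_exists_nnreal_btwn.1 h2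
    have := ENNReal.ofReal_lt_iff_lt_toReal (by positivity) ENNReal.coe_ne_top |>.1 h3
    exact ⟨α, by simp at this; linarith, h4⟩
  have hα0 : (0 : ℝ) < α := by linarith
  -- With this `ε` the two error terms have orders `H s + α / 2` and `2 * α`, both larger than `H
  -- s`.
  obtain ⟨C, hC, hexp⟩ := hb.exists_expansion hH hH1 s (ε := α / 2) (by linarith)
  set dH : ℝ → ℝ := fun h => H (s + h) - H s with hdH
  set D1 : ℝ → ℝ := fun h => b (s + h) (H (s + h)) - b (s + h) (H s) with hD1
  have hdo : dH =o[𝓝[≠] 0] fun h : ℝ => |h| ^ (α : ℝ) :=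
    isLittleO_of_lt_pointwiseHolderExponent hα2
  have hD1o : ∀ β : ℝ, β ≤ H s + α / 2 → β ≤ 2 * α → D1 =o[𝓝[≠] 0] fun h : ℝ => |h| ^ β := by
    intro β hβ1 hβ2
    have h2 : D1 =O[𝓝[≠] 0] fun h => (|h| ^ (H s - α / 2) + |dH h|) * dH h := by
      refine IsBigO.of_bound C ?_
      filter_upwards [hexp] with h hh
      rw [norm_mul, Real.norm_eq_abs, Real.norm_eq_abs, Real.norm_eq_abs,
        abs_of_nonneg (a := _ + _) (by positivity), ← mul_assoc]
      simpa [hz] using hh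
    have hmono : ∀ γ : ℝ, β ≤ γ →
        (fun h : ℝ => |h| ^ γ) =O[𝓝[≠] 0] fun h : ℝ => |h| ^ β := by
      intro γ hγ
      rcases hγ.eq_or_lt with rfl | h3
      exacts [isBigO_refl _ _, (isLittleO_rpow_abs h3).isBigO]
    have hmul : ∀ x y : ℝ, (fun h : ℝ => |h| ^ x * |h| ^ y) =O[𝓝[≠] 0]
        fun h : ℝ => |h| ^ (x + y) := by
      intro x y
      refine EventuallyEq.isBigO ?_
      filter_upwards [self_mem_nhdsWithin] with h hh
      rw [Real.rpow_add (abs_pos.2 hh)]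
    have h3 : (fun h => |h| ^ (H s - α / 2) * dH h) =o[𝓝[≠] 0] fun h : ℝ => |h| ^ β :=
      ((isBigO_refl _ _).mul_isLittleO hdo).trans_isBigO
        ((hmul _ _).trans (hmono _ (by linarith)))
    have h4 : (fun h => |dH h| * dH h) =o[𝓝[≠] 0] fun h : ℝ => |h| ^ β :=
      (hdo.norm_left.mul hdo).trans_isBigO ((hmul _ _).trans (hmono _ (by linarith)))
    refine h2.trans_isLittleO ?_
    have := h3.add h4
    simpa [add_mul] using this
  have hX : (fun h => b (s + h) (H (s + h)) - b s (H s))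
      = fun h => D1 h + (b (s + h) (H s) - b s (H s)) := by
    ext h; simp [hD1]
  apply le_antisymm
  · by_contra! hcon
    have h2 : ENNReal.ofReal (H s) < ENNReal.ofReal (min (H s + α / 2) (2 * α)) := by
      rw [ENNReal.ofReal_lt_ofReal_iff (by positivity)]
      exact lt_min (by linarith) hα1
    obtain ⟨β, hβ1, hβ2⟩ := ENNReal.lt_iff_exists_nnreal_btwn.1 (lt_min hcon h2)
    have h3 : H s < β := by
      have := (ENNReal.ofReal_lt_iff_lt_toReal h0.le ENNReal.coe_ne_top).1 hβ1
      simpa using this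
    have h4 : (β : ℝ) < min (H s + α / 2) (2 * α) := by
      have := (ENNReal.lt_ofReal_iff_toReal_lt ENNReal.coe_ne_top).1
        (hβ2.trans_le (min_le_right _ _))
      simpa using this
    have h5 := isLittleO_of_lt_pointwiseHolderExponent (hβ2.trans_le (min_le_left _ _))
    rw [hX] at h5
    refine hb.not_isLittleO (s := s) (hH1 s) h3 ?_
    have := h5.sub (hD1o β (h4.le.trans (min_le_left _ _)) (h4.le.trans (min_le_right _ _)))
    simpa using this
  · refine ENNReal.le_of_forall_nnreal_lt fun β hβ => ?_
    have h3 : (β : ℝ) < H s := by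
      have := (ENNReal.lt_ofReal_iff_toReal_lt ENNReal.coe_ne_top).1 hβ
      simpa using this
    refine le_pointwiseHolderExponent ?_
    rw [hX]
    exact (hD1o β (by linarith) (by linarith)).add (hb.isLittleO (hH1 s) h3)

end Pointwise


/-! ### Power series expansion of the kernel in `θ - 1/2`. -/

section Kernel

/-- `(log u) ^ n / n!` for `u > 0`, and zero otherwise. -/
noncomputable def logPow (n : ℕ) (u : ℝ) : ℝ := if 0 < u then Real.log u ^ n / n.factorial else 0

/-- The coefficient of `(θ - 1/2) ^ n` in the expansion of `fieldKernel t θ`. -/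
noncomputable def kernelCoeff (n : ℕ) (t x : ℝ) : ℝ := logPow n (t - x) - logPow n (-x)

/-- Translate and dilate. -/
noncomputable def rescale (a c : ℝ) (f : ℝ → ℝ) (x : ℝ) : ℝ := f ((x - a) / c)

theorem measurable_logPow (n : ℕ) : Measurable (logPow n) :=
  Measurable.ite measurableSet_Ioi (by fun_prop) measurable_const

theorem measurable_kernelCoeff (n : ℕ) (t : ℝ) : Measurable (kernelCoeff n t) :=
  ((measurable_logPow n).comp (by fun_prop)).sub ((measurable_logPow n).comp (by fun_prop))

theorem hasSum_logPow (p u : ℝ) : HasSum (fun n => p ^ n * logPow n u) (posPartPow u p) := by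
  by_cases hu : 0 < u
  · simp only [logPow, posPartPow, hu, if_true]
    rw [Real.rpow_def_of_pos hu, Real.exp_eq_exp_ℝ]
    have e : (fun n : ℕ => p ^ n * (Real.log u ^ n / n.factorial))
        = fun n : ℕ => (Real.log u * p) ^ n / n.factorial := by
      ext n; rw [mul_pow]; ring
    rw [e]
    exact NormedSpace.expSeries_div_hasSum_exp (𝔸 := ℝ) (Real.log u * p)
  · simp [logPow, posPartPow, hu]

theorem hasSum_fieldKernel (t θ x : ℝ) :
    HasSum (fun n => (θ - 1 / 2) ^ n * kernelCoeff n t x) (fieldKernel t θ x) := by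
  simpa [kernelCoeff, fieldKernel, mul_sub] using
    (hasSum_logPow (θ - 1 / 2) (t - x)).sub (hasSum_logPow (θ - 1 / 2) (-x))

/-- The binomial theorem for `(log h + log u) ^ n / n!`. -/
theorem logPow_mul {h : ℝ} (hh : 0 < h) (n : ℕ) (u : ℝ) :
    logPow n (h * u) =
      ∑ m ∈ Finset.HasAntidiagonal.antidiagonal n,
        Real.log h ^ m.1 / m.1.factorial * logPow m.2 u := by
  by_cases hu : 0 < u
  · have h1 : 0 < h * u := mul_pos hh hu
    simp only [logPow, h1, hu, if_true]
    rw [Real.log_mul hh.ne' hu.ne', (Commute.all _ _).add_pow', Finset.sum_div]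
    refine Finset.sum_congr rfl fun m hm => ?_
    rw [Finset.HasAntidiagonal.mem_antidiagonal] at hm
    have h2 := Nat.add_choose_mul_factorial_mul_factorial m.2 m.1
    rw [add_comm, hm] at h2
    have h3 : ((n.choose m.1 : ℕ) : ℝ) * m.1.factorial * m.2.factorial = n.factorial := by
      rw [mul_right_comm]
      exact_mod_cast h2
    have h4 : (m.1.factorial : ℝ) ≠ 0 := by exact_mod_cast m.1.factorial_ne_zero
    have h5 : (m.2.factorial : ℝ) ≠ 0 := by exact_mod_cast m.2.factorial_ne_zero
    have h6 : (n.factorial : ℝ) ≠ 0 := by exact_mod_cast n.factorial_ne_zero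
    rw [nsmul_eq_mul, div_mul_div_comm, div_eq_div_iff h6 (mul_ne_zero h4 h5), ← h3]
    ring
  · have h1 : ¬ 0 < h * u := by
      rw [not_lt] at *
      exact mul_nonpos_of_nonneg_of_nonpos hh.le hu
    simp [logPow, h1, hu]

/-- Self-similarity read off on coefficients: the factor `h ^ (θ - 1/2)` of the full kernel becomes
a convolution with the coefficients of the exponential of `(θ - 1/2) * log h`. -/
theorem kernelCoeff_add_sub {h : ℝ} (hh : 0 < h) (n : ℕ) (t x : ℝ) :
    kernelCoeff n (t + h) x - kernelCoeff n t x =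
      ∑ m ∈ Finset.HasAntidiagonal.antidiagonal n,
        Real.log h ^ m.1 / m.1.factorial * rescale t h (kernelCoeff m.2 1) x := by
  have h1 : t + h - x = h * (1 - (x - t) / h) := by field_simp; ring
  have h2 : t - x = h * -((x - t) / h) := by field_simp; ring
  simp only [kernelCoeff, rescale, mul_sub, Finset.sum_sub_distrib]
  rw [← logPow_mul hh, ← logPow_mul hh, ← h2, ← h1]
  ring

theorem posPartPow_mul {h : ℝ} (hh : 0 < h) (p u : ℝ) :
    posPartPow (h * u) p = h ^ p * posPartPow u p := by
  by_cases hu : 0 < u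
  · simp only [posPartPow, hu, mul_pos hh hu, if_true]
    rw [Real.mul_rpow hh.le hu.le]
  · have h1 : ¬ 0 < h * u := by
      rw [not_lt] at *
      exact mul_nonpos_of_nonneg_of_nonpos hh.le hu
    simp [posPartPow, h1, hu]

theorem fieldKernel_add_sub {h : ℝ} (hh : 0 < h) (θ t x : ℝ) :
    fieldKernel (t + h) θ x - fieldKernel t θ x =
      h ^ (θ - 1 / 2) * rescale t h (fieldKernel 1 θ) x := by
  have h1 : t + h - x = h * (1 - (x - t) / h) := by field_simp; ring
  have h2 : t - x = h * -((x - t) / h) := by field_simp; ring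
  simp only [fieldKernel, rescale, mul_sub]
  rw [← posPartPow_mul hh, ← posPartPow_mul hh, ← h2, ← h1]
  ring

theorem fieldKernel_zero (θ : ℝ) : fieldKernel 0 θ = 0 := by ext x; simp [fieldKernel]

theorem kernelCoeff_zero (n : ℕ) : kernelCoeff n 0 = 0 := by ext x; simp [kernelCoeff]

theorem map_rescale {a c : ℝ} (hc : 0 < c) :
    Measure.map (fun x : ℝ => (x - a) / c) volume = ENNReal.ofReal c • volume := by
  have h1 : (fun x : ℝ => (x - a) / c) = (fun x => c⁻¹ * x) ∘ fun x => x - a := by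
    ext x; simp [div_eq_inv_mul]
  rw [h1, ← Measure.map_map (by fun_prop) (by fun_prop),
    (measurePreserving_sub_right volume a).map_eq, Real.map_volume_mul_left (inv_ne_zero hc.ne'),
    inv_inv, abs_of_pos hc]

theorem eLpNorm_rescale {a c : ℝ} (hc : 0 < c) {f : ℝ → ℝ} (hf : AEStronglyMeasurable f volume) :
    eLpNorm (rescale a c f) 2 volume = ENNReal.ofReal (c ^ (1 / 2 : ℝ)) * eLpNorm f 2 volume := by
  have h1 : rescale a c f = f ∘ fun x => (x - a) / c := rfl
  have hf' : AEStronglyMeasurable f (Measure.map (fun x : ℝ => (x - a) / c) volume) := by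
    rw [map_rescale hc]; exact hf.smul_measure _
  rw [h1, ← eLpNorm_map_measure hf' (by fun_prop), map_rescale hc,
    eLpNorm_smul_measure_of_ne_top ENNReal.ofNat_ne_top, smul_eq_mul,
    ENNReal.ofReal_rpow_of_pos hc]
  norm_num

theorem aestronglyMeasurable_rescale {a c : ℝ} (hc : 0 < c) {f : ℝ → ℝ}
    (hf : AEStronglyMeasurable f volume) : AEStronglyMeasurable (rescale a c f) volume := by
  have hf' : AEStronglyMeasurable f (Measure.map (fun x : ℝ => (x - a) / c) volume) := by
    rw [map_rescale hc]; exact hf.smul_measure _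
  exact hf'.comp_measurable (by fun_prop)

theorem MeasureTheory.MemLp.rescale {a c : ℝ} (hc : 0 < c) {f : ℝ → ℝ} (hf : MemLp f 2 volume) :
    MemLp (rescale a c f) 2 volume := by
  refine ⟨aestronglyMeasurable_rescale hc hf.1, ?_⟩
  rw [eLpNorm_rescale hc hf.1]
  exact ENNReal.mul_lt_top ENNReal.ofReal_lt_top hf.2

/-- A square integrable function dominating the coefficients. -/
noncomputable def coeffMajorant (r u : ℝ) : ℝ :=
  if 0 < u then (if u ≤ 1 then u ^ (-r) else u ^ (r - 1)) else 0

theorem measurable_coeffMajorant (r : ℝ) : Measurable (coeffMajorant r) :=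
  Measurable.ite measurableSet_Ioi (Measurable.ite measurableSet_Iic (by fun_prop) (by fun_prop))
    measurable_const

theorem memLp_coeffMajorant {r : ℝ} (hr : r < 1 / 2) : MemLp (coeffMajorant r) 2 volume := by
  rw [memLp_two_iff_integrable_sq (measurable_coeffMajorant r).aestronglyMeasurable]
  have h1 : IntegrableOn (fun u : ℝ => u ^ (-(2 * r))) (Ioc 0 1) := by
    rw [← intervalIntegrable_iff_integrableOn_Ioc_of_le zero_le_one]
    exact intervalIntegral.intervalIntegrable_rpow' (by linarith)
  have h2 : IntegrableOn (fun u : ℝ => u ^ (2 * (r - 1))) (Ioi 1) :=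
    integrableOn_Ioi_rpow_of_lt (by linarith) one_pos
  have h3 := (h1.integrable_indicator measurableSet_Ioc).add
    (h2.integrable_indicator measurableSet_Ioi)
  refine h3.congr (Eventually.of_forall fun u => ?_)
  by_cases hu : 0 < u
  · by_cases hu1 : u ≤ 1
    · simp only [Pi.add_apply, indicator, mem_Ioc, mem_Ioi, hu, hu1, not_lt.2 hu1, coeffMajorant,
        if_true, if_false, and_self, add_zero]
      rw [← Real.rpow_natCast, ← Real.rpow_mul hu.le]
      congr 1; push_cast; ring
    · simp only [Pi.add_apply, indicator, mem_Ioc, mem_Ioi, hu, hu1, not_le.1 hu1, coeffMajorant,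
        if_true, if_false, and_false, zero_add]
      rw [← Real.rpow_natCast, ← Real.rpow_mul hu.le]
      congr 1; push_cast; ring
  · have : ¬ 1 < u := by linarith
    simp [indicator, hu, this, coeffMajorant]

theorem pow_div_factorial_le_exp {x : ℝ} (hx : 0 ≤ x) (n : ℕ) :
    x ^ n / n.factorial ≤ Real.exp x := Real.pow_div_factorial_le_exp x hx n

theorem abs_logPow_le {r : ℝ} (hr : 0 ≤ r) (n : ℕ) (u : ℝ) :
    r ^ n * |logPow n u| ≤ if 0 < u then Real.exp (r * |Real.log u|) else 0 := by
  by_cases hu : 0 < u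
  · simp only [logPow, hu, if_true]
    rw [abs_div, abs_pow, Nat.abs_cast, ← mul_div_assoc, ← mul_pow]
    exact pow_div_factorial_le_exp (by positivity) n
  · simp [logPow, hu]

/-- Near the singularities `x ^ n / n! ≤ exp x` replaces `r ^ n |log u| ^ n / n!` by `u ^ (-r)`. Far
to the left, the difference of the two logarithms is `O(1/v)`, which gives decay `v ^ (r - 1)`. Both
are square integrable for `r < 1/2`, uniformly in `n`. -/
theorem abs_kernelCoeff_le {r : ℝ} (hr : 0 < r) (hr2 : r < 1 / 2) (n : ℕ) (x : ℝ) :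
    r ^ n * |kernelCoeff n 1 x| ≤ coeffMajorant r (1 - x) + 3 * coeffMajorant r (-x) := by
  have hmnn : ∀ u, 0 ≤ coeffMajorant r u := by
    intro u
    unfold coeffMajorant
    split_ifs with h1 h2 <;> positivity
  have hsmall : ∀ u, 0 < u → u ≤ 1 → Real.exp (r * |Real.log u|) = coeffMajorant r u := by
    intro u h1 h2
    simp only [coeffMajorant, h1, h2, if_true]
    rw [Real.rpow_def_of_pos h1, abs_of_nonpos (Real.log_nonpos h1.le h2)]
    congr 1; ring
  rcases lt_or_ge x (-1) with hx | hx
  · -- far field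
    obtain ⟨v, rfl⟩ : ∃ v, x = -v := ⟨-x, by ring⟩
    have hv : 1 < v := by linarith
    have hv0 : 0 < v := by linarith
    simp only [kernelCoeff, logPow, sub_neg_eq_add, neg_neg, hv0, show 0 < 1 + v by linarith,
      if_true]
    have h1 : coeffMajorant r v = v ^ (r - 1) := by
      simp [coeffMajorant, hv0, hv]
    rw [h1]
    refine le_trans ?_ (le_add_of_nonneg_left (hmnn _))
    rcases n with _ | n
    · simp; positivity
    set a := Real.log (1 + v)
    set b := Real.log v
    have hb : 0 ≤ b := Real.log_nonneg hv.le
    have hab : b ≤ a := Real.log_le_log hv0 (by linarith)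
    have ha : 0 ≤ a := hb.trans hab
    have hd : a - b ≤ 1 / v := by
      rw [← Real.log_div (by linarith) hv0.ne']
      have := Real.log_le_sub_one_of_pos (show 0 < (1 + v) / v by positivity)
      refine this.trans (le_of_eq ?_)
      field_simp; ring
    -- The factor `n + 1` produced here is absorbed by `(n + 1)!`, leaving a term of the exponential
    -- series.
    have hpow : a ^ (n + 1) - b ^ (n + 1) ≤ (n + 1) * a ^ n * (a - b) := by
      have h2 : a ^ (n + 1) - b ^ (n + 1) =
          (∑ i ∈ Finset.range (n + 1), a ^ i * b ^ (n + 1 - 1 - i)) * (a - b) :=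
        ((Commute.all a b).geom_sum₂_mul (n + 1)).symm
      rw [h2]
      refine mul_le_mul_of_nonneg_right ?_ (by linarith)
      calc ∑ i ∈ Finset.range (n + 1), a ^ i * b ^ (n + 1 - 1 - i)
          ≤ ∑ i ∈ Finset.range (n + 1), a ^ n := by
            refine Finset.sum_le_sum fun i hi => ?_
            have hi' : i ≤ n := by simpa [Nat.lt_succ_iff] using hi
            calc a ^ i * b ^ (n + 1 - 1 - i) ≤ a ^ i * a ^ (n - i) := by
                  rw [Nat.add_sub_cancel]; gcongr
              _ = a ^ n := by rw [← pow_add, Nat.add_sub_cancel' hi']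
        _ = (n + 1) * a ^ n := by simp
    have hnn : 0 ≤ a ^ (n + 1) - b ^ (n + 1) := sub_nonneg.2 (by gcongr)
    have hexp : Real.exp (r * a) ≤ 2 * v ^ r := by
      have : Real.exp (r * a) = (1 + v) ^ r := by
        rw [Real.rpow_def_of_pos (by linarith), mul_comm]
      rw [this]
      calc (1 + v) ^ r ≤ (2 * v) ^ r := Real.rpow_le_rpow (by linarith) (by linarith) hr.le
        _ = 2 ^ r * v ^ r := Real.mul_rpow zero_le_two hv0.le
        _ ≤ 2 ^ (1 : ℝ) * v ^ r := by
          gcongr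
          · norm_num
          · linarith
        _ = 2 * v ^ r := by rw [Real.rpow_one]
    have hfac : ((n + 1).factorial : ℝ) = (n + 1) * n.factorial := by
      push_cast [Nat.factorial_succ]; ring
    have hfp : (0 : ℝ) < n.factorial := by exact_mod_cast n.factorial_pos
    calc r ^ (n + 1) * |a ^ (n + 1) / (n + 1).factorial - b ^ (n + 1) / (n + 1).factorial|
        = r ^ (n + 1) * ((a ^ (n + 1) - b ^ (n + 1)) / (n + 1).factorial) := by
          rw [← sub_div, abs_of_nonneg (by positivity)]
      _ ≤ r ^ (n + 1) * (((n + 1) * a ^ n * (1 / v)) / (n + 1).factorial) := by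
          gcongr
          exact hpow.trans (by gcongr)
      _ = r * ((r * a) ^ n / n.factorial) * (1 / v) := by
          rw [hfac, mul_pow, pow_succ]; field_simp
      _ ≤ 1 * (2 * v ^ r) * (1 / v) := by
          gcongr
          · linarith
          · exact (pow_div_factorial_le_exp (by positivity) n).trans hexp
      _ = 2 * v ^ (r - 1) := by
          rw [Real.rpow_sub_one hv0.ne']; ring
      _ ≤ 3 * v ^ (r - 1) := by
          have := Real.rpow_nonneg hv0.le (r - 1)
          linarith
  · have h1 : r ^ n * |kernelCoeff n 1 x| ≤
        r ^ n * |logPow n (1 - x)| + r ^ n * |logPow n (-x)| := by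
      rw [← mul_add]
      gcongr
      exact abs_sub _ _
    refine h1.trans ?_
    rcases lt_or_ge x 0 with hx0 | hx0
    · have h2 : r ^ n * |logPow n (1 - x)| ≤ 2 := by
        refine (abs_logPow_le hr.le n _).trans ?_
        rw [if_pos (by linarith), abs_of_nonneg (Real.log_nonneg (by linarith))]
        have h3 : Real.log (1 - x) ≤ Real.log 2 := Real.log_le_log (by linarith) (by linarith)
        calc Real.exp (r * Real.log (1 - x)) ≤ Real.exp (1 * Real.log 2) := by
              gcongr
              · exact Real.log_nonneg (by linarith)
              · linarith
          _ = 2 := by rw [one_mul, Real.exp_log two_pos]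
      have h3 : r ^ n * |logPow n (-x)| ≤ coeffMajorant r (-x) := by
        refine (abs_logPow_le hr.le n _).trans ?_
        rw [if_pos (by linarith), hsmall _ (by linarith) (by linarith)]
      have h4 : 1 ≤ coeffMajorant r (-x) := by
        rw [← hsmall _ (by linarith) (by linarith)]
        exact Real.one_le_exp (by positivity)
      linarith [hmnn (1 - x)]
    · have h3 : r ^ n * |logPow n (-x)| = 0 := by simp [logPow, hx0]
      have h2 : r ^ n * |logPow n (1 - x)| ≤ coeffMajorant r (1 - x) := by
        refine (abs_logPow_le hr.le n _).trans ?_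
        split_ifs with h5
        · rw [hsmall _ h5 (by linarith)]
        · exact hmnn _
      linarith [hmnn (-x)]

/-- Geometric control for every `r < 1/2` makes the radius of convergence at least `1/2`: the series
in `θ - 1/2` covers the whole parameter interval `(0, 1)`. -/
theorem exists_kernelCoeff_bound {r : ℝ} (hr : 0 < r) (hr2 : r < 1 / 2) :
    ∃ G : ℝ, 0 < G ∧ ∀ n, MemLp (kernelCoeff n 1) 2 volume ∧
      eLpNorm (kernelCoeff n 1) 2 volume ≤ ENNReal.ofReal (G / r ^ n) := by
  have h1 : MemLp (fun x => coeffMajorant r (1 - x) + 3 * coeffMajorant r (-x)) 2 volume := by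
    refine MemLp.add ?_ (MemLp.const_mul ?_ 3)
    · exact (memLp_coeffMajorant hr2).comp_measurePreserving
        (Measure.measurePreserving_sub_left volume 1)
    · exact (memLp_coeffMajorant hr2).comp_measurePreserving
        (Measure.measurePreserving_neg volume)
  set g := fun x => coeffMajorant r (1 - x) + 3 * coeffMajorant r (-x)
  have h2 : ∀ n, eLpNorm (kernelCoeff n 1) 2 volume ≤
      ENNReal.ofReal ((r ^ n)⁻¹) * eLpNorm g 2 volume := by
    intro n
    refine eLpNorm_le_mul_eLpNorm_of_ae_le_mul (Eventually.of_forall fun x => ?_) 2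
    have h3 := abs_kernelCoeff_le hr hr2 n x
    rw [Real.norm_eq_abs, inv_mul_eq_div, le_div_iff₀ (by positivity), mul_comm]
    exact h3.trans (le_abs_self _)
  refine ⟨(eLpNorm g 2 volume).toReal + 1, by positivity, fun n => ?_⟩
  have h4 : ENNReal.ofReal ((r ^ n)⁻¹) * eLpNorm g 2 volume ≤
      ENNReal.ofReal (((eLpNorm g 2 volume).toReal + 1) / r ^ n) := by
    rw [div_eq_inv_mul, ENNReal.ofReal_mul (by positivity)]
    gcongr
    rw [← ENNReal.ofReal_toReal h1.2.ne]
    refine ENNReal.ofReal_le_ofReal ?_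
    rw [ENNReal.toReal_ofReal ENNReal.toReal_nonneg]
    linarith
  exact ⟨⟨(measurable_kernelCoeff n 1).aestronglyMeasurable,
    ((h2 n).trans h4).trans_lt ENNReal.ofReal_lt_top⟩, (h2 n).trans h4⟩

theorem memLp_kernelCoeff_one (n : ℕ) : MemLp (kernelCoeff n 1) 2 volume := by
  obtain ⟨G, -, h⟩ := exists_kernelCoeff_bound (r := 1 / 4) (by norm_num) (by norm_num)
  exact (h n).1

theorem memLp_of_increments {g : ℝ → ℝ → ℝ} (h0 : MemLp (g 0) 2 volume)
    (h : ∀ t, ∀ h > 0, MemLp (fun x => g (t + h) x - g t x) 2 volume) (t : ℝ) :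
    MemLp (g t) 2 volume := by
  rcases lt_trichotomy t 0 with ht | rfl | ht
  · have := h0.sub (h t (-t) (by linarith))
    convert this using 1
    ext x; simp
  · exact h0
  · have := (h 0 t ht).add h0
    convert this using 1
    ext x; simp

theorem memLp_kernelCoeff (n : ℕ) (t : ℝ) : MemLp (kernelCoeff n t) 2 volume := by
  refine memLp_of_increments (g := kernelCoeff n) ?_ ?_ t
  · rw [kernelCoeff_zero]; exact MemLp.zero
  · intro t h hh
    simp only [kernelCoeff_add_sub hh]
    exact memLp_finsetSum _ fun m _ => ((memLp_kernelCoeff_one m.2).rescale hh).const_mul _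

/-- An `L²` sum and a pointwise sum of the same terms agree, since partial sums converge almost
everywhere along a subsequence. -/
theorem ae_eq_of_hasSum {α : Type*} [MeasurableSpace α] {μ : Measure α} {g : ℕ → Lp ℝ 2 μ}
    {G : Lp ℝ 2 μ} {u : ℕ → α → ℝ} {U : α → ℝ} (hg : HasSum g G) (hu : ∀ n, u n =ᵐ[μ] g n)
    (hU : ∀ᵐ x ∂μ, HasSum (fun n => u n x) (U x)) : U =ᵐ[μ] G := by
  obtain ⟨ns, hns, hae⟩ := (tendstoInMeasure_of_tendsto_Lp hg.tendsto_sum_nat).exists_seq_tendsto_ae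
  have h1 : ∀ᵐ x ∂μ, ∀ N : ℕ, (∑ n ∈ Finset.range N, g n : Lp ℝ 2 μ) x
      = ∑ n ∈ Finset.range N, g n x := by
    rw [ae_all_iff]
    intro N
    induction N with
    | zero =>
      filter_upwards [Lp.coeFn_zero ℝ 2 μ] with x hx
      simpa using hx
    | succ N ih =>
      rw [Finset.sum_range_succ]
      filter_upwards [ih, Lp.coeFn_add (∑ n ∈ Finset.range N, g n) (g N)] with x h2 h3
      rw [h3, Pi.add_apply, h2, Finset.sum_range_succ]
  filter_upwards [hae, h1, hU, ae_all_iff.2 hu] with x h2 h3 h4 h5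
  have h6 := h4.tendsto_sum_nat.comp hns.tendsto_atTop
  refine tendsto_nhds_unique h6 (h2.congr fun i => ?_)
  rw [h3]
  exact Finset.sum_congr rfl fun n _ => (h5 n).symm

theorem summable_pow_smul {F : Type*} [NormedAddCommGroup F] [NormedSpace ℝ F] [CompleteSpace F]
    {g : ℕ → F} {y r G : ℝ} (hr1 : |y| < r) (hg : ∀ n, ‖g n‖ ≤ G / r ^ n) :
    Summable fun n => y ^ n • g n := by
  have hr : 0 < r := (abs_nonneg _).trans_lt hr1
  refine Summable.of_norm_bounded (g := fun n => G * (|y| / r) ^ n) ?_ fun n => ?_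
  · exact (summable_geometric_of_lt_one (by positivity) ((div_lt_one hr).2 hr1)).mul_left G
  · rw [norm_smul, norm_pow, Real.norm_eq_abs, div_pow]
    calc |y| ^ n * ‖g n‖ ≤ |y| ^ n * (G / r ^ n) := by gcongr; exact hg n
      _ = _ := by ring

/-- The image of `kernelCoeff n 1` under the unitary rescaling of `L²(ℝ)`. -/
noncomputable def unitCoeff (a c : ℝ) (n : ℕ) (x : ℝ) : ℝ :=
  c ^ (-1 / 2 : ℝ) * rescale a c (kernelCoeff n 1) x

theorem memLp_unitCoeff (a : ℝ) {c : ℝ} (hc : 0 < c) (n : ℕ) :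
    MemLp (unitCoeff a c n) 2 volume :=
  ((memLp_kernelCoeff_one n).rescale hc).const_mul _

theorem norm_unitCoeff_le (a : ℝ) {c : ℝ} (hc : 0 < c) {n : ℕ} {B : ℝ} (hB : 0 ≤ B)
    (h : eLpNorm (kernelCoeff n 1) 2 volume ≤ ENNReal.ofReal B) :
    ‖(memLp_unitCoeff a hc n).toLp‖ ≤ B := by
  rw [Lp.norm_toLp]
  refine ENNReal.toReal_le_of_le_ofReal hB (le_trans (le_of_eq ?_) h)
  have : unitCoeff a c n = (c ^ (-1 / 2 : ℝ)) • rescale a c (kernelCoeff n 1) := rfl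
  rw [this, eLpNorm_const_smul, eLpNorm_rescale hc (memLp_kernelCoeff_one n).1, ← mul_assoc,
    Real.enorm_eq_ofReal (by positivity), ← ENNReal.ofReal_mul (by positivity),
    ← Real.rpow_add hc]
  norm_num

/-- The coefficient bounds give summability in `L²`, because the prefactor `c ^ (-1/2)` makes the
rescaling norm preserving; the sum is then identified pointwise. -/
theorem hasSum_unitCoeff {θ : ℝ} (hθ : θ ∈ Ioo (0 : ℝ) 1) (a : ℝ) {c : ℝ} (hc : 0 < c) :
    ∃ hK : MemLp (fun x => c ^ (-1 / 2 : ℝ) * rescale a c (fieldKernel 1 θ) x) 2 volume,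
      HasSum (fun n => (θ - 1 / 2) ^ n • (memLp_unitCoeff a hc n).toLp) hK.toLp := by
  obtain ⟨r, hr1, hr2⟩ : ∃ r, |θ - 1 / 2| < r ∧ r < 1 / 2 :=
    exists_between (abs_lt.2 ⟨by linarith [hθ.1], by linarith [hθ.2]⟩)
  have hr : 0 < r := (abs_nonneg _).trans_lt hr1
  obtain ⟨G, hG, hb⟩ := exists_kernelCoeff_bound hr hr2
  have hs : Summable fun n => (θ - 1 / 2) ^ n • (memLp_unitCoeff a hc n).toLp :=
    summable_pow_smul hr1 fun n => norm_unitCoeff_le a hc (by positivity) (hb n).2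
  have h1 := ae_eq_of_hasSum
    (U := fun x => c ^ (-1 / 2 : ℝ) * rescale a c (fieldKernel 1 θ) x)
    (u := fun n x => (θ - 1 / 2) ^ n * unitCoeff a c n x) hs.hasSum ?_ ?_
  · have hK := (memLp_congr_ae h1).2 (Lp.memLp _)
    refine ⟨hK, ?_⟩
    convert hs.hasSum
    exact Lp.ext (hK.coeFn_toLp.trans h1)
  · intro n
    filter_upwards [Lp.coeFn_smul ((θ - 1 / 2) ^ n) (memLp_unitCoeff a hc n).toLp,
      (memLp_unitCoeff a hc n).coeFn_toLp] with x h2 h3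
    rw [h2, Pi.smul_apply, h3, smul_eq_mul]
  · refine Eventually.of_forall fun x => ?_
    have := (hasSum_fieldKernel 1 θ ((x - a) / c)).mul_left (c ^ (-1 / 2 : ℝ))
    simpa only [unitCoeff, rescale, mul_left_comm] using this

theorem memLp_fieldKernel_one {θ : ℝ} (hθ : θ ∈ Ioo (0 : ℝ) 1) :
    MemLp (fieldKernel 1 θ) 2 volume := by
  obtain ⟨hK, -⟩ := hasSum_unitCoeff hθ 0 one_pos
  simpa [rescale] using hK

theorem memLp_fieldKernel {θ : ℝ} (hθ : θ ∈ Ioo (0 : ℝ) 1) (t : ℝ) :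
    MemLp (fieldKernel t θ) 2 volume := by
  refine memLp_of_increments (g := fun t => fieldKernel t θ) ?_ ?_ t
  · rw [fieldKernel_zero]; exact MemLp.zero
  · intro t h hh
    simp only [fieldKernel_add_sub hh]
    exact ((memLp_fieldKernel_one hθ).rescale hh).const_mul _

end Kernel


/-! ### Almost sure bounds for countable Gaussian families. -/

section RandomCoefficients

variable {Ω : Type*} [MeasurableSpace Ω] {P : Measure Ω}
  {E : Type*} [NormedAddCommGroup E] [InnerProductSpace ℝ E]

theorem IsIsonormal.lintegral_pow_le {I : E →L[ℝ] Lp ℝ 2 P} (hI : IsIsonormal I) (p : ℕ)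
    {f : E} (hf : ‖f‖ ≤ 1) :
    ∫⁻ ω, ‖I f ω‖ₑ ^ p ∂P ≤ ∫⁻ x, ‖x‖ₑ ^ p ∂gaussianReal 0 1 := by
  have hm : AEMeasurable (I f) P := (Lp.aestronglyMeasurable (I f)).aemeasurable
  have h1 : gaussianReal 0 (‖f‖₊ ^ 2) = (gaussianReal 0 1).map (‖f‖ * ·) := by
    rw [gaussianReal_map_const_mul, mul_zero, mul_one]
    congr 1
  have hg : Measurable fun x : ℝ => ‖x‖ₑ ^ p := by fun_prop
  calc ∫⁻ ω, ‖I f ω‖ₑ ^ p ∂P = ∫⁻ x, ‖x‖ₑ ^ p ∂(P.map (I f)) := by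
        rw [lintegral_map' hg.aemeasurable hm]
    _ = ∫⁻ x, ‖‖f‖ * x‖ₑ ^ p ∂gaussianReal 0 1 := by
        rw [hI f, h1, lintegral_map hg (by fun_prop)]
    _ ≤ ∫⁻ x, ‖x‖ₑ ^ p ∂gaussianReal 0 1 := by
        refine lintegral_mono fun x => ?_
        refine pow_le_pow_left₀ zero_le ?_ p
        rw [enorm_mul]
        have : ‖‖f‖‖ₑ ≤ 1 := by
          rw [enorm_norm, ← ofReal_norm]
          exact ENNReal.ofReal_le_one.2 hf
        exact mul_le_of_le_one_left zero_le this

theorem lintegral_pow_gaussianReal_lt_top (p : ℕ) :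
    ∫⁻ x, ‖x‖ₑ ^ p ∂gaussianReal 0 1 < ⊤ := by
  rcases Nat.eq_zero_or_pos p with rfl | hp
  · simp
  have h1 := memLp_id_gaussianReal (μ := 0) (v := 1) (p : ℝ≥0)
  have h2 := lintegral_rpow_enorm_lt_top_of_eLpNorm_lt_top (p := (p : ℝ≥0∞)) (by positivity)
    (by simp) (by simpa using h1.2)
  simpa using h2

/-- Countably many standard Gaussian variables are dominated by any weight that has a summable
negative power. -/
theorem IsIsonormal.ae_exists_bound {I : E →L[ℝ] Lp ℝ 2 P} (hI : IsIsonormal I) {ι : Type*}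
    [Countable ι] (f : ι → E) (hf : ∀ i, ‖f i‖ ≤ 1) (w : ι → ℝ) (hw : ∀ i, 0 < w i) {p : ℕ}
    (hp : p ≠ 0) (hs : Summable fun i => (w i ^ p)⁻¹) :
    ∀ᵐ ω ∂P, ∃ C : ℝ, 0 < C ∧ ∀ i, |I (f i) ω| ≤ C * w i := by
  have hm : ∀ i, AEMeasurable (fun ω => ‖I (f i) ω‖ₑ ^ p * ENNReal.ofReal ((w i ^ p)⁻¹)) P :=
    fun i => ((Lp.aestronglyMeasurable (I (f i))).enorm.pow_const p).mul_const _
  -- The weighted sum of `p`-th moments is finite, so the weighted sum of `p`-th powers is finite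
  -- almost surely and bounds each of its terms.
  have h1 : ∫⁻ ω, ∑' i, ‖I (f i) ω‖ₑ ^ p * ENNReal.ofReal ((w i ^ p)⁻¹) ∂P ≠ ⊤ := by
    rw [lintegral_tsum hm]
    refine ne_top_of_le_ne_top (b := (∫⁻ x, ‖x‖ₑ ^ p ∂gaussianReal 0 1) *
      ∑' i, ENNReal.ofReal ((w i ^ p)⁻¹)) ?_ ?_
    · refine ENNReal.mul_ne_top (lintegral_pow_gaussianReal_lt_top p).ne ?_
      exact hs.tsum_ofReal_ne_top
    · rw [← ENNReal.tsum_mul_left]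
      refine ENNReal.tsum_le_tsum fun i => ?_
      rw [lintegral_mul_const'' _ ((Lp.aestronglyMeasurable (I (f i))).enorm.pow_const p)]
      gcongr
      exact hI.lintegral_pow_le p (hf i)
  filter_upwards [ae_lt_top' (AEMeasurable.tsum hm) h1] with ω hω
  set S := ∑' i, ‖I (f i) ω‖ₑ ^ p * ENNReal.ofReal ((w i ^ p)⁻¹)
  refine ⟨S.toReal + 1, by positivity, fun i => ?_⟩
  have h2 : ‖I (f i) ω‖ₑ ^ p * ENNReal.ofReal ((w i ^ p)⁻¹) ≤ S := ENNReal.le_tsum i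
  have hwp : 0 < w i ^ p := pow_pos (hw i) p
  have h3 : (|I (f i) ω| / w i) ^ p ≤ S.toReal := by
    have := ENNReal.toReal_mono hω.ne h2
    rwa [ENNReal.toReal_mul, ENNReal.toReal_pow, toReal_enorm, Real.norm_eq_abs,
      ENNReal.toReal_ofReal (by positivity), ← div_eq_mul_inv, ← div_pow] at this
  have hS : 0 ≤ S.toReal := ENNReal.toReal_nonneg
  rw [← div_le_iff₀ (hw i)]
  refine le_of_pow_le_pow_left₀ hp (by positivity) (h3.trans ?_)
  calc S.toReal ≤ S.toReal + 1 := by linarith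
    _ ≤ (S.toReal + 1) ^ p := le_self_pow₀ (by linarith) hp

end RandomCoefficients

/-! ### Random power series coefficients on the dyadic grids. -/

section Grid

/-- The mesh of the dyadic grid of level `j`. -/
noncomputable def mesh (j : ℕ) : ℝ := (1 / 2 : ℝ) ^ j

theorem mesh_pos (j : ℕ) : 0 < mesh j := by unfold mesh; positivity

theorem mesh_le_one (j : ℕ) : mesh j ≤ 1 := pow_le_one₀ (by norm_num) (by norm_num)

variable {Ω : Type*} [MeasurableSpace Ω] {P : Measure Ω}

/-- The random coefficients of the field at time `t`. -/
noncomputable def pathCoeff (I : Lp ℝ 2 (volume : Measure ℝ) →L[ℝ] Lp ℝ 2 P) (ω : Ω) (n : ℕ)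
    (t : ℝ) : ℝ := I (memLp_kernelCoeff n t).toLp ω

/-- The normalized random coefficients of the increment of the field over a dyadic interval. -/
noncomputable def incrCoeff (I : Lp ℝ 2 (volume : Measure ℝ) →L[ℝ] Lp ℝ 2 P) (ω : Ω) (j : ℕ)
    (k : ℤ) (n : ℕ) : ℝ := I (memLp_unitCoeff (k * mesh j) (mesh_pos j) n).toLp ω

/-- The properties of the random coefficients from which a path of the field is constructed. -/
structure IsGoodCoeff (A : ℕ → ℝ → ℝ) (X : ℕ → ℤ → ℕ → ℝ) : Prop where
  zero : ∀ n, A n 0 = 0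
  incr : ∀ (j : ℕ) (k : ℤ) (n : ℕ), A n ((k + 1) * mesh j) - A n (k * mesh j) =
    mesh j ^ (1 / 2 : ℝ) * ∑ m ∈ Finset.HasAntidiagonal.antidiagonal n,
      Real.log (mesh j) ^ m.1 / m.1.factorial * X j k m.2
  bound : ∀ r < (1 / 2 : ℝ), 0 < r → ∀ ε > (0 : ℝ), ∃ C > 0, ∀ j k n,
    |X j k n| ≤ C * (((n + 1) * (j + 1) * (|(k : ℝ)| + 1)) ^ ε / r ^ n)

theorem summable_grid_weight :
    Summable fun i : ℕ × ℕ × ℤ => ((((i.2.2 : ℝ) ^ 2 + 1) * ((i.1 + 1 : ℝ) ^ 2 *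
      (i.2.1 + 1 : ℝ) ^ 2))⁻¹) := by
  have h1 : Summable fun n : ℕ => (((n : ℝ) + 1) ^ 2)⁻¹ := by
    have := (summable_nat_add_iff 1).2 (Real.summable_nat_pow_inv (p := 2) |>.2 one_lt_two)
    simpa using this
  have h2 : Summable fun k : ℤ => ((k : ℝ) ^ 2 + 1)⁻¹ := by
    have h3 : Summable fun k : ℤ => 1 / (k : ℝ) ^ 2 := Real.summable_one_div_int_pow.2 one_lt_two
    have h4 := h3.add (summable_of_hasFiniteSupport (f := fun k : ℤ => if k = 0 then (1 : ℝ) else 0)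
      ((finite_singleton (0 : ℤ)).subset (by intro k; simp)))
    refine Summable.of_nonneg_of_le (fun k => by positivity) (fun k => ?_) h4
    by_cases hk : k = 0
    · simp [hk]
    · have : (0 : ℝ) < (k : ℝ) ^ 2 := by positivity
      simp only [hk, if_false, add_zero, one_div]
      exact inv_anti₀ this (by linarith)
  have h5 := h1.mul_of_nonneg (h1.mul_of_nonneg h2 (fun _ => by positivity) fun _ => by positivity)
    (fun _ => by positivity) fun _ => by positivity
  refine h5.congr fun i => ?_
  simp only [mul_inv]
  ring

/-- The linear relations are images under `I` of identities between kernels, countably many of them.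
The growth bound applies the moment estimate to the family of all normalized dyadic coefficients at
once. -/
theorem IsIsonormal.ae_isGoodCoeff {I : Lp ℝ 2 (volume : Measure ℝ) →L[ℝ] Lp ℝ 2 P}
    (hI : IsIsonormal I) : ∀ᵐ ω ∂P, IsGoodCoeff (pathCoeff I ω) (incrCoeff I ω) := by
  have h1 : ∀ᵐ ω ∂P, ∀ n, pathCoeff I ω n 0 = 0 := by
    rw [ae_all_iff]
    intro n
    have : (memLp_kernelCoeff n 0).toLp = 0 := by
      refine Lp.ext ((MemLp.coeFn_toLp _).trans ?_)
      rw [kernelCoeff_zero]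
      exact (Lp.coeFn_zero ℝ 2 volume).symm
    simp only [pathCoeff, this, map_zero]
    exact Lp.coeFn_zero ℝ 2 P
  have h2 : ∀ᵐ ω ∂P, ∀ (j : ℕ) (k : ℤ) (n : ℕ),
      pathCoeff I ω n ((k + 1) * mesh j) - pathCoeff I ω n (k * mesh j) =
      mesh j ^ (1 / 2 : ℝ) * ∑ m ∈ Finset.HasAntidiagonal.antidiagonal n,
        Real.log (mesh j) ^ m.1 / m.1.factorial * incrCoeff I ω j k m.2 := by
    simp only [ae_all_iff]
    intro j k n
    have e : (memLp_kernelCoeff n ((k + 1) * mesh j)).toLp - (memLp_kernelCoeff n (k * mesh j)).toLp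
        = ∑ m ∈ Finset.HasAntidiagonal.antidiagonal n,
          (mesh j ^ (1 / 2 : ℝ) * (Real.log (mesh j) ^ m.1 / m.1.factorial)) •
            (memLp_unitCoeff (k * mesh j) (mesh_pos j) m.2).toLp := by
      rw [← MemLp.toLp_sub]
      refine Lp.ext ((MemLp.coeFn_toLp _).trans ?_)
      have e1 : ∀ᵐ x : ℝ, ∀ m ∈ Finset.HasAntidiagonal.antidiagonal n,
          ((memLp_unitCoeff (k * mesh j) (mesh_pos j) m.2).toLp : Lp ℝ 2 (volume : Measure ℝ)) x
            = unitCoeff (k * mesh j) (mesh j) m.2 x :=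
        (ae_ball_iff (Finset.countable_toSet _)).2 fun m _ => MemLp.coeFn_toLp _
      filter_upwards [Lp_coeFn_sum_smul (Finset.HasAntidiagonal.antidiagonal n)
        (fun m => mesh j ^ (1 / 2 : ℝ) * (Real.log (mesh j) ^ m.1 / m.1.factorial))
        (fun m => (memLp_unitCoeff (k * mesh j) (mesh_pos j) m.2).toLp), e1] with x h3 h4
      rw [h3, Pi.sub_apply, add_mul, one_mul, kernelCoeff_add_sub (mesh_pos j)]
      refine Finset.sum_congr rfl fun m hm => ?_
      rw [h4 m hm, unitCoeff]
      have h5 : mesh j ^ (1 / 2 : ℝ) * mesh j ^ (-1 / 2 : ℝ) = 1 := by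
        rw [← Real.rpow_add (mesh_pos j)]; norm_num
      linear_combination (-(Real.log (mesh j) ^ m.1 / m.1.factorial) *
        rescale (k * mesh j) (mesh j) (kernelCoeff m.2 1) x) * h5
    have e2 := congrArg I e
    rw [map_sub, map_sum] at e2
    simp only [map_smul] at e2
    filter_upwards [Lp.coeFn_sub (I (memLp_kernelCoeff n ((k + 1) * mesh j)).toLp)
      (I (memLp_kernelCoeff n (k * mesh j)).toLp),
      Lp_coeFn_sum_smul (Finset.HasAntidiagonal.antidiagonal n)
        (fun m => mesh j ^ (1 / 2 : ℝ) * (Real.log (mesh j) ^ m.1 / m.1.factorial))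
        (fun m => I (memLp_unitCoeff (k * mesh j) (mesh_pos j) m.2).toLp)] with ω h3 h4
    rw [← e2, h3, Pi.sub_apply] at h4
    rw [pathCoeff, pathCoeff, h4, Finset.mul_sum]
    refine Finset.sum_congr rfl fun m _ => ?_
    rw [incrCoeff]; ring
  have h3 : ∀ᵐ ω ∂P, ∀ q : ℕ, ∃ C > 0, ∀ j k n, |incrCoeff I ω j k n| ≤
      C * (((n + 1) * (j + 1) * (|(k : ℝ)| + 1)) ^ (1 / (q + 1) : ℝ) /
        (1 / 2 - 1 / (q + 3) : ℝ) ^ n) := by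
    rw [ae_all_iff]
    intro q
    -- As `q` grows, `r` tends to `1/2` and the growth exponent `1 / (q + 1)` to `0`, so one null
    -- set serves all real pairs `(r, ε)`.
    set r : ℝ := 1 / 2 - 1 / (q + 3) with hr
    have hq : (0 : ℝ) < 1 / (q + 3) := by positivity
    have hq2 : (1 : ℝ) / (q + 3) ≤ 1 / 3 :=
      one_div_le_one_div_of_le (by norm_num) (by linarith [(Nat.cast_nonneg q : (0 : ℝ) ≤ q)])
    have hr0 : 0 < r := by rw [hr]; linarith
    obtain ⟨G, hG, hb⟩ := exists_kernelCoeff_bound hr0 (by rw [hr]; linarith)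
    have hw0 : ∀ i : ℕ × ℕ × ℤ, 0 < ((i.1 + 1 : ℝ) * (i.2.1 + 1) * (|(i.2.2 : ℝ)| + 1)) :=
      fun i => by positivity
    -- The moment order `2 * (q + 1)` cancels the exponent `1 / (q + 1)` of the weight and leaves
    -- summable inverse squares.
    have hae := hI.ae_exists_bound (ι := ℕ × ℕ × ℤ)
      (fun i => (r ^ i.1 / G) • (memLp_unitCoeff (i.2.2 * mesh i.2.1) (mesh_pos i.2.1) i.1).toLp)
      (fun i => ?_)
      (fun i => ((i.1 + 1 : ℝ) * (i.2.1 + 1) * (|(i.2.2 : ℝ)| + 1)) ^ (1 / (q + 1) : ℝ))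
      (fun i => Real.rpow_pos_of_pos (hw0 i) _) (p := 2 * (q + 1)) (by omega) ?_
    · have hsm : ∀ᵐ ω ∂P, ∀ i : ℕ × ℕ × ℤ,
          I ((r ^ i.1 / G) • (memLp_unitCoeff (i.2.2 * mesh i.2.1) (mesh_pos i.2.1) i.1).toLp) ω
            = r ^ i.1 / G * incrCoeff I ω i.2.1 i.2.2 i.1 := by
        rw [ae_all_iff]
        intro i
        rw [map_smul]
        filter_upwards [Lp.coeFn_smul (r ^ i.1 / G)
          (I (memLp_unitCoeff (i.2.2 * mesh i.2.1) (mesh_pos i.2.1) i.1).toLp)] with ω hω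
        rw [hω]; rfl
      filter_upwards [hae, hsm] with ω hω hω2
      obtain ⟨C, hC, h4⟩ := hω
      refine ⟨C * G, by positivity, fun j k n => ?_⟩
      have h5 := h4 (n, j, k)
      rw [hω2, abs_mul, abs_of_pos (by positivity)] at h5
      rw [← mul_div_assoc, le_div_iff₀ (by positivity)]
      rw [div_mul_eq_mul_div, div_le_iff₀ hG] at h5
      linarith
    · rw [norm_smul, Real.norm_eq_abs, abs_of_pos (by positivity)]
      calc r ^ i.1 / G * _ ≤ r ^ i.1 / G * (G / r ^ i.1) := by
            gcongr
            exact norm_unitCoeff_le _ (mesh_pos _) (by positivity) (hb i.1).2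
        _ = 1 := by field_simp
    · refine Summable.of_nonneg_of_le (fun i => ?_) (fun i => ?_) summable_grid_weight
      · have := hw0 i
        positivity
      · have e : (((i.1 + 1 : ℝ) * (i.2.1 + 1) * (|(i.2.2 : ℝ)| + 1)) ^ (1 / (q + 1) : ℝ))
            ^ (2 * (q + 1)) = ((i.1 + 1 : ℝ) * (i.2.1 + 1) * (|(i.2.2 : ℝ)| + 1)) ^ 2 := by
          rw [← Real.rpow_natCast, ← Real.rpow_mul (hw0 i).le, ← Real.rpow_natCast]
          congr 1
          push_cast
          field_simp
        rw [e]
        refine inv_anti₀ (by positivity) ?_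
        have : (i.2.2 : ℝ) ^ 2 + 1 ≤ (|(i.2.2 : ℝ)| + 1) ^ 2 := by
          have := abs_nonneg (i.2.2 : ℝ)
          have := sq_abs (i.2.2 : ℝ)
          nlinarith
        calc _ ≤ (|(i.2.2 : ℝ)| + 1) ^ 2 * ((i.1 + 1 : ℝ) ^ 2 * (i.2.1 + 1 : ℝ) ^ 2) := by gcongr
          _ = _ := by ring
  filter_upwards [h1, h2, h3] with ω h4 h5 h6
  refine ⟨h4, h5, fun r hr hr0 ε hε => ?_⟩
  obtain ⟨q, hq1, hq2⟩ : ∃ q : ℕ, (1 : ℝ) / (q + 1) ≤ ε ∧ r ≤ 1 / 2 - 1 / (q + 3) := by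
    obtain ⟨q, hq⟩ := exists_nat_one_div_lt (lt_min hε (sub_pos.2 hr))
    refine ⟨q, hq.le.trans (min_le_left _ _), ?_⟩
    have h7 := hq.le.trans (min_le_right _ _)
    have h8 : (1 : ℝ) / (q + 3) ≤ 1 / (q + 1) :=
      one_div_le_one_div_of_le (by positivity) (by linarith)
    linarith
  obtain ⟨C, hC, hb⟩ := h6 q
  refine ⟨C, hC, fun j k n => (hb j k n).trans ?_⟩
  have h9 : (1 : ℝ) ≤ (n + 1) * (j + 1) * (|(k : ℝ)| + 1) := by
    have := abs_nonneg (k : ℝ)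
    have h10 : (1 : ℝ) ≤ (n + 1) * (j + 1) := by
      exact_mod_cast Nat.le_mul_of_pos_left _ (by omega) |>.trans' (by omega)
    nlinarith
  gcongr

end Grid


/-! ### Dyadic chaining in the time variable. -/

section Chaining

/-- The largest point of the dyadic grid of level `j` that is at most `t`. -/
noncomputable def dyadicFloor (j : ℕ) (t : ℝ) : ℝ := ⌊t / mesh j⌋ * mesh j

theorem mesh_succ (j : ℕ) : mesh j = 2 * mesh (j + 1) := by
  unfold mesh; rw [pow_succ]; ring

theorem mesh_rpow (j : ℕ) (γ : ℝ) : mesh j ^ γ = ((1 / 2 : ℝ) ^ γ) ^ j := by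
  rw [mesh, ← Real.rpow_natCast, ← Real.rpow_natCast, ← Real.rpow_mul (by norm_num),
    ← Real.rpow_mul (by norm_num), mul_comm]

theorem dyadicFloor_le (j : ℕ) (t : ℝ) : dyadicFloor j t ≤ t := by
  rw [dyadicFloor, ← le_div_iff₀ (mesh_pos j)]
  exact Int.floor_le _

theorem lt_dyadicFloor_add (j : ℕ) (t : ℝ) : t < dyadicFloor j t + mesh j := by
  have := Int.lt_floor_add_one (t / mesh j)
  rw [div_lt_iff₀ (mesh_pos j)] at this
  rw [dyadicFloor]
  linarith

/-- The grid point to the left of `t` may leave `[-M, M]` by one mesh; hence the margin `1` in the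
hypotheses of the chaining lemmas. -/
theorem abs_floor_mul_mesh_le {j : ℕ} {t M : ℝ} (ht : |t| ≤ M) :
    |((⌊t / mesh j⌋ : ℤ) : ℝ)| * mesh j ≤ M + 1 := by
  have h1 : |((⌊t / mesh j⌋ : ℤ) : ℝ)| * mesh j = |dyadicFloor j t| := by
    rw [dyadicFloor, abs_mul, abs_of_pos (mesh_pos j)]
  rw [h1]
  have := abs_le.1 ht
  have := dyadicFloor_le j t
  have := lt_dyadicFloor_add j t
  have := mesh_le_one j
  exact abs_le.2 ⟨by linarith, by linarith⟩

theorem tendsto_mesh : Tendsto mesh atTop (𝓝 0) :=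
  tendsto_pow_atTop_nhds_zero_of_lt_one (by norm_num) (by norm_num)

theorem tendsto_dyadicFloor (t : ℝ) : Tendsto (fun j => dyadicFloor j t) atTop (𝓝 t) := by
  have h1 : Tendsto (fun j => t - mesh j) atTop (𝓝 t) := by
    simpa using tendsto_mesh.const_sub t
  exact tendsto_of_tendsto_of_tendsto_of_le_of_le h1 tendsto_const_nhds
    (fun j => by linarith [lt_dyadicFloor_add j t]) fun j => dyadicFloor_le j t

/-- The limit along the dyadic approximations of `t`. -/
noncomputable def dyadicLim (φ : ℝ → ℂ) (t : ℝ) : ℂ :=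
  limUnder atTop fun j => φ (dyadicFloor j t)

variable {φ : ℝ → ℂ} {A γ M : ℝ}

theorem dist_dyadicFloor_succ_le (hA : 0 ≤ A) (hγ : 0 < γ)
    (h : ∀ (j : ℕ) (k : ℤ), |(k : ℝ)| * mesh j ≤ M + 1 →
      ‖φ ((k + 1) * mesh j) - φ (k * mesh j)‖ ≤ A * mesh j ^ γ)
    {t : ℝ} (ht : |t| ≤ M) (j : ℕ) :
    dist (φ (dyadicFloor j t)) (φ (dyadicFloor (j + 1) t)) ≤ A * ((1 / 2 : ℝ) ^ γ) ^ j := by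
  rw [← mesh_rpow]
  set k := ⌊t / mesh j⌋ with hk
  have h1 : dyadicFloor j t = ((2 * k : ℤ) : ℝ) * mesh (j + 1) := by
    rw [dyadicFloor, ← hk, mesh_succ j]; push_cast; ring
  have h2 : t / mesh (j + 1) = 2 * (t / mesh j) := by
    rw [mesh_succ j]
    have := mesh_pos (j + 1)
    field_simp
  have hk1 : (k : ℝ) ≤ t / mesh j := Int.floor_le _
  have hk2 : t / mesh j < k + 1 := Int.lt_floor_add_one _
  have h3 : ⌊t / mesh (j + 1)⌋ = 2 * k ∨ ⌊t / mesh (j + 1)⌋ = 2 * k + 1 := by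
    have h4 : 2 * k ≤ ⌊t / mesh (j + 1)⌋ := Int.le_floor.2 (by rw [h2]; push_cast; linarith)
    have h5 : ⌊t / mesh (j + 1)⌋ < 2 * k + 2 := Int.floor_lt.2 (by rw [h2]; push_cast; linarith)
    omega
  have hm : mesh (j + 1) ^ γ ≤ mesh j ^ γ :=
    Real.rpow_le_rpow (mesh_pos _).le (by rw [mesh_succ j]; linarith [mesh_pos (j + 1)]) hγ.le
  rcases h3 with h3 | h3
  · rw [h1, dyadicFloor, h3, dist_self]
    have := Real.rpow_nonneg (mesh_pos j).le γ
    positivity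
  · rw [h1, dyadicFloor, h3, dist_comm, dist_eq_norm]
    refine le_trans ?_ (mul_le_mul_of_nonneg_left hm hA)
    have h6 := h (j + 1) (2 * k) ?_
    · rwa [show (((2 * k + 1 : ℤ) : ℝ)) = ((2 * k : ℤ) : ℝ) + 1 by push_cast; rfl]
    · have := abs_floor_mul_mesh_le (j := j) ht
      rw [← hk, mesh_succ j] at this
      push_cast
      rw [abs_mul, abs_two]
      linarith

theorem half_rpow_lt_one (hγ : 0 < γ) : (1 / 2 : ℝ) ^ γ < 1 :=
  Real.rpow_lt_one (by norm_num) (by norm_num) hγ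

theorem tendsto_dyadicLim (hA : 0 ≤ A) (hγ : 0 < γ)
    (h : ∀ (j : ℕ) (k : ℤ), |(k : ℝ)| * mesh j ≤ M + 1 →
      ‖φ ((k + 1) * mesh j) - φ (k * mesh j)‖ ≤ A * mesh j ^ γ)
    {t : ℝ} (ht : |t| ≤ M) :
    Tendsto (fun j => φ (dyadicFloor j t)) atTop (𝓝 (dyadicLim φ t)) :=
  (cauchySeq_of_le_geometric _ A (half_rpow_lt_one hγ)
    (dist_dyadicFloor_succ_le hA hγ h ht)).tendsto_limUnder

theorem dist_dyadicLim_le (hA : 0 ≤ A) (hγ : 0 < γ)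
    (h : ∀ (j : ℕ) (k : ℤ), |(k : ℝ)| * mesh j ≤ M + 1 →
      ‖φ ((k + 1) * mesh j) - φ (k * mesh j)‖ ≤ A * mesh j ^ γ)
    {t : ℝ} (ht : |t| ≤ M) (j : ℕ) :
    dist (φ (dyadicFloor j t)) (dyadicLim φ t) ≤ A * mesh j ^ γ / (1 - (1 / 2 : ℝ) ^ γ) := by
  rw [mesh_rpow]
  exact dist_le_of_le_geometric_of_tendsto _ A (half_rpow_lt_one hγ)
    (dist_dyadicFloor_succ_le hA hγ h ht) (tendsto_dyadicLim hA hγ h ht) j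

/-- Kolmogorov's chaining argument. -/
theorem norm_dyadicLim_sub_le (hA : 0 ≤ A) (hγ : 0 < γ)
    (h : ∀ (j : ℕ) (k : ℤ), |(k : ℝ)| * mesh j ≤ M + 1 →
      ‖φ ((k + 1) * mesh j) - φ (k * mesh j)‖ ≤ A * mesh j ^ γ)
    {s t : ℝ} (hs : |s| ≤ M) (ht : |t| ≤ M) (hst : |s - t| ≤ 1) :
    ‖dyadicLim φ s - dyadicLim φ t‖ ≤
      A * (2 / (1 - (1 / 2 : ℝ) ^ γ) + 1) * 2 ^ γ * |s - t| ^ γ := by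
  wlog hle : s ≤ t generalizing s t
  · rw [norm_sub_rev, abs_sub_comm]
    exact this ht hs (by rwa [abs_sub_comm]) (le_of_not_ge hle)
  have hq := half_rpow_lt_one hγ
  rcases hle.eq_or_lt with rfl | hlt
  · simp [Real.zero_rpow hγ.ne']
  have hd : 0 < |s - t| := abs_pos.2 (by linarith)
  -- At the level where the mesh is comparable to `|s - t|`, the grid points below `s` and `t` are
  -- equal or adjacent.
  obtain ⟨j, hj1, hj2⟩ := exists_nat_pow_near_of_lt_one (y := (1 / 2 : ℝ)) hd hst (by norm_num)
    (by norm_num)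
  change mesh (j + 1) < _ at hj1
  change _ ≤ mesh j at hj2
  have hm := mesh_pos j
  have h1 : ‖φ (dyadicFloor j s) - φ (dyadicFloor j t)‖ ≤ A * mesh j ^ γ := by
    have h2 : s / mesh j ≤ t / mesh j := by gcongr
    have h3 : t / mesh j ≤ s / mesh j + 1 := by
      rw [div_add_one hm.ne']
      gcongr
      rw [abs_of_neg (by linarith)] at hj2
      linarith
    have h4 : ⌊t / mesh j⌋ = ⌊s / mesh j⌋ ∨ ⌊t / mesh j⌋ = ⌊s / mesh j⌋ + 1 := by
      have h5 := Int.floor_le_floor h2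
      have h6 := Int.floor_le_floor h3
      rw [Int.floor_add_one] at h6
      omega
    rcases h4 with h4 | h4
    · rw [dyadicFloor, dyadicFloor, h4, sub_self, norm_zero]
      positivity
    · rw [dyadicFloor, dyadicFloor, h4, norm_sub_rev]
      push_cast
      exact h j _ (abs_floor_mul_mesh_le hs)
  have h2 : mesh j ^ γ ≤ 2 ^ γ * |s - t| ^ γ := by
    rw [← Real.mul_rpow zero_le_two hd.le]
    refine Real.rpow_le_rpow hm.le ?_ hγ.le
    rw [mesh_succ j]
    linarith
  have h3 := dist_dyadicLim_le hA hγ h hs j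
  have h4 := dist_dyadicLim_le hA hγ h ht j
  rw [dist_eq_norm] at h3 h4
  have h5 : dyadicLim φ s - dyadicLim φ t = -(φ (dyadicFloor j s) - dyadicLim φ s) +
      (φ (dyadicFloor j s) - φ (dyadicFloor j t)) + (φ (dyadicFloor j t) - dyadicLim φ t) := by
    ring
  have hpos : 0 < 1 - (1 / 2 : ℝ) ^ γ := by linarith
  calc ‖dyadicLim φ s - dyadicLim φ t‖
      ≤ A * mesh j ^ γ / (1 - (1 / 2 : ℝ) ^ γ) + A * mesh j ^ γ
        + A * mesh j ^ γ / (1 - (1 / 2 : ℝ) ^ γ) := by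
        rw [h5]
        refine (norm_add₃_le).trans ?_
        rw [norm_neg]
        gcongr
    _ = A * (2 / (1 - (1 / 2 : ℝ) ^ γ) + 1) * mesh j ^ γ := by ring
    _ ≤ A * (2 / (1 - (1 / 2 : ℝ) ^ γ) + 1) * (2 ^ γ * |s - t| ^ γ) := by gcongr
    _ = _ := by ring

end Chaining

/-! ### Holomorphic dependence on the parameter along the dyadic grid. -/

section Series

/-- The power series in `z - 1/2` with coefficients `A n t`. -/
noncomputable def pathSeries (A : ℕ → ℝ → ℝ) (z : ℂ) (t : ℝ) : ℂ :=
  ∑' n, (z - 1 / 2) ^ n * (A n t : ℂ)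

/-- The power series in `z - 1/2` with coefficients `X j k n`. -/
noncomputable def incrSeries (X : ℕ → ℤ → ℕ → ℝ) (j : ℕ) (k : ℤ) (z : ℂ) : ℂ :=
  ∑' n, (z - 1 / 2) ^ n * (X j k n : ℂ)

variable {A : ℕ → ℝ → ℝ} {X : ℕ → ℤ → ℕ → ℝ}

/-- With `r < r' < 1/2`, the geometric factor `(r / r') ^ n` beats the polynomial growth in `n`.
Using the exponent `min ε 1` keeps that growth at most linear. -/
theorem IsGoodCoeff.exists_summable_bound (hg : IsGoodCoeff A X) {r : ℝ} (hr0 : 0 ≤ r)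
    (hr : r < 1 / 2) {ε : ℝ} (hε : 0 < ε) :
    ∃ c : ℕ → ℝ, Summable c ∧ (∀ n, 0 ≤ c n) ∧ ∀ j k n, ∀ z : ℂ, ‖z - 1 / 2‖ ≤ r →
      ‖(z - 1 / 2) ^ n * (X j k n : ℂ)‖ ≤ ((j + 1) * (|(k : ℝ)| + 1)) ^ ε * c n := by
  obtain ⟨r', hr1, hr2⟩ := exists_between hr
  have hr'0 : 0 < r' := hr0.trans_lt hr1
  obtain ⟨C, hC, hb⟩ := hg.bound r' hr2 hr'0 (min ε 1) (lt_min hε one_pos)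
  have hq : r / r' < 1 := (div_lt_one hr'0).2 hr1
  have hq0 : 0 ≤ r / r' := by positivity
  refine ⟨fun n => C * ((n + 1) * (r / r') ^ n), ?_, fun n => by positivity, ?_⟩
  · have h1 := summable_pow_mul_geometric_of_norm_lt_one (R := ℝ) 1
      (r := r / r') (by rwa [Real.norm_eq_abs, abs_of_nonneg hq0])
    have h2 := summable_geometric_of_lt_one hq0 hq
    refine ((h1.add h2).mul_left C).congr fun n => ?_
    ring
  · intro j k n z hz
    rw [norm_mul, norm_pow, Complex.norm_real, Real.norm_eq_abs]
    have hW : (1 : ℝ) ≤ (j + 1) * (|(k : ℝ)| + 1) := by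
      have := abs_nonneg (k : ℝ)
      have : (0 : ℝ) ≤ j := by positivity
      nlinarith
    have hmin : 0 < min ε 1 := lt_min hε one_pos
    calc ‖z - 1 / 2‖ ^ n * |X j k n|
        ≤ r ^ n * (C * (((n + 1) * (j + 1) * (|(k : ℝ)| + 1)) ^ (min ε 1) / r' ^ n)) := by
          gcongr
          exact hb j k n
      _ = C * ((((n : ℝ) + 1) ^ (min ε 1) * ((j + 1) * (|(k : ℝ)| + 1)) ^ (min ε 1))
            * (r / r') ^ n) := by
          rw [mul_assoc, Real.mul_rpow (by positivity) (by positivity), div_pow]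
          ring
      _ ≤ C * ((((n : ℝ) + 1) ^ (1 : ℝ) * ((j + 1) * (|(k : ℝ)| + 1)) ^ ε) * (r / r') ^ n) := by
          gcongr
          · linarith [(Nat.cast_nonneg n : (0 : ℝ) ≤ n)]
          · exact min_le_right _ _
          · exact min_le_left _ _
      _ = _ := by rw [Real.rpow_one]; ring

theorem IsGoodCoeff.summable_incr (hg : IsGoodCoeff A X) (j : ℕ) (k : ℤ) {z : ℂ}
    (hz : ‖z - 1 / 2‖ < 1 / 2) : Summable fun n => ‖(z - 1 / 2) ^ n * (X j k n : ℂ)‖ := by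
  obtain ⟨c, hc, -, hb⟩ := hg.exists_summable_bound (norm_nonneg (z - 1 / 2)) hz one_pos
  exact Summable.of_nonneg_of_le (fun n => norm_nonneg _) (fun n => hb j k n z le_rfl)
    (hc.mul_left _)

theorem IsGoodCoeff.exists_norm_incrSeries_le (hg : IsGoodCoeff A X) {r : ℝ} (hr0 : 0 ≤ r)
    (hr : r < 1 / 2) {ε : ℝ} (hε : 0 < ε) :
    ∃ C > 0, ∀ j k, ∀ z : ℂ, ‖z - 1 / 2‖ ≤ r →
      ‖incrSeries X j k z‖ ≤ C * ((j + 1) * (|(k : ℝ)| + 1)) ^ ε := by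
  obtain ⟨c, hc, hc0, hb⟩ := hg.exists_summable_bound hr0 hr hε
  have hs : 0 ≤ ∑' n, c n := tsum_nonneg hc0
  refine ⟨∑' n, c n + 1, by positivity, fun j k z hz => ?_⟩
  calc ‖incrSeries X j k z‖ ≤ ((j + 1) * (|(k : ℝ)| + 1)) ^ ε * ∑' n, c n :=
        tsum_of_norm_bounded (hc.hasSum.mul_left _) fun n => hb j k n z hz
    _ ≤ ((j + 1) * (|(k : ℝ)| + 1)) ^ ε * (∑' n, c n + 1) := by gcongr; linarith
    _ = _ := mul_comm _ _

theorem IsGoodCoeff.differentiableOn_incrSeries (hg : IsGoodCoeff A X) (j : ℕ) (k : ℤ) :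
    DifferentiableOn ℂ (incrSeries X j k) (Metric.ball (1 / 2) (1 / 2)) := by
  intro z hz
  rw [mem_ball_iff_norm] at hz
  obtain ⟨r, hr1, hr2⟩ := exists_between hz
  obtain ⟨c, hc, hc0, hb⟩ := hg.exists_summable_bound ((norm_nonneg _).trans hr1.le) hr2 one_pos
  have h1 : DifferentiableOn ℂ (incrSeries X j k) (Metric.ball (1 / 2) r) := by
    refine Complex.differentiableOn_tsum_of_summable_norm (hc.mul_left _) (fun n => ?_)
      Metric.isOpen_ball fun n w hw => hb j k n w ?_
    · fun_prop
    · exact (mem_ball_iff_norm.1 hw).le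
  exact (h1.differentiableAt (Metric.isOpen_ball.mem_nhds
    (mem_ball_iff_norm.2 hr1))).differentiableWithinAt

/-- The convolution in the coefficients is the Cauchy product of the exponential series of `(z -
1/2) * log mesh` with the normalized series; together with the prefactor `mesh ^ (1/2)` this gives
`mesh ^ z`. -/
theorem IsGoodCoeff.hasSum_incr (hg : IsGoodCoeff A X) (j : ℕ) (k : ℤ) {z : ℂ}
    (hz : ‖z - 1 / 2‖ < 1 / 2) :
    HasSum (fun n => (z - 1 / 2) ^ n * (A n ((k + 1) * mesh j) : ℂ) -
      (z - 1 / 2) ^ n * (A n (k * mesh j) : ℂ)) ((mesh j : ℂ) ^ z * incrSeries X j k z) := by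
  set L := Real.log (mesh j) with hL
  have hs1 : Summable fun n : ℕ => ‖((z - 1 / 2) * (L : ℂ)) ^ n / (n.factorial : ℂ)‖ :=
    NormedSpace.norm_expSeries_div_summable (𝔸 := ℂ) _
  have hs2 := hg.summable_incr j k hz
  have h1 := (summable_norm_sum_mul_antidiagonal_of_summable_norm hs1 hs2).of_norm.hasSum
  rw [← tsum_mul_tsum_eq_tsum_sum_antidiagonal_of_summable_norm hs1 hs2] at h1
  have h2 := h1.mul_left ((mesh j ^ (1 / 2 : ℝ) : ℝ) : ℂ)
  have hm : (mesh j : ℂ) ≠ 0 := by exact_mod_cast (mesh_pos j).ne'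
  have hexp : ∑' n : ℕ, ((z - 1 / 2) * (L : ℂ)) ^ n / (n.factorial : ℂ)
      = (mesh j : ℂ) ^ (z - 1 / 2) := by
    have := (NormedSpace.expSeries_div_hasSum_exp (𝔸 := ℂ) ((z - 1 / 2) * (L : ℂ))).tsum_eq
    rw [this, ← Complex.exp_eq_exp_ℂ, Complex.cpow_def_of_ne_zero hm, hL,
      Complex.ofReal_log (mesh_pos j).le, mul_comm]
  have hval : ((mesh j ^ (1 / 2 : ℝ) : ℝ) : ℂ) * ((mesh j : ℂ) ^ (z - 1 / 2) * incrSeries X j k z)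
      = (mesh j : ℂ) ^ z * incrSeries X j k z := by
    rw [Complex.ofReal_cpow (mesh_pos j).le, ← mul_assoc, ← Complex.cpow_add _ _ hm]
    congr 2
    push_cast
    ring
  rw [hexp] at h2
  change HasSum _ (((mesh j ^ (1 / 2 : ℝ) : ℝ) : ℂ) *
    ((mesh j : ℂ) ^ (z - 1 / 2) * incrSeries X j k z)) at h2
  rw [hval] at h2
  refine h2.congr_fun ?_ |> id
  intro n
  rw [← mul_sub, ← Complex.ofReal_sub, hg.incr]
  push_cast
  rw [Finset.mul_sum, Finset.mul_sum, Finset.mul_sum]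
  refine Finset.sum_congr rfl fun m hm => ?_
  rw [Finset.HasAntidiagonal.mem_antidiagonal] at hm
  rw [← hm, pow_add, mul_pow]
  ring

/-- All coefficients vanish at time `0`, and each step of the grid adds a convergent series. -/
theorem IsGoodCoeff.summable_path (hg : IsGoodCoeff A X) (j : ℕ) (k : ℤ) {z : ℂ}
    (hz : ‖z - 1 / 2‖ < 1 / 2) :
    Summable fun n => (z - 1 / 2) ^ n * (A n (k * mesh j) : ℂ) := by
  induction k using Int.induction_on with
  | zero => simp [hg.zero]
  | succ k ih =>
    have := (hg.hasSum_incr j k hz).summable.add ih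
    simpa using this
  | pred k ih =>
    have := ih.sub (hg.hasSum_incr j (-(k : ℤ) - 1) hz).summable
    simpa using this

theorem IsGoodCoeff.pathSeries_sub (hg : IsGoodCoeff A X) (j : ℕ) (k : ℤ) {z : ℂ}
    (hz : ‖z - 1 / 2‖ < 1 / 2) :
    pathSeries A z ((k + 1) * mesh j) - pathSeries A z (k * mesh j)
      = (mesh j : ℂ) ^ z * incrSeries X j k z := by
  have h1 := hg.summable_path j (k + 1) hz
  push_cast at h1
  rw [← (hg.hasSum_incr j k hz).tsum_eq, h1.tsum_sub (hg.summable_path j k hz)]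
  rfl

theorem IsGoodCoeff.pathSeries_zero (hg : IsGoodCoeff A X) (z : ℂ) : pathSeries A z 0 = 0 := by
  simp [pathSeries, hg.zero]

theorem IsGoodCoeff.differentiableOn_pathSeries (hg : IsGoodCoeff A X) (j : ℕ) (k : ℤ) :
    DifferentiableOn ℂ (fun z => pathSeries A z (k * mesh j)) (Metric.ball (1 / 2) (1 / 2)) := by
  have hm : (mesh j : ℂ) ≠ 0 := by exact_mod_cast (mesh_pos j).ne'
  have hd : ∀ k : ℤ, DifferentiableOn ℂ (fun z => (mesh j : ℂ) ^ z * incrSeries X j k z)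
      (Metric.ball (1 / 2) (1 / 2)) := fun k =>
    (differentiableOn_id.const_cpow (Or.inl hm)).mul (hg.differentiableOn_incrSeries j k)
  induction k using Int.induction_on with
  | zero => simp [hg.pathSeries_zero]
  | succ k ih =>
    refine ((hd k).add ih).congr fun z hz => ?_
    have := hg.pathSeries_sub j k (mem_ball_iff_norm.1 hz)
    push_cast at this ⊢
    rw [Pi.add_apply, ← this, sub_add_cancel]
  | pred k ih =>
    refine (ih.sub (hd (-(k : ℤ) - 1))).congr fun z hz => ?_
    have := hg.pathSeries_sub j (-(k : ℤ) - 1) (mem_ball_iff_norm.1 hz)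
    push_cast at this ⊢
    rw [Pi.sub_apply, ← this]
    simp

/-- On a bounded time range `(j + 1) * (|k| + 1)` is at most a constant times `mesh ^ (-2)`, so its
power `ε / 2` costs only `mesh ^ (-ε)`. -/
theorem IsGoodCoeff.exists_increment_bound (hg : IsGoodCoeff A X) {r : ℝ} (hr0 : 0 ≤ r)
    (hr : r < 1 / 2) {ε : ℝ} (hε : 0 < ε) {M : ℝ} (hM : 0 ≤ M) :
    ∃ C > 0, ∀ (j : ℕ) (k : ℤ) (z : ℂ), ‖z - 1 / 2‖ ≤ r → |(k : ℝ)| * mesh j ≤ M →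
      ‖pathSeries A z ((k + 1) * mesh j) - pathSeries A z (k * mesh j)‖
        ≤ C * mesh j ^ (z.re - ε) := by
  obtain ⟨C, hC, hb⟩ := hg.exists_norm_incrSeries_le hr0 hr (half_pos hε)
  refine ⟨C * (M + 1) ^ (ε / 2), by positivity, fun j k z hz hk => ?_⟩
  have hm := mesh_pos j
  rw [hg.pathSeries_sub j k (hz.trans_lt hr), norm_mul, Complex.norm_cpow_eq_rpow_re_of_pos hm]
  have h1 : ((j : ℝ) + 1) * (|(k : ℝ)| + 1) ≤ (M + 1) * mesh j ^ (-2 : ℝ) := by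
    have h2 : (j : ℝ) + 1 ≤ (mesh j)⁻¹ := by
      rw [mesh, one_div, inv_pow, inv_inv]
      exact_mod_cast Nat.lt_two_pow_self
    have h3 : |(k : ℝ)| + 1 ≤ (M + 1) * (mesh j)⁻¹ := by
      rw [← div_eq_mul_inv, le_div_iff₀ hm]
      linarith [mesh_le_one j]
    calc ((j : ℝ) + 1) * (|(k : ℝ)| + 1) ≤ (mesh j)⁻¹ * ((M + 1) * (mesh j)⁻¹) := by gcongr
      _ = (M + 1) * mesh j ^ (-2 : ℝ) := by
        rw [Real.rpow_neg hm.le, Real.rpow_two]; field_simp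
  calc mesh j ^ z.re * ‖incrSeries X j k z‖
      ≤ mesh j ^ z.re * (C * ((M + 1) * mesh j ^ (-2 : ℝ)) ^ (ε / 2)) := by
        gcongr
        exact (hb j k z hz).trans (by gcongr)
    _ = C * (M + 1) ^ (ε / 2) * (mesh j ^ z.re * mesh j ^ (-ε)) := by
        rw [Real.mul_rpow (by positivity) (by positivity), ← Real.rpow_mul hm.le]
        ring_nf
    _ = _ := by rw [← Real.rpow_add hm, sub_eq_add_neg]

end Series


/-! ### The limiting field as a family of holomorphic functions. -/

section HolomorphicPath

/-- A family of holomorphic functions on the disc of diameter `(0, 1)`, indexed by `ℝ`, with the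
Hölder continuity in the index of a fractional Brownian motion. -/
structure IsHolomorphicPath (F : ℝ → ℂ → ℂ) : Prop where
  zero : ∀ z, F 0 z = 0
  differentiableOn : ∀ t, DifferentiableOn ℂ (F t) (Metric.ball (1 / 2) (1 / 2))
  bound : ∀ r ε M : ℝ, 0 ≤ r → 0 < ε → r + ε < 1 / 2 → 0 ≤ M → ∃ C > 0,
    ∀ s t : ℝ, |s| ≤ M → |t| ≤ M →
    ∀ z : ℂ, ‖z - 1 / 2‖ ≤ r → ‖F s z - F t z‖ ≤ C * |s - t| ^ (z.re - ε)

theorem abs_re_sub_half_le {r : ℝ} {z : ℂ} (hz : ‖z - 1 / 2‖ ≤ r) : |z.re - 1 / 2| ≤ r := by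
  have := Complex.abs_re_le_norm (z - 1 / 2)
  have h2 : (z - 1 / 2).re = z.re - 1 / 2 := by simp
  rw [h2] at this
  exact this.trans hz

/-- An estimate for times at distance at most `1` extends to the whole range by cutting `[s, t]`
into `N ≥ 2M` equal steps. -/
theorem norm_sub_le_of_subdivision {E : Type*} [SeminormedAddCommGroup E] (φ : ℝ → E)
    {M C γ : ℝ} (hC : 0 ≤ C) (hγ : 0 < γ) {N : ℕ} (hN : 0 < N) (hMN : 2 * M ≤ N)
    (h : ∀ s t, |s| ≤ M → |t| ≤ M → |s - t| ≤ 1 → ‖φ s - φ t‖ ≤ C * |s - t| ^ γ)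
    {s t : ℝ} (hs : |s| ≤ M) (ht : |t| ≤ M) : ‖φ s - φ t‖ ≤ N * C * |s - t| ^ γ := by
  have hN' : (0 : ℝ) < N := by exact_mod_cast hN
  set u : ℕ → ℝ := fun i => t + i * ((s - t) / N) with hu
  have hu0 : u 0 = t := by simp [hu]
  have huN : u N = s := by simp only [hu]; field_simp; ring
  have hmem : ∀ i ≤ N, |u i| ≤ M := by
    intro i hi
    have hi' : (i : ℝ) / N ≤ 1 := by rw [div_le_one hN']; exact_mod_cast hi
    have hi0 : 0 ≤ (i : ℝ) / N := by positivity
    have h1 : u i = (1 - i / N) * t + (i / N) * s := by simp only [hu]; ring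
    rw [h1]
    calc |(1 - i / N) * t + (i / N) * s| ≤ |(1 - i / N) * t| + |(i / N) * s| := abs_add_le _ _
      _ = (1 - i / N) * |t| + (i / N) * |s| := by
        rw [abs_mul, abs_mul, abs_of_nonneg hi0, abs_of_nonneg (sub_nonneg.2 hi')]
      _ ≤ (1 - i / N) * M + (i / N) * M := by
        have := sub_nonneg.2 hi'
        gcongr
      _ = M := by ring
  have hstep : ∀ i, |u (i + 1) - u i| = |s - t| / N := by
    intro i
    have : u (i + 1) - u i = (s - t) / N := by simp only [hu]; push_cast; ring
    rw [this, abs_div, abs_of_pos hN']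
  have hst : |s - t| ≤ 2 * M := (abs_sub s t).trans (by linarith)
  have hN1 : (1 : ℝ) ≤ N := by exact_mod_cast hN
  calc ‖φ s - φ t‖ = ‖∑ i ∈ Finset.range N, (φ (u (i + 1)) - φ (u i))‖ := by
        rw [Finset.sum_range_sub (fun i => φ (u i)), hu0, huN]
    _ ≤ ∑ i ∈ Finset.range N, C * |s - t| ^ γ := by
        refine norm_sum_le_of_le _ fun i hi => ?_
        have hi := Finset.mem_range.1 hi
        refine (h _ _ (hmem _ hi) (hmem _ hi.le) ?_).trans ?_
        · rw [hstep, div_le_one hN']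
          linarith
        · rw [hstep]
          gcongr
          exact div_le_self (abs_nonneg _) hN1
    _ = _ := by rw [Finset.sum_const, Finset.card_range, nsmul_eq_mul]; ring

variable {A : ℕ → ℝ → ℝ} {X : ℕ → ℤ → ℕ → ℝ}

theorem dyadicFloor_zero (j : ℕ) : dyadicFloor j 0 = 0 := by simp [dyadicFloor]

/-- The dyadic approximations are holomorphic in `z` and converge locally uniformly on the disc,
while chaining for each `z` gives the modulus of continuity in `t`. -/
theorem IsGoodCoeff.isHolomorphicPath (hg : IsGoodCoeff A X) :
    IsHolomorphicPath fun t z => dyadicLim (pathSeries A z) t := by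
  refine ⟨fun z => ?_, fun t => ?_, fun r ε M hr hε hrε hM => ?_⟩
  · simp only [dyadicLim, dyadicFloor_zero, hg.pathSeries_zero]
    exact tendsto_const_nhds.limUnder_eq
  · intro z hz
    rw [mem_ball_iff_norm] at hz
    obtain ⟨r, hr1, hr2⟩ := exists_between hz
    have hr0 : 0 ≤ r := (norm_nonneg _).trans hr1.le
    -- Only some positive exponent `γ`, common to all `w` in the disc of radius `r`, is needed for
    -- uniform convergence.
    set ε := (1 / 2 - r) / 2 with hε
    have hε0 : 0 < ε := by rw [hε]; linarith
    set γ := 1 / 2 - r - ε with hγ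
    have hγ0 : 0 < γ := by rw [hγ, hε]; linarith
    obtain ⟨C, hC, hb⟩ := hg.exists_increment_bound hr0 hr2 hε0 (M := |t| + 1) (by positivity)
    have hb' : ∀ w : ℂ, ‖w - 1 / 2‖ ≤ r → ∀ (j : ℕ) (k : ℤ), |(k : ℝ)| * mesh j ≤ |t| + 1 →
        ‖pathSeries A w ((k + 1) * mesh j) - pathSeries A w (k * mesh j)‖ ≤ C * mesh j ^ γ := by
      intro w hw j k hk
      refine (hb j k w hw hk).trans ?_
      have h1 := (abs_le.1 (abs_re_sub_half_le hw)).1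
      exact mul_le_mul_of_nonneg_left (Real.rpow_le_rpow_of_exponent_ge (mesh_pos j)
        (mesh_le_one j) (by rw [hγ]; linarith)) hC.le
    have hlim : TendstoLocallyUniformlyOn (fun j w => pathSeries A w (dyadicFloor j t))
        (fun w => dyadicLim (pathSeries A w) t) atTop (Metric.ball (1 / 2) r) := by
      refine TendstoUniformlyOn.tendstoLocallyUniformlyOn ?_
      rw [Metric.tendstoUniformlyOn_iff]
      intro e he
      have h0 : Tendsto (fun j => C * mesh j ^ γ / (1 - (1 / 2 : ℝ) ^ γ)) atTop (𝓝 0) := by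
        have := ((tendsto_mesh.rpow_const (p := γ) (Or.inr hγ0.le)).const_mul C).div_const
          (1 - (1 / 2 : ℝ) ^ γ)
        simpa [Real.zero_rpow hγ0.ne'] using this
      filter_upwards [h0.eventually_lt_const he] with j hj w hw
      rw [dist_comm]
      exact (dist_dyadicLim_le hC.le hγ0 (hb' w (mem_ball_iff_norm.1 hw).le) le_rfl j).trans_lt hj
    have h1 : DifferentiableOn ℂ (fun w => dyadicLim (pathSeries A w) t)
        (Metric.ball (1 / 2) r) := by
      refine hlim.differentiableOn (Eventually.of_forall fun j => ?_) Metric.isOpen_ball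
      exact (hg.differentiableOn_pathSeries j _).mono (Metric.ball_subset_ball hr2.le)
    exact (h1.differentiableAt (Metric.isOpen_ball.mem_nhds
      (mem_ball_iff_norm.2 hr1))).differentiableWithinAt
  · obtain ⟨C, hC, hb⟩ := hg.exists_increment_bound hr (by linarith) hε (M := M + 1)
      (by positivity)
    -- A lower bound for the exponents `z.re - ε` on the disc; it makes the chaining constant
    -- uniform in `z`.
    set γ₀ := 1 / 2 - r - ε with hγ₀
    have hγ₀0 : 0 < γ₀ := by rw [hγ₀]; linarith
    have hq₀ := half_rpow_lt_one hγ₀0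
    obtain ⟨N, hN⟩ := exists_nat_ge (max 1 (2 * M))
    have hN1 : 0 < N := by
      have : (1 : ℝ) ≤ N := (le_max_left _ _).trans hN
      exact_mod_cast this
    set D := C * (2 / (1 - (1 / 2 : ℝ) ^ γ₀) + 1) * 2 with hD
    have hD0 : 0 < D := by
      have : 0 < 1 - (1 / 2 : ℝ) ^ γ₀ := by linarith
      positivity
    refine ⟨N * D, by positivity, fun s t hs ht z hz => ?_⟩
    have hre := abs_le.1 (abs_re_sub_half_le hz)
    have hγ : γ₀ ≤ z.re - ε := by rw [hγ₀]; linarith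
    refine norm_sub_le_of_subdivision (fun t => dyadicLim (pathSeries A z) t) hD0.le
      (hγ₀0.trans_le hγ) hN1 ((le_max_right _ _).trans hN) (fun s t hs ht hst => ?_) hs ht
    refine (norm_dyadicLim_sub_le hC.le (hγ₀0.trans_le hγ) (fun j k hk => hb j k z hz hk)
      hs ht hst).trans ?_
    have h1 : (1 / 2 : ℝ) ^ (z.re - ε) ≤ (1 / 2 : ℝ) ^ γ₀ :=
      Real.rpow_le_rpow_of_exponent_ge (by norm_num) (by norm_num) hγ
    have h2 : (2 : ℝ) ^ (z.re - ε) ≤ 2 := by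
      calc (2 : ℝ) ^ (z.re - ε) ≤ 2 ^ (1 : ℝ) :=
            Real.rpow_le_rpow_of_exponent_le one_le_two (by linarith)
        _ = 2 := Real.rpow_one 2
    have h3 : 0 < 1 - (1 / 2 : ℝ) ^ γ₀ := by linarith
    rw [hD]
    gcongr

end HolomorphicPath


/-! ### Regularity of the real field and of its derivatives in `θ`. -/

section RealPath

theorem differentiableOn_iteratedDeriv {G : ℂ → ℂ} {s : Set ℂ} (hs : IsOpen s)
    (hG : DifferentiableOn ℂ G s) (n : ℕ) : DifferentiableOn ℂ (iteratedDeriv n G) s := by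
  induction n with
  | zero => simpa using hG
  | succ n ih => rw [iteratedDeriv_succ]; exact ih.deriv hs

theorem ofReal_mem_ball {θ : ℝ} (hθ : θ ∈ Ioo (0 : ℝ) 1) :
    (θ : ℂ) ∈ Metric.ball (1 / 2 : ℂ) (1 / 2) := by
  rw [mem_ball_iff_norm, show (θ : ℂ) - 1 / 2 = ((θ - 1 / 2 : ℝ) : ℂ) by push_cast; ring,
    Complex.norm_real, Real.norm_eq_abs, abs_lt]
  constructor <;> linarith [hθ.1, hθ.2]

theorem iteratedDeriv_re {G : ℂ → ℂ} (hG : DifferentiableOn ℂ G (Metric.ball (1 / 2) (1 / 2)))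
    (n : ℕ) {θ : ℝ} (hθ : θ ∈ Ioo (0 : ℝ) 1) :
    iteratedDeriv n (fun x : ℝ => (G x).re) θ = (iteratedDeriv n G θ).re ∧
      HasDerivAt (iteratedDeriv n fun x : ℝ => (G x).re) (iteratedDeriv (n + 1) G θ).re θ := by
  have h1 : ∀ n, ∀ θ ∈ Ioo (0 : ℝ) 1,
      HasDerivAt (fun x : ℝ => (iteratedDeriv n G x).re) (iteratedDeriv (n + 1) G θ).re θ := by
    intro n θ hθ
    rw [iteratedDeriv_succ]
    exact ((differentiableOn_iteratedDeriv Metric.isOpen_ball hG n).differentiableAt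
      (Metric.isOpen_ball.mem_nhds (ofReal_mem_ball hθ))).hasDerivAt.real_of_complex
  have h2 : ∀ θ ∈ Ioo (0 : ℝ) 1,
      iteratedDeriv n (fun x : ℝ => (G x).re) θ = (iteratedDeriv n G θ).re := by
    induction n with
    | zero => simp
    | succ n ih =>
      intro θ hθ
      rw [iteratedDeriv_succ]
      have h3 : iteratedDeriv n (fun x : ℝ => (G x).re) =ᶠ[𝓝 θ]
          fun x : ℝ => (iteratedDeriv n G x).re := by
        filter_upwards [isOpen_Ioo.mem_nhds hθ] with x hx using ih x hx
      rw [h3.deriv_eq, (h1 n θ hθ).deriv]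
  refine ⟨h2 θ hθ, (h1 n θ hθ).congr_of_eventuallyEq ?_⟩
  filter_upwards [isOpen_Ioo.mem_nhds hθ] with x hx using h2 x hx

/-- Lowering an exponent is free only for bases at most `1`; the factor `K ^ m` pays for distances
`d` between `1` and `K`. -/
theorem rpow_le_mul_rpow {d K p q m : ℝ} (hd : 0 < d) (hK1 : 1 ≤ K) (hdK : d ≤ K) (hpq : q ≤ p)
    (hm : p - q ≤ m) : d ^ p ≤ K ^ m * d ^ q := by
  have h1 : d ^ p = d ^ (p - q) * d ^ q := by rw [← Real.rpow_add hd]; ring_nf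
  rw [h1]
  refine mul_le_mul_of_nonneg_right ?_ (Real.rpow_nonneg hd.le _)
  calc d ^ (p - q) ≤ K ^ (p - q) := Real.rpow_le_rpow hd.le hdK (by linarith)
    _ ≤ K ^ m := Real.rpow_le_rpow_of_exponent_le hK1 hm

variable {F : ℝ → ℂ → ℂ}

/-- Cauchy's estimate on a small circle around `θ` bounds the `n`-th derivative of `F t₁ - F t₂` by
its values there, where the exponent is within `ρ` of that at `θ`. -/
theorem IsHolomorphicPath.exists_iteratedDeriv_bound (hF : IsHolomorphicPath F) (n : ℕ)
    {ε M a c : ℝ} (hε : 0 < ε) (hM : 0 < M) (ha : 0 < a) (hac : a < c) (hc : c < 1) :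
    ∃ C > 0, ∀ t₁ ∈ Icc (-M) M, ∀ t₂ ∈ Icc (-M) M, ∀ θ ∈ Icc a c,
      |(iteratedDeriv n (F t₁) θ).re - (iteratedDeriv n (F t₂) θ).re|
        ≤ C * |t₁ - t₂| ^ (θ - ε) := by
  -- The radius keeps the circle inside the disc of radius `r < 1/2` and costs at most `ε / 4` of
  -- the exponent; `ε'` below costs at most `ε / 2` more.
  set ρ := min (ε / 4) (min (a / 4) ((1 - c) / 4)) with hρ
  have hρ0 : 0 < ρ := lt_min (by linarith) (lt_min (by linarith) (by linarith))
  have hρ1 : ρ ≤ ε / 4 := min_le_left _ _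
  have hρ2 : ρ ≤ a / 4 := (min_le_right _ _).trans (min_le_left _ _)
  have hρ3 : ρ ≤ (1 - c) / 4 := (min_le_right _ _).trans (min_le_right _ _)
  set r := max (1 / 2 - a) (c - 1 / 2) + ρ with hr
  have hr1 : 1 / 2 - a + ρ ≤ r := by rw [hr]; linarith [le_max_left (1 / 2 - a) (c - 1 / 2)]
  have hr2 : c - 1 / 2 + ρ ≤ r := by rw [hr]; linarith [le_max_right (1 / 2 - a) (c - 1 / 2)]
  have hr3 : r < 1 / 2 := by
    rw [hr]
    rcases max_choice (1 / 2 - a) (c - 1 / 2) with h | h <;> rw [h] <;> linarith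
  set ε' := min (ε / 2) ((1 / 2 - r) / 2) with hε'
  have hε'0 : 0 < ε' := lt_min (by linarith) (by linarith)
  have hε'1 : ε' ≤ ε / 2 := min_le_left _ _
  have hε'2 : ε' ≤ (1 / 2 - r) / 2 := min_le_right _ _
  obtain ⟨C, hC, hb⟩ := hF.bound r ε' M (by linarith) hε'0 (by linarith) hM.le
  refine ⟨n.factorial * (C * (2 * M + 1) ^ (1 + ε)) / ρ ^ n, by positivity,
    fun t₁ h₁ t₂ h₂ θ hθ => ?_⟩
  rcases eq_or_ne t₁ t₂ with rfl | hne
  · rw [sub_self, abs_zero]; positivity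
  have hd : 0 < |t₁ - t₂| := abs_pos.2 (sub_ne_zero.2 hne)
  have ht₁ := abs_le.2 h₁
  have ht₂ := abs_le.2 h₂
  have hdM : |t₁ - t₂| ≤ 2 * M + 1 := (abs_sub t₁ t₂).trans (by linarith)
  have hθ' : θ ∈ Ioo (0 : ℝ) 1 := ⟨by linarith [hθ.1], by linarith [hθ.2]⟩
  have hin : ∀ z : ℂ, dist z θ ≤ ρ → ‖z - 1 / 2‖ ≤ r := by
    intro z hz
    rw [dist_eq_norm] at hz
    have h3 : ‖(θ : ℂ) - 1 / 2‖ ≤ r - ρ := by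
      rw [show (θ : ℂ) - 1 / 2 = ((θ - 1 / 2 : ℝ) : ℂ) by push_cast; ring, Complex.norm_real,
        Real.norm_eq_abs, abs_le]
      constructor <;> linarith [hθ.1, hθ.2]
    have h4 := norm_sub_le_norm_sub_add_norm_sub z (θ : ℂ) (1 / 2)
    linarith
  have hdiff : ∀ t, DifferentiableOn ℂ (F t) (Metric.ball (1 / 2) (1 / 2)) := hF.differentiableOn
  have hcd : ∀ t, ContDiffAt ℂ n (F t) θ := fun t =>
    ((hdiff t).contDiffOn Metric.isOpen_ball).contDiffAt
      (Metric.isOpen_ball.mem_nhds (ofReal_mem_ball hθ'))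
  have hsub : Metric.closedBall (θ : ℂ) ρ ⊆ Metric.ball (1 / 2) (1 / 2) := fun z hz =>
    mem_ball_iff_norm.2 ((hin z hz).trans_lt hr3)
  have hcauchy := Complex.norm_iteratedDeriv_le_of_forall_mem_sphere_norm_le (c := (θ : ℂ))
    (C := C * ((2 * M + 1) ^ (1 + ε) * |t₁ - t₂| ^ (θ - ε))) (f := F t₁ - F t₂) n hρ0
    (((hdiff t₁).sub (hdiff t₂)).diffContOnCl_ball hsub) (fun z hz => by
      have hz' : dist z θ = ρ := hz
      refine (hb t₁ t₂ ht₁ ht₂ z (hin z hz'.le)).trans ?_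
      refine mul_le_mul_of_nonneg_left ?_ hC.le
      have hre : |z.re - θ| ≤ ρ := by
        have := Complex.abs_re_le_norm (z - θ)
        rw [← dist_eq_norm, hz'] at this
        simpa using this
      have hre := abs_le.1 hre
      exact rpow_le_mul_rpow hd (by linarith) hdM (by linarith) (by linarith [hθ'.1]))
  rw [iteratedDeriv_sub (hcd t₁) (hcd t₂)] at hcauchy
  rw [← Complex.sub_re]
  refine (Complex.abs_re_le_norm _).trans (hcauchy.trans (le_of_eq ?_))
  ring

/-- The path from `(t₁, θ₁)` to `(t₂, θ₂)` first changes `θ` at fixed time, where the next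
derivative is bounded, and then changes time at fixed `θ`. -/
theorem IsHolomorphicPath.holder (hF : IsHolomorphicPath F) (n : ℕ)
    (ε M a c : ℝ) (hε : 0 < ε) (hM : 0 < M) (ha : 0 < a) (hac : a < c) (hc : c < 1) :
    ∃ C > 0, ∀ t₁ ∈ Icc (-M) M, ∀ t₂ ∈ Icc (-M) M, ∀ θ₁ ∈ Icc a c, ∀ θ₂ ∈ Icc a c,
      |partialTheta n (fun t (θ : ℝ) => (F t θ).re) t₁ θ₁ -
        partialTheta n (fun t (θ : ℝ) => (F t θ).re) t₂ θ₂| ≤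
        C * (|t₁ - t₂| ^ (max θ₁ θ₂ - ε) + |θ₁ - θ₂|) := by
  obtain ⟨C₁, hC₁, h₁⟩ := hF.exists_iteratedDeriv_bound n hε hM ha hac hc
  obtain ⟨C₂, hC₂, h₂⟩ := hF.exists_iteratedDeriv_bound (n + 1) (half_pos ha) hM ha hac hc
  have hIoo : ∀ θ ∈ Icc a c, θ ∈ Ioo (0 : ℝ) 1 := fun θ hθ =>
    ⟨by linarith [hθ.1], by linarith [hθ.2]⟩
  have hp : ∀ t, ∀ θ ∈ Icc a c, partialTheta n (fun t (θ : ℝ) => (F t θ).re) t θ =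
      (iteratedDeriv n (F t) θ).re := fun t θ hθ =>
    (iteratedDeriv_re (hF.differentiableOn t) n (hIoo θ hθ)).1
  have hzero : F 0 = fun _ => 0 := funext hF.zero
  -- The time increment estimate is anchored at `t = 0`, where the path vanishes.
  have hbd : ∀ t ∈ Icc (-M) M, ∀ θ ∈ Icc a c,
      |(iteratedDeriv (n + 1) (F t) θ).re| ≤ C₂ * (M + 1) := by
    intro t ht θ hθ
    have h3 := h₂ t ht 0 ⟨by linarith, hM.le⟩ θ hθ
    have h4 : iteratedDeriv (n + 1) (F 0) θ = 0 := by
      rw [hzero, iteratedDeriv_const]; simp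
    rw [h4, Complex.zero_re, sub_zero, sub_zero] at h3
    refine h3.trans (mul_le_mul_of_nonneg_left ?_ hC₂.le)
    have ht' := abs_le.2 ht
    calc |t| ^ (θ - a / 2) ≤ (M + 1) ^ (θ - a / 2) :=
          Real.rpow_le_rpow (abs_nonneg _) (by linarith) (by linarith [hθ.1])
      _ ≤ (M + 1) ^ (1 : ℝ) :=
          Real.rpow_le_rpow_of_exponent_le (by linarith) (by linarith [hθ.2])
      _ = M + 1 := Real.rpow_one _
  have hmv : ∀ t ∈ Icc (-M) M, ∀ θ₁ ∈ Icc a c, ∀ θ₂ ∈ Icc a c,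
      |(iteratedDeriv n (F t) θ₁).re - (iteratedDeriv n (F t) θ₂).re| ≤
        C₂ * (M + 1) * |θ₁ - θ₂| := by
    intro t ht θ₁ hθ₁ θ₂ hθ₂
    rw [← hp t θ₁ hθ₁, ← hp t θ₂ hθ₂]
    exact (convex_Icc a c).norm_image_sub_le_of_norm_hasDerivWithin_le (C := C₂ * (M + 1))
      (fun x hx => (iteratedDeriv_re (hF.differentiableOn t) n
        (hIoo x hx)).2.hasDerivWithinAt) (fun x hx => hbd t ht x hx) hθ₂ hθ₁
  -- Ordering the parameters lets time be changed at the larger one, which produces the maximum in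
  -- the exponent.
  have key : ∀ t₁ ∈ Icc (-M) M, ∀ t₂ ∈ Icc (-M) M, ∀ θ₁ ∈ Icc a c, ∀ θ₂ ∈ Icc a c, θ₁ ≤ θ₂ →
      |(iteratedDeriv n (F t₁) θ₁).re - (iteratedDeriv n (F t₂) θ₂).re| ≤
        (C₁ + C₂ * (M + 1)) * (|t₁ - t₂| ^ (max θ₁ θ₂ - ε) + |θ₁ - θ₂|) := by
    intro t₁ ht₁ t₂ ht₂ θ₁ hθ₁ θ₂ hθ₂ hle
    rw [max_eq_right hle]
    have h3 := hmv t₁ ht₁ θ₁ hθ₁ θ₂ hθ₂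
    have h4 := h₁ t₁ ht₁ t₂ ht₂ θ₂ hθ₂
    have h5 := abs_sub_le (iteratedDeriv n (F t₁) θ₁).re (iteratedDeriv n (F t₁) θ₂).re
      (iteratedDeriv n (F t₂) θ₂).re
    have h6 : 0 ≤ |t₁ - t₂| ^ (θ₂ - ε) := by positivity
    have h7 : 0 ≤ C₂ * (M + 1) := by positivity
    have h8 := abs_nonneg (θ₁ - θ₂)
    nlinarith [mul_nonneg hC₁.le h8, mul_nonneg h7 h6]
  refine ⟨C₁ + C₂ * (M + 1), by positivity, fun t₁ ht₁ t₂ ht₂ θ₁ hθ₁ θ₂ hθ₂ => ?_⟩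
  rw [hp t₁ θ₁ hθ₁, hp t₂ θ₂ hθ₂]
  rcases le_total θ₁ θ₂ with hle | hle
  · exact key t₁ ht₁ t₂ ht₂ θ₁ hθ₁ θ₂ hθ₂ hle
  · rw [abs_sub_comm, abs_sub_comm t₁, abs_sub_comm θ₁, max_comm]
    exact key t₂ ht₂ t₁ ht₁ θ₂ hθ₂ θ₁ hθ₁ hle

theorem IsHolomorphicPath.contDiffOn (hF : IsHolomorphicPath F) (t : ℝ) {n : WithTop ℕ∞} :
    ContDiffOn ℝ n (fun θ : ℝ => (F t θ).re) (Ioo (0 : ℝ) 1) := by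
  have h1 : ContDiffOn ℝ n (F t) (Metric.ball (1 / 2) (1 / 2)) :=
    ((hF.differentiableOn t).contDiffOn Metric.isOpen_ball).restrict_scalars ℝ
  exact Complex.reCLM.contDiff.comp_contDiffOn
    (h1.comp Complex.ofRealCLM.contDiff.contDiffOn fun θ hθ => ofReal_mem_ball hθ)

/-- Continuity from a Hölder estimate as in `IsRegularRealization.holder`. -/
theorem continuousOn_of_holder {f : ℝ → ℝ → ℝ}
    (h : ∀ ε M a c : ℝ, 0 < ε → 0 < M → 0 < a → a < c → c < 1 →
      ∃ C > 0, ∀ t₁ ∈ Icc (-M) M, ∀ t₂ ∈ Icc (-M) M, ∀ θ₁ ∈ Icc a c, ∀ θ₂ ∈ Icc a c,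
        |f t₁ θ₁ - f t₂ θ₂| ≤ C * (|t₁ - t₂| ^ (max θ₁ θ₂ - ε) + |θ₁ - θ₂|)) :
    ContinuousOn (fun p : ℝ × ℝ => f p.1 p.2) (univ ×ˢ Ioo (0 : ℝ) 1) := by
  rintro ⟨t, θ⟩ ⟨-, hθ⟩
  simp only at hθ
  refine ContinuousAt.continuousWithinAt ?_
  obtain ⟨hθ0, hθ1⟩ := hθ
  obtain ⟨C, hC, hb⟩ := h (θ / 4) (|t| + 1) (θ / 2) ((1 + θ) / 2) (by linarith) (by positivity)
    (by linarith) (by linarith) (by linarith)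
  rw [ContinuousAt, tendsto_iff_dist_tendsto_zero]
  have hlim : Tendsto (fun q : ℝ × ℝ => C * (|q.1 - t| ^ (θ / 4) + |q.2 - θ|)) (𝓝 (t, θ))
      (𝓝 0) := by
    have hc : ContinuousAt (fun q : ℝ × ℝ => C * (|q.1 - t| ^ (θ / 4) + |q.2 - θ|)) (t, θ) := by
      refine continuousAt_const.mul (ContinuousAt.add (ContinuousAt.rpow_const ?_ ?_) ?_)
      · fun_prop
      · right; linarith
      · fun_prop
    have := hc.tendsto
    simpa [Real.zero_rpow (show θ / 4 ≠ 0 by linarith)] using this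
  refine squeeze_zero' (Eventually.of_forall fun _ => dist_nonneg) ?_ hlim
  have h1 : ∀ᶠ q : ℝ × ℝ in 𝓝 (t, θ), |q.1 - t| < 1 :=
    (continuous_fst.tendsto (t, θ)).eventually (Metric.ball_mem_nhds t one_pos)
  have h2 : ∀ᶠ q : ℝ × ℝ in 𝓝 (t, θ), q.2 ∈ Icc (θ / 2) ((1 + θ) / 2) :=
    (continuous_snd.tendsto (t, θ)).eventually (Icc_mem_nhds (by linarith) (by linarith))
  filter_upwards [h1, h2] with q hq1 hq2
  have ht := abs_le.1 (le_refl |t|)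
  have hq1' := abs_lt.1 hq1
  refine (hb q.1 ⟨by linarith, by linarith⟩ t ⟨by linarith, by linarith⟩ q.2 hq2 θ
    ⟨by linarith, by linarith⟩).trans ?_
  refine mul_le_mul_of_nonneg_left (add_le_add_left ?_ _) hC.le
  refine Real.rpow_le_rpow_of_exponent_ge_of_imp (abs_nonneg _) hq1.le ?_ ?_
  · linarith [le_max_right q.2 θ]
  · intro _ h0
    linarith [le_max_right q.2 θ]

theorem limsupQuotient_eq_zero_of_holder {f : ℝ → ℝ → ℝ}
    (h : ∀ ε M a c : ℝ, 0 < ε → 0 < M → 0 < a → a < c → c < 1 →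
      ∃ C > 0, ∀ t₁ ∈ Icc (-M) M, ∀ t₂ ∈ Icc (-M) M, ∀ θ₁ ∈ Icc a c, ∀ θ₂ ∈ Icc a c,
        |f t₁ θ₁ - f t₂ θ₂| ≤ C * (|t₁ - t₂| ^ (max θ₁ θ₂ - ε) + |θ₁ - θ₂|))
    {ε : ℝ} (hε : 0 < ε) (s : ℝ) {θ : ℝ} (hθ : θ ∈ Ioo (0 : ℝ) 1) :
    limsupQuotient (fun t => f t θ) s (θ - ε) = 0 := by
  rw [limsupQuotient_eq_zero_iff]
  obtain ⟨hθ0, hθ1⟩ := hθ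
  obtain ⟨C, hC, hb⟩ := h (ε / 2) (|s| + 1) (θ / 2) ((1 + θ) / 2) (by linarith) (by positivity)
    (by linarith) (by linarith) (by linarith)
  refine Asymptotics.IsBigO.trans_isLittleO (Asymptotics.IsBigO.of_bound C ?_)
    (isLittleO_rpow_abs (show θ - ε < θ - ε / 2 by linarith))
  have h1 : ∀ᶠ h : ℝ in 𝓝[≠] 0, |h| < 1 := by
    refine nhdsWithin_le_nhds ((continuous_abs.tendsto (0 : ℝ)).eventually_lt_const ?_)
    simp
  filter_upwards [h1] with h hh
  have hs := abs_le.1 (le_refl |s|)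
  have hh' := abs_lt.1 hh
  have hmem : θ ∈ Icc (θ / 2) ((1 + θ) / 2) := ⟨by linarith, by linarith⟩
  have := hb (s + h) ⟨by linarith, by linarith⟩ s ⟨by linarith, by linarith⟩ θ hmem θ hmem
  rw [add_sub_cancel_left, max_self, sub_self, abs_zero, add_zero] at this
  rw [Real.norm_eq_abs, Real.norm_eq_abs, abs_of_nonneg (Real.rpow_nonneg (abs_nonneg h) _)]
  exact this

end RealPath


/-! ### The constructed field is a modification of the Wiener integral field. -/

section Identification

theorem eLpNorm_fieldKernel_sub {θ : ℝ} (hθ : θ ∈ Ioo (0 : ℝ) 1) {s t : ℝ} (hst : s < t) :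
    eLpNorm (fieldKernel t θ - fieldKernel s θ) 2 volume
      = ENNReal.ofReal ((t - s) ^ θ) * eLpNorm (fieldKernel 1 θ) 2 volume := by
  have hh : 0 < t - s := sub_pos.2 hst
  have h1 : fieldKernel t θ - fieldKernel s θ =
      (t - s) ^ (θ - 1 / 2) • rescale s (t - s) (fieldKernel 1 θ) := by
    ext x
    have := fieldKernel_add_sub hh θ s x
    rw [add_sub_cancel] at this
    simpa using this
  rw [h1, eLpNorm_const_smul, eLpNorm_rescale hh (memLp_fieldKernel_one hθ).1, ← mul_assoc,
    Real.enorm_eq_ofReal (by positivity), ← ENNReal.ofReal_mul (by positivity),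
    ← Real.rpow_add hh]
  ring_nf

theorem norm_toLp_fieldKernel_sub {θ : ℝ} (hθ : θ ∈ Ioo (0 : ℝ) 1) (s t : ℝ) :
    ‖(memLp_fieldKernel hθ t).toLp - (memLp_fieldKernel hθ s).toLp‖
      = |t - s| ^ θ * ‖(memLp_fieldKernel_one hθ).toLp‖ := by
  wlog hst : s < t generalizing s t
  · rcases (not_lt.1 hst).eq_or_lt with rfl | h
    · simp [Real.zero_rpow hθ.1.ne']
    · rw [norm_sub_rev, abs_sub_comm]
      exact this t s h
  rw [← MemLp.toLp_sub, Lp.norm_toLp, Lp.norm_toLp, eLpNorm_fieldKernel_sub hθ hst,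
    ENNReal.toReal_mul, ENNReal.toReal_ofReal (by have := sub_pos.2 hst; positivity),
    abs_of_pos (sub_pos.2 hst)]

theorem IsGoodCoeff.tendsto_pathSeries {A : ℕ → ℝ → ℝ} {X : ℕ → ℤ → ℕ → ℝ} (hg : IsGoodCoeff A X)
    {z : ℂ} (hz : ‖z - 1 / 2‖ < 1 / 2) (t : ℝ) :
    Tendsto (fun j => pathSeries A z (dyadicFloor j t)) atTop
      (𝓝 (dyadicLim (pathSeries A z) t)) := by
  have hre := (abs_le.1 (abs_re_sub_half_le le_rfl : |z.re - 1 / 2| ≤ ‖z - 1 / 2‖)).1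
  have hz0 : 0 < z.re := by linarith
  obtain ⟨C, hC, hb⟩ := hg.exists_increment_bound (norm_nonneg _) hz (half_pos hz0)
    (M := |t| + 1) (by positivity)
  exact tendsto_dyadicLim hC.le (show 0 < z.re - z.re / 2 by linarith)
    (fun j k hk => hb j k z le_rfl hk) le_rfl

variable {Ω : Type*} [MeasurableSpace Ω] {P : Measure Ω}
  {I : Lp ℝ 2 (volume : Measure ℝ) →L[ℝ] Lp ℝ 2 P}

theorem norm_ofReal_sub_half_lt {θ : ℝ} (hθ : θ ∈ Ioo (0 : ℝ) 1) :
    ‖(θ : ℂ) - 1 / 2‖ < 1 / 2 := mem_ball_iff_norm.1 (ofReal_mem_ball hθ)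

theorem IsIsonormal.incrSeries_ae_eq (hI : IsIsonormal I) {θ : ℝ} (hθ : θ ∈ Ioo (0 : ℝ) 1) (j : ℕ)
    (k : ℤ) :
    (fun ω => mesh j ^ θ * (incrSeries (incrCoeff I ω) j k θ).re) =ᵐ[P]
      (I (memLp_fieldKernel hθ ((k + 1) * mesh j)).toLp -
        I (memLp_fieldKernel hθ (k * mesh j)).toLp : Lp ℝ 2 P) := by
  obtain ⟨hK, hs⟩ := hasSum_unitCoeff hθ (k * mesh j) (mesh_pos j)
  have h1 : (fun ω => (incrSeries (incrCoeff I ω) j k θ).re) =ᵐ[P] I hK.toLp := by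
    refine ae_eq_of_hasSum (u := fun n ω => (θ - 1 / 2) ^ n * incrCoeff I ω j k n)
      (I.hasSum hs) (fun n => ?_) ?_
    · rw [map_smul]
      filter_upwards [Lp.coeFn_smul ((θ - 1 / 2) ^ n)
        (I (memLp_unitCoeff (k * mesh j) (mesh_pos j) n).toLp)] with ω hω
      rw [hω]; rfl
    · filter_upwards [hI.ae_isGoodCoeff] with ω hω
      have h2 := (hω.summable_incr j k (norm_ofReal_sub_half_lt hθ)).of_norm.hasSum
      have h3 := Complex.reCLM.hasSum h2
      refine h3.congr_fun ?_ |> id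
      intro n
      rw [Complex.reCLM_apply,
        show ((θ : ℂ) - 1 / 2) ^ n * (incrCoeff I ω j k n : ℂ) =
          (((θ - 1 / 2) ^ n * incrCoeff I ω j k n : ℝ) : ℂ) by push_cast; ring, Complex.ofReal_re]
  have h2 : (memLp_fieldKernel hθ ((k + 1) * mesh j)).toLp -
      (memLp_fieldKernel hθ (k * mesh j)).toLp = mesh j ^ θ • hK.toLp := by
    rw [← MemLp.toLp_sub, ← MemLp.toLp_const_smul]
    refine MemLp.toLp_congr _ _ (Eventually.of_forall fun x => ?_)
    have h3 := fieldKernel_add_sub (mesh_pos j) θ (k * mesh j) x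
    rw [Pi.sub_apply, Pi.smul_apply, add_mul, one_mul, h3, smul_eq_mul, ← mul_assoc,
      ← Real.rpow_add (mesh_pos j)]
    ring_nf
  rw [← map_sub, h2, map_smul]
  filter_upwards [h1, Lp.coeFn_smul (mesh j ^ θ) (I hK.toLp)] with ω h3 h4
  rw [h4, Pi.smul_apply, smul_eq_mul, h3]

/-- Both sides vanish at time `0` and have the same grid increments, so the identity propagates
along the integers in both directions. -/
theorem IsIsonormal.pathSeries_ae_eq (hI : IsIsonormal I) {θ : ℝ} (hθ : θ ∈ Ioo (0 : ℝ) 1) (j : ℕ)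
    (k : ℤ) :
    (fun ω => (pathSeries (pathCoeff I ω) θ (k * mesh j)).re) =ᵐ[P]
      I (memLp_fieldKernel hθ (k * mesh j)).toLp := by
  have hstep : ∀ k : ℤ, (fun ω => (pathSeries (pathCoeff I ω) θ ((k + 1) * mesh j)).re -
      (pathSeries (pathCoeff I ω) θ (k * mesh j)).re) =ᵐ[P]
      fun ω => I (memLp_fieldKernel hθ ((k + 1) * mesh j)).toLp ω -
        I (memLp_fieldKernel hθ (k * mesh j)).toLp ω := by
    intro k
    filter_upwards [hI.ae_isGoodCoeff, hI.incrSeries_ae_eq hθ j k,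
      Lp.coeFn_sub (I (memLp_fieldKernel hθ ((k + 1) * mesh j)).toLp)
        (I (memLp_fieldKernel hθ (k * mesh j)).toLp)] with ω h1 h2 h3
    rw [h3, Pi.sub_apply] at h2
    rw [← h2, ← Complex.sub_re, h1.pathSeries_sub j k (norm_ofReal_sub_half_lt hθ),
      ← Complex.ofReal_cpow (mesh_pos j).le, Complex.re_ofReal_mul]
  induction k using Int.induction_on with
  | zero =>
    have h0 : (memLp_fieldKernel hθ (((0 : ℤ) : ℝ) * mesh j)).toLp = 0 := by
      refine Lp.ext ((MemLp.coeFn_toLp _).trans ?_)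
      rw [Int.cast_zero, zero_mul, fieldKernel_zero]
      exact (Lp.coeFn_zero ℝ 2 volume).symm
    rw [h0, map_zero]
    filter_upwards [hI.ae_isGoodCoeff, Lp.coeFn_zero ℝ 2 P] with ω h1 h2
    rw [h2, Int.cast_zero, zero_mul, h1.pathSeries_zero]
    rfl
  | succ k ih =>
    filter_upwards [ih, hstep k] with ω h1 h2
    push_cast at h1 h2 ⊢
    linarith
  | pred k ih =>
    have h3 := hstep (-(k : ℤ) - 1)
    have h4 : (((-(k : ℤ) - 1 : ℤ) : ℝ) + 1) = ((-(k : ℤ) : ℤ) : ℝ) := by push_cast; ring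
    rw [h4] at h3
    filter_upwards [ih, h3] with ω h1 h2
    linarith

/-- From the dyadic points to all times: the paths converge by construction and the Wiener integrals
converge in `L²`, since the kernels are Hölder continuous in `t`. -/
theorem IsIsonormal.dyadicLim_ae_eq (hI : IsIsonormal I) {θ : ℝ} (hθ : θ ∈ Ioo (0 : ℝ) 1) (t : ℝ) :
    (fun ω => (dyadicLim (pathSeries (pathCoeff I ω) θ) t).re) =ᵐ[P]
      I (memLp_fieldKernel hθ t).toLp := by
  have h1 : Tendsto (fun j => I (memLp_fieldKernel hθ (dyadicFloor j t)).toLp) atTop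
      (𝓝 (I (memLp_fieldKernel hθ t).toLp)) := by
    refine (I.continuous.tendsto _).comp ?_
    rw [tendsto_iff_norm_sub_tendsto_zero]
    refine Tendsto.congr (fun j => (norm_toLp_fieldKernel_sub hθ t _).symm) ?_
    have h2 : Tendsto (fun j => |dyadicFloor j t - t|) atTop (𝓝 0) := by
      have := ((tendsto_dyadicFloor t).sub_const t).abs
      simpa using this
    have h3 := (h2.rpow_const (p := θ) (Or.inr hθ.1.le)).mul_const
      ‖(memLp_fieldKernel_one hθ).toLp‖
    rwa [Real.zero_rpow hθ.1.ne', zero_mul] at h3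
  obtain ⟨ns, hns, hae⟩ := (tendstoInMeasure_of_tendsto_Lp h1).exists_seq_tendsto_ae
  have h2 : ∀ᵐ ω ∂P, ∀ j, (pathSeries (pathCoeff I ω) θ (dyadicFloor j t)).re =
      I (memLp_fieldKernel hθ (dyadicFloor j t)).toLp ω :=
    ae_all_iff.2 fun j => hI.pathSeries_ae_eq hθ j _
  filter_upwards [hae, h2, hI.ae_isGoodCoeff] with ω h3 h4 h5
  have h6 := ((Complex.continuous_re.tendsto _).comp
    (h5.tendsto_pathSeries (norm_ofReal_sub_half_lt hθ) t)).comp hns.tendsto_atTop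
  refine tendsto_nhds_unique h6 (h3.congr fun i => ?_)
  rw [← h4]; rfl

theorem IsIsonormal.exists_isHolomorphicPath (hI : IsIsonormal I) :
    ∃ F : Ω → ℝ → ℂ → ℂ, (∀ᵐ ω ∂P, IsHolomorphicPath (F ω)) ∧
      ∀ (t θ : ℝ) (hθ : θ ∈ Ioo (0 : ℝ) 1),
        (fun ω => (F ω t θ).re) =ᵐ[P] I (memLp_fieldKernel hθ t).toLp :=
  ⟨fun ω t z => dyadicLim (pathSeries (pathCoeff I ω) z) t,
    hI.ae_isGoodCoeff.mono fun _ h => h.isHolomorphicPath, fun t _ hθ => hI.dyadicLim_ae_eq hθ t⟩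

end Identification


/-! ### Small ball estimates from the causality of the kernels. -/

section SmallBall

theorem inner_toLp_eq_zero {f g : ℝ → ℝ} (hf : MemLp f 2 volume) (hg : MemLp g 2 volume)
    (h : ∀ x, f x * g x = 0) : inner ℝ hf.toLp hg.toLp = 0 := by
  rw [L2.inner_def]
  refine integral_eq_zero_of_ae ?_
  filter_upwards [hf.coeFn_toLp, hg.coeFn_toLp] with x h1 h2
  rw [h1, h2]
  simpa [mul_comm] using h x

/-- The squared norm is at least `a ^ (2θ) / (2θ)`, the integral of `(T - x) ^ (2θ - 1)`, and `2θ ≤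
4`. -/
theorem le_norm_toLp_indicator {f : ℝ → ℝ} (hf : MemLp f 2 volume) {T a θ : ℝ} (ha : 0 < a)
    (hθ : θ ∈ Ioo (0 : ℝ) 1) (h : ∀ x ∈ Ioo (T - a) T, (T - x) ^ (θ - 1 / 2) ≤ |f x|) :
    a ^ θ / 2 ≤ ‖(hf.indicator (measurableSet_Ioo (a := T - a) (b := T))).toLp‖ := by
  have hlt : T - a < T := by linarith
  have hint : IntervalIntegrable (fun x => (T - x) ^ (2 * θ - 1)) volume (T - a) T := by
    have := (intervalIntegral.intervalIntegrable_rpow' (r := 2 * θ - 1) (a := a) (b := 0)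
      (by linarith [hθ.1])).comp_sub_left T
    simpa using this
  have hval : ∫ x in Ioo (T - a) T, (T - x) ^ (2 * θ - 1) = a ^ (2 * θ) / (2 * θ) := by
    rw [← integral_Ioc_eq_integral_Ioo, ← intervalIntegral.integral_of_le hlt.le,
      intervalIntegral.integral_comp_sub_left (fun x => x ^ (2 * θ - 1)) T, sub_self,
      sub_sub_cancel,
      integral_rpow (Or.inl (by linarith [hθ.1])), sub_add_cancel,
      Real.zero_rpow (by linarith [hθ.1]), sub_zero]
  have hsq : ‖(hf.indicator (measurableSet_Ioo (a := T - a) (b := T))).toLp‖ ^ 2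
      = ∫ x in Ioo (T - a) T, f x ^ 2 := by
    rw [← real_inner_self_eq_norm_sq, L2.inner_def, ← integral_indicator measurableSet_Ioo]
    refine integral_congr_ae ?_
    filter_upwards [(hf.indicator (measurableSet_Ioo (a := T - a) (b := T))).coeFn_toLp] with x hx
    rw [hx]
    by_cases hm : x ∈ Ioo (T - a) T
    · simp [indicator_of_mem hm, pow_two]
    · simp [indicator_of_notMem hm]
  have hle : a ^ (2 * θ) / (2 * θ) ≤ ∫ x in Ioo (T - a) T, f x ^ 2 := by
    rw [← hval]
    refine setIntegral_mono_on ?_ hf.integrable_sq.integrableOn measurableSet_Ioo fun x hx => ?_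
    · exact ((intervalIntegrable_iff_integrableOn_Ioc_of_le hlt.le).1 hint).mono_set
        Ioo_subset_Ioc_self
    · have hx0 : 0 < T - x := by linarith [hx.2]
      calc (T - x) ^ (2 * θ - 1) = ((T - x) ^ (θ - 1 / 2)) ^ 2 := by
            rw [← Real.rpow_natCast, ← Real.rpow_mul hx0.le]; ring_nf
        _ ≤ |f x| ^ 2 := by gcongr; exact h x hx
        _ = f x ^ 2 := sq_abs _
  refine le_of_sq_le_sq ?_ (norm_nonneg _)
  rw [hsq]
  refine le_trans ?_ hle
  have h1 : (a ^ θ) ^ 2 = a ^ (2 * θ) := by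
    rw [← Real.rpow_natCast, ← Real.rpow_mul ha.le]; ring_nf
  rw [div_pow, h1]
  have h2 : 0 < a ^ (2 * θ) := by positivity
  have h3 : 0 < 2 * θ := by linarith [hθ.1]
  exact div_le_div_of_nonneg_left h2.le h3 (by linarith [hθ.2])

variable {Ω : Type*} [MeasurableSpace Ω] {P : Measure Ω} [IsProbabilityMeasure P]
  {I : Lp ℝ 2 (volume : Measure ℝ) →L[ℝ] Lp ℝ 2 P}

/-- Local nondeterminism: the part of `f l` on the last window `(T l - a l, T l)` is orthogonal to
its own remainder and to all earlier kernels, which vanish on that window. -/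
theorem IsIsonormal.measure_small_ball_kernel_le (hI : IsIsonormal I) {f : ℕ → ℝ → ℝ}
    (hf : ∀ l, MemLp (f l) 2 volume) {T a θ : ℕ → ℝ} (r : ℝ) (L : ℕ)
    (ha : ∀ l < L, 0 < a l) (hθ : ∀ l < L, θ l ∈ Ioo (0 : ℝ) 1)
    (hT : ∀ l < L, ∀ i < l, T i ≤ T l - a l)
    (hzero : ∀ l < L, ∀ x, T l ≤ x → f l x = 0)
    (hlow : ∀ l < L, ∀ x ∈ Ioo (T l - a l) (T l), (T l - x) ^ (θ l - 1 / 2) ≤ |f l x|) :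
    P {ω | ∀ l < L, |I (hf l).toLp ω| < r} ≤
      ∏ l ∈ Finset.range L, ENNReal.ofReal (r / (a l ^ θ l / 2)) := by
  have h := hI.measure_small_ball_le (fun l => (hf l).toLp)
    (fun l => ((hf l).indicator (measurableSet_Ioo (a := T l - a l) (b := T l))).toLp)
    (fun l => Real.toNNReal (a l ^ θ l / 2)) r L ?_ ?_ ?_ ?_
  · refine h.trans (le_of_eq (Finset.prod_congr rfl fun l hl => ?_))
    have := ha l (Finset.mem_range.1 hl)
    rw [Real.coe_toNNReal _ (by positivity)]
  · intro l hl i hi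
    refine inner_toLp_eq_zero _ _ fun x => ?_
    by_cases hm : x ∈ Ioo (T l - a l) (T l)
    · rw [hzero i (hi.trans hl) x ((hT l hl i hi).trans hm.1.le), mul_zero]
    · rw [indicator_of_notMem hm, zero_mul]
  · intro l hl
    rw [← MemLp.toLp_sub]
    refine inner_toLp_eq_zero _ _ fun x => ?_
    by_cases hm : x ∈ Ioo (T l - a l) (T l)
    · rw [Pi.sub_apply, indicator_of_mem hm, sub_self, mul_zero]
    · rw [indicator_of_notMem hm, zero_mul]
  · intro l hl
    have := ha l hl
    exact Real.toNNReal_pos.2 (by positivity)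
  · intro l hl
    rw [← NNReal.coe_le_coe, Real.coe_toNNReal _ (by have := ha l hl; positivity), coe_nnnorm]
    exact le_norm_toLp_indicator (hf l) (ha l hl) (hθ l hl) (hlow l hl)

/-- A run of `L` consecutive increments of the field over a dyadic grid is unlikely to be small. -/
theorem IsIsonormal.measure_small_increments_le (hI : IsIsonormal I) {θ : ℝ}
    (hθ : θ ∈ Ioo (0 : ℝ) 1) {h : ℝ} (hh : 0 < h) (t r : ℝ) (L : ℕ) :
    P {ω | ∀ l < L, |I (memLp_fieldKernel hθ (t + (l + 1 : ℕ) * h)).toLp ω -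
      I (memLp_fieldKernel hθ (t + (l : ℕ) * h)).toLp ω| < r} ≤
      ENNReal.ofReal (r / (h ^ θ / 2)) ^ L := by
  have hm : ∀ l : ℕ, MemLp (fieldKernel (t + (l + 1 : ℕ) * h) θ - fieldKernel (t + l * h) θ) 2
      volume := fun l => (memLp_fieldKernel hθ _).sub (memLp_fieldKernel hθ _)
  have hb := hI.measure_small_ball_kernel_le hm (T := fun l => t + (l + 1 : ℕ) * h)
    (a := fun _ => h) (θ := fun _ => θ) r L (fun _ _ => hh) (fun _ _ => hθ) ?_ ?_ ?_
  · rw [Finset.prod_const, Finset.card_range] at hb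
    refine le_trans (measure_mono_ae ?_) hb
    have hsub : ∀ᵐ ω ∂P, ∀ l : ℕ, I (hm l).toLp ω =
        I (memLp_fieldKernel hθ (t + (l + 1 : ℕ) * h)).toLp ω -
          I (memLp_fieldKernel hθ (t + l * h)).toLp ω := by
      rw [ae_all_iff]
      intro l
      rw [MemLp.toLp_sub (memLp_fieldKernel hθ _) (memLp_fieldKernel hθ _), map_sub]
      exact Lp.coeFn_sub _ _
    filter_upwards [hsub] with ω hω h1 l hl
    rw [hω]
    exact h1 l hl
  · intro l _ i hi
    have : ((i + 1 : ℕ) : ℝ) ≤ l := by exact_mod_cast hi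
    push_cast at this ⊢
    nlinarith
  · intro l _ x hx
    simp only [Pi.sub_apply, fieldKernel, posPartPow]
    push_cast at hx ⊢
    have h1 : ¬ 0 < t + (l + 1) * h - x := by linarith
    have h2 : ¬ 0 < t + l * h - x := by nlinarith
    rw [if_neg h1, if_neg h2]
    ring
  -- On the newest cell only the power at the later time survives: the earlier one vanishes and the
  -- `-x` terms cancel.
  · intro l _ x hx
    simp only [Pi.sub_apply, fieldKernel, posPartPow]
    push_cast at hx ⊢
    have h2 : ¬ 0 < t + l * h - x := by
      have := hx.1
      nlinarith
    rw [if_pos (by linarith [hx.2]), if_neg h2]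
    simp only [zero_sub, sub_neg_eq_add, sub_add_cancel]
    exact le_abs_self _

end SmallBall


/-! ### The lower half of (R2) and the existence of a regular pair. -/

section Roughness

theorem exists_bound_of_limsupQuotient_ne_top {f : ℝ → ℝ} {s α : ℝ}
    (h : limsupQuotient f s α ≠ ⊤) :
    ∃ C ≥ 0, ∃ δ > 0, ∀ u, |u - s| < δ → |f u - f s| ≤ C * |u - s| ^ α := by
  obtain ⟨C, hC⟩ : ∃ C : ℝ≥0, limsupQuotient f s α < C :=
    ENNReal.lt_iff_exists_nnreal_btwn.1 (lt_top_iff_ne_top.2 h) |>.imp fun _ h => h.1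
  have h1 : ∀ᶠ u in 𝓝[≠] (0 : ℝ), ENNReal.ofReal (|f (s + u) - f s| / |u| ^ α) < C :=
    eventually_lt_of_limsup_lt hC
  rw [eventually_nhdsWithin_iff, Metric.eventually_nhds_iff] at h1
  obtain ⟨δ, hδ, h2⟩ := h1
  refine ⟨C, C.2, δ, hδ, fun u hu => ?_⟩
  rcases eq_or_ne u s with rfl | hne
  · simp only [sub_self, abs_zero]
    have := Real.rpow_nonneg (le_refl (0 : ℝ)) α
    positivity
  · have h3 : u - s ≠ 0 := sub_ne_zero.2 hne
    have h4 := h2 (y := u - s) (by simpa using hu) h3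
    rw [add_sub_cancel, ENNReal.ofReal_lt_coe_iff (by positivity)] at h4
    have : 0 < |u - s| := abs_pos.2 h3
    rw [div_lt_iff₀ (by positivity)] at h4
    exact h4.le

/-- A finite upper limit at `s` would make all `4m` grid increments next to `s` as small as `mesh ^
(θ + ε)`. Rounding `θ` to the grid of step `mesh ^ 2` changes them by `O(mesh ^ 2)` only, so the
lower bound `mesh ^ (θ' + 1/m)` with `1/m < ε` is contradicted. -/
theorem limsupQuotient_eq_top_of_increments {f : ℝ → ℝ → ℝ}
    (h : ∀ ε M a c : ℝ, 0 < ε → 0 < M → 0 < a → a < c → c < 1 →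
      ∃ C > 0, ∀ t₁ ∈ Icc (-M) M, ∀ t₂ ∈ Icc (-M) M, ∀ θ₁ ∈ Icc a c, ∀ θ₂ ∈ Icc a c,
        |f t₁ θ₁ - f t₂ θ₂| ≤ C * (|t₁ - t₂| ^ (max θ₁ θ₂ - ε) + |θ₁ - θ₂|))
    (hinc : ∀ m : ℕ, 0 < m → ∀ᶠ j : ℕ in atTop, ∀ k : ℤ, |(k : ℝ)| * mesh j ≤ j → ∀ i : ℕ,
      i * mesh j ^ 2 ∈ Ioo (0 : ℝ) 1 → ∃ l < 4 * m, mesh j ^ (i * mesh j ^ 2 + 1 / m : ℝ) ≤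
        |f (k * mesh j + (l + 1 : ℕ) * mesh j) (i * mesh j ^ 2) -
          f (k * mesh j + (l : ℕ) * mesh j) (i * mesh j ^ 2)|)
    {ε : ℝ} (hε : 0 < ε) (s : ℝ) {θ : ℝ} (hθ : θ ∈ Ioo (0 : ℝ) 1) :
    limsupQuotient (fun t => f t θ) s (θ + ε) = ⊤ := by
  by_contra hne
  obtain ⟨C, hC, δ, hδ, hb⟩ := exists_bound_of_limsupQuotient_ne_top hne
  obtain ⟨hθ0, hθ1⟩ := hθ
  obtain ⟨m', hm'⟩ := exists_nat_one_div_lt hε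
  set m := m' + 1 with hm
  have hm0 : (0 : ℝ) < 1 / (m : ℝ) := by positivity
  have hmε : 1 / (m : ℝ) < ε := by rw [hm]; push_cast; exact hm'
  have hm1 : 1 / (m : ℝ) ≤ 1 := by
    rw [hm, div_le_one (by positivity)]; push_cast; linarith [(Nat.cast_nonneg m' : (0 : ℝ) ≤ m')]
  set L : ℝ := 4 * m + 1 with hL
  have hL0 : 0 < L := by positivity
  obtain ⟨C', hC', hlip⟩ := h (θ / 4) (|s| + L) (θ / 2) ((1 + θ) / 2) (by linarith)
    (by positivity) (by linarith) (by linarith) (by linarith)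
  -- The Hölder error and the rounding error, both divided by `mesh j ^ (θ + 1 / m)`; they vanish
  -- since `1 / m < ε` and `θ + 1 / m < 2`.
  have hlim : Tendsto (fun j => 2 * C * L ^ (θ + ε) * mesh j ^ (ε - 1 / m) +
      2 * C' * mesh j ^ (2 - θ - 1 / m)) atTop (𝓝 0) := by
    have e1 : ε - 1 / m ≠ 0 := by linarith
    have e2 : 2 - θ - 1 / m ≠ 0 := by linarith
    have := ((tendsto_mesh.rpow_const (p := ε - 1 / m) (Or.inr (by linarith))).const_mul
      (2 * C * L ^ (θ + ε))).add
      ((tendsto_mesh.rpow_const (p := 2 - θ - 1 / m) (Or.inr (by linarith))).const_mul (2 * C'))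
    simpa only [Real.zero_rpow e1, Real.zero_rpow e2, mul_zero, add_zero] using this
  have hδlim : ∀ᶠ j in atTop, L * mesh j < δ := by
    have := tendsto_mesh.const_mul L
    rw [mul_zero] at this
    exact this.eventually_lt_const hδ
  have hθlim : ∀ᶠ j in atTop, mesh j < θ / 2 := tendsto_mesh.eventually_lt_const (by linarith)
  have hjlim : ∀ᶠ j : ℕ in atTop, |s| + 1 ≤ j := tendsto_natCast_atTop_atTop.eventually_ge_atTop _
  obtain ⟨j, h1, h2, h3, h4, h5⟩ := (hlim.eventually_lt_const one_pos |>.and (hδlim.and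
    (hθlim.and (hjlim.and (hinc m (by omega)))))).exists
  have hq := mesh_pos j
  have hq1 := mesh_le_one j
  have hq2 : mesh j ^ 2 ≤ mesh j := by nlinarith
  set i := ⌊θ / mesh j ^ 2⌋₊ with hi
  set θ' := i * mesh j ^ 2 with hθ'
  have hi1 : θ' ≤ θ := by
    rw [hθ', ← le_div_iff₀ (by positivity)]
    exact Nat.floor_le (by positivity)
  have hi2 : θ < θ' + mesh j ^ 2 := by
    have := Nat.lt_floor_add_one (θ / mesh j ^ 2)
    rw [div_lt_iff₀ (by positivity)] at this
    rw [hθ', hi]; linarith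
  set k := ⌊s / mesh j⌋ with hk
  obtain ⟨l, hl, h6⟩ := h5 k ((abs_floor_mul_mesh_le le_rfl).trans h4) i
    ⟨by rw [← hθ']; linarith, by rw [← hθ']; linarith⟩
  rw [← hθ'] at h6
  have hfl1 : k * mesh j ≤ s := dyadicFloor_le j s
  have hfl2 : s < k * mesh j + mesh j := lt_dyadicFloor_add j s
  have hpt : ∀ l' : ℕ, l' ≤ 4 * m → |k * mesh j + l' * mesh j - s| ≤ L * mesh j := by
    intro l' hl'
    have : (l' : ℝ) ≤ 4 * m := by exact_mod_cast hl'
    have h7 : (l' : ℝ) * mesh j ≤ 4 * m * mesh j := by gcongr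
    have h8 : (0 : ℝ) ≤ l' * mesh j := by positivity
    rw [abs_le, hL]
    constructor <;> nlinarith
  have hmem : ∀ l' : ℕ, l' ≤ 4 * m →
      k * mesh j + l' * mesh j ∈ Icc (-(|s| + L)) (|s| + L) := by
    intro l' hl'
    have h7 := abs_le.1 (hpt l' hl')
    have h8 := abs_le.1 (le_refl |s|)
    have h9 : L * mesh j ≤ L := by nlinarith
    exact ⟨by linarith, by linarith⟩
  have hhold : ∀ l' : ℕ, l' ≤ 4 * m →
      |f (k * mesh j + l' * mesh j) θ - f s θ| ≤ C * (L ^ (θ + ε) * mesh j ^ (θ + ε)) := by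
    intro l' hl'
    have h7 := hpt l' hl'
    refine (hb _ (h7.trans_lt h2)).trans (mul_le_mul_of_nonneg_left ?_ hC)
    rw [← Real.mul_rpow hL0.le hq.le]
    exact Real.rpow_le_rpow (abs_nonneg _) h7 (by linarith)
  have hlip' : ∀ l' : ℕ, l' ≤ 4 * m → |f (k * mesh j + l' * mesh j) θ' -
      f (k * mesh j + l' * mesh j) θ| ≤ C' * mesh j ^ 2 := by
    intro l' hl'
    have h7 := hlip _ (hmem l' hl') _ (hmem l' hl') θ' ⟨by linarith, by linarith⟩ θ
      ⟨by linarith, by linarith⟩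
    rw [sub_self, abs_zero, max_eq_right hi1, Real.zero_rpow (by linarith), zero_add] at h7
    refine h7.trans (mul_le_mul_of_nonneg_left ?_ hC'.le)
    rw [abs_le]
    constructor <;> linarith
  have hup : mesh j ^ (θ + 1 / m) ≤ 2 * C * L ^ (θ + ε) * mesh j ^ (θ + ε) +
      2 * C' * mesh j ^ 2 := by
    have e1 := abs_le.1 (hhold (l + 1) (by omega))
    have e2 := abs_le.1 (hhold l (by omega))
    have e3 := abs_le.1 (hlip' (l + 1) (by omega))
    have e4 := abs_le.1 (hlip' l (by omega))
    calc mesh j ^ (θ + 1 / m) ≤ mesh j ^ (θ' + 1 / m) :=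
          Real.rpow_le_rpow_of_exponent_ge hq hq1 (by linarith)
      _ ≤ _ := h6
      _ ≤ _ := abs_le.2 ⟨by linarith, by linarith⟩
  have hp : 0 < mesh j ^ (θ + 1 / m) := by positivity
  have e1 : mesh j ^ (θ + ε) = mesh j ^ (ε - 1 / m) * mesh j ^ (θ + 1 / m) := by
    rw [← Real.rpow_add hq]; ring_nf
  have e2 : mesh j ^ 2 = mesh j ^ (2 - θ - 1 / m) * mesh j ^ (θ + 1 / m) := by
    rw [← Real.rpow_add hq, ← Real.rpow_two]; ring_nf
  rw [e1, e2] at hup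
  nlinarith

variable {Ω : Type*} [MeasurableSpace Ω] {P : Measure Ω} [IsProbabilityMeasure P]
  {I : Lp ℝ 2 (volume : Measure ℝ) →L[ℝ] Lp ℝ 2 P}

/-- Borel–Cantelli: each increment is small with conditional probability at most `2 * mesh ^ (1/m)`,
so a run of `4m` of them costs `2 ^ (4m) * mesh ^ 4`. This beats the number of grid points `(k, i)`,
which is of order `j * mesh ^ (-3)`. -/
theorem IsIsonormal.ae_eventually_increments (hI : IsIsonormal I) {B : ℝ → ℝ → Ω → ℝ}
    (hB : ∀ (t θ : ℝ) (hθ : θ ∈ Ioo (0 : ℝ) 1), B t θ =ᵐ[P] I (memLp_fieldKernel hθ t).toLp)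
    {m : ℕ} (hm : 0 < m) :
    ∀ᵐ ω ∂P, ∀ᶠ j : ℕ in atTop, ∀ k : ℤ, |(k : ℝ)| * mesh j ≤ j → ∀ i : ℕ,
      i * mesh j ^ 2 ∈ Ioo (0 : ℝ) 1 → ∃ l < 4 * m, mesh j ^ (i * mesh j ^ 2 + 1 / m : ℝ) ≤
        |B (k * mesh j + (l + 1 : ℕ) * mesh j) (i * mesh j ^ 2) ω -
          B (k * mesh j + (l : ℕ) * mesh j) (i * mesh j ^ 2) ω| := by
  set S : ℕ → ℤ → ℕ → Set Ω := fun j k i => {ω | ∀ l < 4 * m,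
    |B (k * mesh j + (l + 1 : ℕ) * mesh j) (i * mesh j ^ 2) ω -
      B (k * mesh j + (l : ℕ) * mesh j) (i * mesh j ^ 2) ω| <
      mesh j ^ (i * mesh j ^ 2 + 1 / m : ℝ)} with hS
  have hinv : ∀ j, ((2 : ℝ) ^ j) * mesh j = 1 := fun j => by
    rw [mesh, ← mul_pow]; norm_num
  have h1 : ∀ (j : ℕ) (k : ℤ) (i : ℕ), i * mesh j ^ 2 ∈ Ioo (0 : ℝ) 1 →
      P (S j k i) ≤ ENNReal.ofReal (2 ^ (4 * m) * mesh j ^ 4) := by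
    intro j k i hθ
    have hq := mesh_pos j
    have h2 := hI.measure_small_increments_le hθ hq (k * mesh j)
      (mesh j ^ (i * mesh j ^ 2 + 1 / m : ℝ)) (4 * m)
    have h3 : mesh j ^ (i * mesh j ^ 2 + 1 / m : ℝ) / (mesh j ^ (i * mesh j ^ 2 : ℝ) / 2)
        = 2 * mesh j ^ (1 / m : ℝ) := by
      rw [Real.rpow_add hq]
      field_simp
    rw [h3, ← ENNReal.ofReal_pow (by positivity), mul_pow] at h2
    have h4 : (mesh j ^ (1 / m : ℝ)) ^ (4 * m) = mesh j ^ 4 := by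
      rw [← Real.rpow_natCast, ← Real.rpow_mul hq.le, ← Real.rpow_natCast]
      congr 1
      push_cast
      field_simp
    rw [h4] at h2
    refine le_trans (measure_mono_ae ?_) h2
    have h5 : ∀ᵐ ω ∂P, ∀ l : ℕ, B (k * mesh j + l * mesh j) (i * mesh j ^ 2) ω =
        I (memLp_fieldKernel hθ (k * mesh j + l * mesh j)).toLp ω :=
      ae_all_iff.2 fun l => hB _ _ hθ
    filter_upwards [h5] with ω hω h6 l hl
    rw [← hω, ← hω]
    exact h6 l hl
  set U : ℕ → Set Ω := fun j => ⋃ k ∈ Finset.Icc (-(j * 2 ^ j : ℤ)) (j * 2 ^ j),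
    ⋃ i ∈ Finset.Ioo 0 (4 ^ j), S j k i with hU
  -- There are `2 * j * 2 ^ j + 1` times and fewer than `4 ^ j` parameters; one factor of the mesh
  -- remains for summability.
  have h2 : ∀ j, P (U j) ≤ ENNReal.ofReal (2 ^ (4 * m) * ((2 * j + 1) * (1 / 2) ^ j)) := by
    intro j
    have h3 : ∀ k ∈ Finset.Icc (-(j * 2 ^ j : ℤ)) (j * 2 ^ j),
        P (⋃ i ∈ Finset.Ioo 0 (4 ^ j), S j k i) ≤
          ENNReal.ofReal (4 ^ j * (2 ^ (4 * m) * mesh j ^ 4)) := by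
      intro k _
      refine (measure_biUnion_finset_le _ _).trans ((Finset.sum_le_card_nsmul _ _
        (ENNReal.ofReal (2 ^ (4 * m) * mesh j ^ 4)) fun i hi => h1 j k i ?_).trans ?_)
      · rw [Finset.mem_Ioo] at hi
        have h4 : (i : ℝ) < 4 ^ j := by exact_mod_cast hi.2
        have h5 : (0 : ℝ) < i := by exact_mod_cast hi.1
        have hq := mesh_pos j
        refine ⟨by positivity, ?_⟩
        calc i * mesh j ^ 2 < 4 ^ j * mesh j ^ 2 := by gcongr
          _ = ((2 : ℝ) ^ j * mesh j) ^ 2 := by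
            rw [mul_pow, ← pow_mul, mul_comm j, pow_mul]; norm_num
          _ = 1 := by rw [hinv, one_pow]
      · rw [nsmul_eq_mul, ENNReal.ofReal_mul (p := 4 ^ j) (by positivity)]
        gcongr
        rw [ENNReal.ofReal_pow (by norm_num), Nat.card_Ioo]
        norm_num
    refine (measure_biUnion_finset_le _ _).trans ((Finset.sum_le_card_nsmul _ _ _ h3).trans ?_)
    rw [nsmul_eq_mul, Int.card_Icc, ← ENNReal.ofReal_natCast,
      ← ENNReal.ofReal_mul (by positivity)]
    refine ENNReal.ofReal_le_ofReal ?_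
    have hc : (((j * 2 ^ j + 1 - -(j * 2 ^ j) : ℤ).toNat : ℕ) : ℝ) = 2 * j * 2 ^ j + 1 := by
      have : (j * 2 ^ j + 1 - -(j * 2 ^ j) : ℤ).toNat = 2 * j * 2 ^ j + 1 := by
        have : (j * 2 ^ j + 1 - -(j * 2 ^ j) : ℤ) = ((2 * j * 2 ^ j + 1 : ℕ) : ℤ) := by
          push_cast; ring
        rw [this, Int.toNat_natCast]
      rw [this]; push_cast; ring
    rw [hc]
    have hq := mesh_pos j
    have hp : (1 : ℝ) ≤ 2 ^ j := one_le_pow₀ (by norm_num)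
    calc (2 * j * 2 ^ j + 1) * (4 ^ j * (2 ^ (4 * m) * mesh j ^ 4))
        ≤ ((2 * j + 1) * 2 ^ j) * (4 ^ j * (2 ^ (4 * m) * mesh j ^ 4)) := by gcongr; nlinarith
      _ = 2 ^ (4 * m) * ((2 * j + 1) * (((2 : ℝ) ^ j * mesh j) ^ 3 * mesh j)) := by
        rw [show (4 : ℝ) ^ j = (2 ^ j) ^ 2 by rw [← pow_mul, mul_comm j, pow_mul]; norm_num]
        ring
      _ = _ := by rw [hinv, one_pow, one_mul, mesh]
  have h3 : ∑' j, P (U j) ≠ ⊤ := by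
    have hs : Summable fun j : ℕ => (2 : ℝ) ^ (4 * m) * ((2 * j + 1) * (1 / 2) ^ j) := by
      refine Summable.mul_left _ ?_
      have e1 := summable_pow_mul_geometric_of_norm_lt_one (R := ℝ) 1 (r := 1 / 2) (by norm_num)
      have e2 := summable_geometric_of_lt_one (r := (1 / 2 : ℝ)) (by norm_num) (by norm_num)
      refine ((e1.mul_left 2).add e2).congr fun j => ?_
      ring
    exact ne_top_of_le_ne_top hs.tsum_ofReal_ne_top (ENNReal.tsum_le_tsum h2)
  filter_upwards [ae_eventually_notMem h3] with ω hω
  filter_upwards [hω] with j hj k hk i hi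
  by_contra hcon
  push Not at hcon
  refine hj ?_
  simp only [hU, mem_iUnion]
  have hq := mesh_pos j
  refine ⟨k, ?_, i, ?_, hcon⟩
  · rw [Finset.mem_Icc, ← abs_le]
    have : |(k : ℝ)| ≤ j * 2 ^ j := by
      have := mul_le_mul_of_nonneg_right hk (show (0 : ℝ) ≤ 2 ^ j by positivity)
      rwa [mul_assoc, mul_comm (mesh j), hinv, mul_one] at this
    exact_mod_cast this
  · rw [Finset.mem_Ioo]
    constructor
    · have := hi.1
      by_contra h0
      have : i = 0 := by omega
      simp [this] at hi
    · have h4 : (i : ℝ) < 4 ^ j := by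
        have h5 : (4 : ℝ) ^ j * mesh j ^ 2 = 1 := by
          rw [show (4 : ℝ) ^ j = (2 ^ j) ^ 2 by rw [← pow_mul, mul_comm j, pow_mul]; norm_num,
            ← mul_pow, hinv, one_pow]
        have h6 := hi.2
        rw [← h5] at h6
        exact lt_of_mul_lt_mul_right h6 (by positivity)
      exact_mod_cast h4

theorem exists_isRegularModification {W : ℝ → Ω → ℝ} (hW : IsTwoSidedBrownianMotion P W) :
    ∃ (B : ℝ → ℝ → Ω → ℝ) (E : Set Ω), IsRegularModification P W B E := by
  obtain ⟨I, hI, hiff⟩ := hW.exists_wiener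
  obtain ⟨F, hF, hFI⟩ := hI.exists_isHolomorphicPath
  have hinc : ∀ᵐ ω ∂P, ∀ m : ℕ, 0 < m → ∀ᶠ j : ℕ in atTop, ∀ k : ℤ, |(k : ℝ)| * mesh j ≤ j →
      ∀ i : ℕ, i * mesh j ^ 2 ∈ Ioo (0 : ℝ) 1 →
      ∃ l < 4 * m, mesh j ^ (i * mesh j ^ 2 + 1 / m : ℝ) ≤
        |(F ω (k * mesh j + (l + 1 : ℕ) * mesh j) ((i * mesh j ^ 2 : ℝ) : ℂ)).re -
          (F ω (k * mesh j + (l : ℕ) * mesh j) ((i * mesh j ^ 2 : ℝ) : ℂ)).re| := by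
    simp only [ae_all_iff]
    intro m hm
    exact hI.ae_eventually_increments (B := fun t θ ω => (F ω t θ).re) hFI hm
  obtain ⟨E, hE1, hE2, hE3⟩ := (hF.and hinc).exists_measurable_mem
  refine ⟨fun t θ ω => (F ω t θ).re, E, fun t θ hθ => (hiff _ _).2 ⟨_, hFI t θ hθ⟩, hE2,
    prob_compl_eq_zero_iff hE2 |>.1 hE1, fun ω hω => ?_⟩
  obtain ⟨h1, h2⟩ := hE3 ω hω
  have h0 := h1.holder 0
  simp only [partialTheta, iteratedDeriv_zero] at h0
  exact ⟨continuousOn_of_holder h0, fun ε hε s θ hθ => limsupQuotient_eq_zero_of_holder h0 hε s hθ,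
    fun ε hε s θ hθ => limsupQuotient_eq_top_of_increments h0 h2 hε s hθ, fun t => h1.contDiffOn t,
    h1.holder⟩

end Roughness


/-! ### Energy and Hausdorff measure of zero sets. -/

section Energy

/-- An efficient cover is thickened to an open one. The radii satisfy `(2 δ n) ^ γ = e n` with `e`
of small sum, and subadditivity of the power `γ ≤ 1` adds this to the old diameters. -/
theorem exists_open_cover_of_hausdorffMeasure_eq_zero {A : Set ℝ} {γ : ℝ} (hγ0 : 0 < γ)
    (hγ1 : γ ≤ 1) (h : μH[γ] A = 0) {ε : ℝ≥0∞} (hε : ε ≠ 0) :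
    ∃ U : ℕ → Set ℝ, (∀ n, IsOpen (U n)) ∧ A ⊆ ⋃ n, U n ∧ ∑' n, Metric.ediam (U n) ^ γ ≤ ε := by
  have hε2 : ε / 2 ≠ 0 := (ENNReal.half_pos hε).ne'
  have h1 : ⨅ (t : ℕ → Set ℝ) (_ : A ⊆ ⋃ n, t n) (_ : ∀ n, Metric.ediam (t n) ≤ 1),
      ∑' n, ⨆ _ : (t n).Nonempty, Metric.ediam (t n) ^ γ < ε / 2 := by
    refine lt_of_le_of_lt ?_ (pos_iff_ne_zero.2 hε2)
    rw [← h, Measure.hausdorffMeasure_apply]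
    exact le_iSup₂_of_le (1 : ℝ≥0∞) one_pos le_rfl
  simp only [iInf_lt_iff] at h1
  obtain ⟨t, ht, -, hsum⟩ := h1
  obtain ⟨e, he0, he⟩ := ENNReal.exists_pos_sum_of_countable hε2 ℕ
  set δ : ℕ → ℝ≥0 := fun n => e n ^ (1 / γ) / 2 with hδ
  have hδ0 : ∀ n, 0 < δ n := fun n => by
    have := NNReal.rpow_pos (p := 1 / γ) (he0 n)
    simp only [hδ]; positivity
  refine ⟨fun n => Metric.thickening (δ n) (t n), fun n => Metric.isOpen_thickening,
    ht.trans (iUnion_mono fun n => Metric.self_subset_thickening (hδ0 n) _), ?_⟩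
  have h2 : ∀ n, Metric.ediam (Metric.thickening (δ n) (t n)) ^ γ ≤
      (⨆ _ : (t n).Nonempty, Metric.ediam (t n) ^ γ) + e n := by
    intro n
    rcases (t n).eq_empty_or_nonempty with h0 | h0
    · simp [h0, ENNReal.zero_rpow_of_pos hγ0]
    · simp only [h0, iSup_pos]
      refine (ENNReal.rpow_le_rpow (Metric.ediam_thickening_le (δ n)) hγ0.le).trans
        ((ENNReal.rpow_add_le_add_rpow _ _ hγ0.le hγ1).trans (add_le_add_right (le_of_eq ?_) _))
      have h3 : (2 : ℝ≥0∞) * δ n = ((e n ^ (1 / γ) : ℝ≥0) : ℝ≥0∞) := by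
        rw [hδ]
        have : (2 : ℝ≥0) * (e n ^ (1 / γ) / 2) = e n ^ (1 / γ) := by field_simp
        rw [← this]; push_cast; rfl
      rw [h3, ← ENNReal.coe_rpow_of_nonneg _ hγ0.le, ← NNReal.rpow_mul,
        one_div_mul_cancel hγ0.ne', NNReal.rpow_one]
  calc ∑' n, Metric.ediam (Metric.thickening (δ n) (t n)) ^ γ
      ≤ ∑' n, ((⨆ _ : (t n).Nonempty, Metric.ediam (t n) ^ γ) + e n) := ENNReal.tsum_le_tsum h2
    _ = ∑' n, (⨆ _ : (t n).Nonempty, Metric.ediam (t n) ^ γ) + ∑' n, (e n : ℝ≥0∞) :=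
      ENNReal.tsum_add
    _ ≤ ε / 2 + ε / 2 := add_le_add hsum.le he.le
    _ = ε := ENNReal.add_halves ε

/-- A weighted arithmetic-geometric inequality, applied with `x` a mass and `d` a power of a
diameter: it trades mass against energy without Cauchy–Schwarz over the cover. -/
theorem ENNReal.le_inv_mul_add_mul_sq {x d κ : ℝ≥0∞} (hκ0 : κ ≠ 0) (hκ : κ ≠ ⊤) :
    x ≤ κ⁻¹ * d + κ * (d⁻¹ * x ^ 2) := by
  rcases eq_or_ne x 0 with rfl | hx0
  · exact zero_le
  rcases eq_or_ne d 0 with rfl | hd0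
  · simp [hx0, hκ0, ENNReal.mul_top, ENNReal.top_mul]
  rcases eq_or_ne d ⊤ with rfl | hd
  · simp [ENNReal.mul_top, hκ]
  rcases eq_or_ne x ⊤ with rfl | hx
  · simp [ENNReal.mul_top, hκ0, ENNReal.inv_ne_zero.2 hd]
  lift x to ℝ≥0 using hx
  lift d to ℝ≥0 using hd
  lift κ to ℝ≥0 using hκ
  have hκ' : κ ≠ 0 := by simpa using hκ0
  have hd' : d ≠ 0 := by simpa using hd0
  rw [← ENNReal.coe_inv hκ', ← ENNReal.coe_inv hd']
  norm_cast
  rw [← NNReal.coe_le_coe]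
  push_cast
  have hκp : (0 : ℝ) < κ := by positivity
  have hdp : (0 : ℝ) < d := by positivity
  have hx := x.2
  have h1 : (κ : ℝ)⁻¹ * d + κ * ((d : ℝ)⁻¹ * x ^ 2) = (d ^ 2 + (κ * x) ^ 2) / (κ * d) := by
    field_simp
  rw [h1, le_div_iff₀ (by positivity)]
  nlinarith [sq_nonneg ((d : ℝ) - κ * x), mul_nonneg (mul_nonneg hκp.le hdp.le) hx]

variable {S : Set ℝ} {γ : ℝ}

/-- The energy of Lebesgue measure on `S`. -/
noncomputable def energy (γ : ℝ) (S : Set ℝ) : ℝ≥0∞ :=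
  ∫⁻ p in S ×ˢ S, (edist p.1 p.2 ^ γ)⁻¹ ∂((volume : Measure ℝ).prod volume)

theorem le_energy (hγ : 0 ≤ γ) {V U : Set ℝ} (hV : MeasurableSet V) (hVU : V ⊆ U) :
    (Metric.ediam U ^ γ)⁻¹ * volume V ^ 2 ≤ energy γ V := by
  have h1 : (volume : Measure ℝ).prod volume (V ×ˢ V) = volume V ^ 2 := by
    rw [Measure.prod_prod, pow_two]
  rw [← h1, energy, ← setLIntegral_const]
  refine setLIntegral_mono' (hV.prod hV) fun p hp => ?_
  refine ENNReal.inv_le_inv.2 (ENNReal.rpow_le_rpow ?_ hγ)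
  exact Metric.edist_le_ediam_of_mem (hVU hp.1) (hVU hp.2)

/-- Cut `S` into disjoint pieces along the cover. On each piece the mass is at most `κ⁻¹` times the
power of the diameter plus `κ` times the energy of the piece, and energies of disjoint pieces add up
to at most that of `S`. -/
theorem volume_le_of_subset_iUnion (hγ : 0 ≤ γ) (hS : MeasurableSet S) {U : ℕ → Set ℝ}
    (hU : ∀ n, MeasurableSet (U n)) (hSU : S ⊆ ⋃ n, U n) {κ : ℝ≥0∞} (hκ0 : κ ≠ 0) (hκ : κ ≠ ⊤) :
    volume S ≤ κ⁻¹ * ∑' n, Metric.ediam (U n) ^ γ + κ * energy γ S := by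
  set V : ℕ → Set ℝ := fun n => disjointed U n ∩ S with hV
  have hVm : ∀ n, MeasurableSet (V n) := fun n => (MeasurableSet.disjointed hU n).inter hS
  have hVd : Pairwise (Function.onFun Disjoint V) := fun i j hij =>
    (disjoint_disjointed U hij).mono inter_subset_left inter_subset_left
  have hVU : ∀ n, V n ⊆ U n := fun n => inter_subset_left.trans (disjointed_subset U n)
  have hVS : ⋃ n, V n = S := by
    rw [hV, ← iUnion_inter, iUnion_disjointed, inter_eq_right.2 hSU]
  have h1 : ∑' n, energy γ (V n) ≤ energy γ S := by
    have h2 : Pairwise (Function.onFun Disjoint fun n => V n ×ˢ V n) := fun i j hij =>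
      Disjoint.set_prod_left (hVd hij) _ _
    unfold energy
    rw [← lintegral_iUnion (fun n => (hVm n).prod (hVm n)) h2]
    refine lintegral_mono_set (iUnion_subset fun n => ?_)
    exact prod_mono inter_subset_right inter_subset_right
  calc volume S = ∑' n, volume (V n) := by rw [← measure_iUnion hVd hVm, hVS]
    _ ≤ ∑' n, (κ⁻¹ * Metric.ediam (U n) ^ γ + κ * energy γ (V n)) := by
        refine ENNReal.tsum_le_tsum fun n =>
          (ENNReal.le_inv_mul_add_mul_sq (d := Metric.ediam (U n) ^ γ) hκ0 hκ).trans ?_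
        gcongr
        exact le_energy hγ (hVm n) (hVU n)
    _ = κ⁻¹ * ∑' n, Metric.ediam (U n) ^ γ + κ * ∑' n, energy γ (V n) := by
        rw [ENNReal.tsum_add, ENNReal.tsum_mul_left, ENNReal.tsum_mul_left]
    _ ≤ _ := by gcongr

/-- Frostman's method: the zero set of a continuous function is large if the rescaled Lebesgue
measures on the sets where the function is small have a non-vanishing mass and a bounded energy. -/
theorem hausdorffMeasure_ne_zero_of_energy (hγ0 : 0 < γ) (hγ1 : γ ≤ 1) {K : Set ℝ}
    (hK : IsCompact K) {g : ℝ → ℝ} (hg : Continuous g) {m T : ℝ≥0∞} (hm : m ≠ 0) (hT : T ≠ ⊤)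
    (h : ∃ᶠ N : ℕ in atTop, m ≤ N * volume {s ∈ K | |g s| < 1 / N} ∧
      N ^ 2 * energy γ {s ∈ K | |g s| < 1 / N} ≤ T) :
    μH[γ] {s ∈ K | g s = 0} ≠ 0 := by
  intro h0
  wlog hmt : m ≠ ⊤ generalizing m
  · exact this (m := 1) one_ne_zero (h.mono fun N hN => ⟨le_trans (by simp [not_not.1 hmt]) hN.1,
      hN.2⟩) ENNReal.one_ne_top
  -- This `κ` keeps the energy contribution below `m / 4`; the cover is then chosen so fine that it
  -- contributes at most `m / 4` as well, leaving total mass below `m`.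
  obtain ⟨κ, hκ0, hκt, hκ⟩ : ∃ κ : ℝ≥0∞, κ ≠ 0 ∧ κ ≠ ⊤ ∧ κ * T ≤ m / 4 := by
    refine ⟨m / 4 / (T + 1), ?_, ?_, ?_⟩
    · exact (ENNReal.div_pos (ENNReal.div_pos hm (by norm_num)).ne' (by simp [hT])).ne'
    · exact (ENNReal.div_lt_top (ENNReal.div_lt_top hmt (by norm_num)).ne (by simp)).ne
    · refine (mul_le_mul_right (le_add_of_nonneg_right zero_le_one : T ≤ T + 1) _).trans ?_
      rw [ENNReal.div_mul_cancel (by simp) (by simp [hT])]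
  have hm4 : m / 4 ≠ 0 := (ENNReal.div_pos hm (by norm_num)).ne'
  obtain ⟨U, hUo, hUc, hUs⟩ := exists_open_cover_of_hausdorffMeasure_eq_zero hγ0 hγ1 h0
    (ε := κ * (m / 4)) (mul_ne_zero hκ0 hm4)
  have hO : IsOpen (⋃ n, U n) := isOpen_iUnion hUo
  have hKO : IsCompact (K \ ⋃ n, U n) := hK.diff hO
  -- On the compact set left uncovered, `|g|` has a positive minimum, so the open cover of the zero
  -- set eventually contains the sets where `g` is small.
  have hev : ∀ᶠ N : ℕ in atTop, {s ∈ K | |g s| < 1 / N} ⊆ ⋃ n, U n := by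
    rcases (K \ ⋃ n, U n).eq_empty_or_nonempty with he | hne
    · exact Eventually.of_forall fun N s hs => sdiff_eq_empty.1 he hs.1
    · obtain ⟨s₀, hs₀, hmin⟩ := hKO.exists_isMinOn hne hg.abs.continuousOn
      have hpos : 0 < |g s₀| := abs_pos.2 fun h => hs₀.2 (hUc ⟨hs₀.1, h⟩)
      filter_upwards [(tendsto_one_div_atTop_nhds_zero_nat (𝕜 := ℝ)).eventually_lt_const hpos]
        with N hN s hs
      by_contra hsn
      exact absurd (hmin ⟨hs.1, hsn⟩) (not_le.2 (hs.2.trans hN))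
  obtain ⟨N, ⟨hN1, hN2⟩, hNU, hN0⟩ := (h.and_eventually (hev.and (eventually_gt_atTop 0))).exists
  set S := {s ∈ K | |g s| < 1 / N} with hS
  have hSm : MeasurableSet S := hK.measurableSet.inter
    (measurableSet_lt hg.abs.measurable measurable_const)
  have hN' : (N : ℝ≥0∞) ≠ 0 := by simpa using hN0.ne'
  have hNt : (N : ℝ≥0∞) ≠ ⊤ := by simp
  -- Lebesgue measure is scaled by `N` and its energy by `N ^ 2`, hence the weight `κ * N`.
  have h1 := volume_le_of_subset_iUnion hγ0.le hSm (fun n => (hUo n).measurableSet) hNU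
    (κ := κ * N) (mul_ne_zero hκ0 hN') (ENNReal.mul_ne_top hκt hNt)
  have h2 : N * volume S ≤ m / 4 + m / 4 := by
    calc N * volume S ≤ N * ((κ * N)⁻¹ * ∑' n, Metric.ediam (U n) ^ γ + κ * N * energy γ S) := by
          gcongr
      _ ≤ N * ((κ * N)⁻¹ * (κ * (m / 4)) + κ * N * energy γ S) := by gcongr
      _ = (κ * N)⁻¹ * (κ * N) * (m / 4) + κ * (N ^ 2 * energy γ S) := by ring
      _ ≤ m / 4 + κ * T := by
          rw [ENNReal.inv_mul_cancel (mul_ne_zero hκ0 hN') (ENNReal.mul_ne_top hκt hNt), one_mul]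
          gcongr
      _ ≤ m / 4 + m / 4 := by gcongr
  have h3 : m / 4 + m / 4 < m := by
    lift m to ℝ≥0 using hmt
    have hm' : 0 < m := pos_iff_ne_zero.2 (by simpa using hm)
    have : (m : ℝ≥0∞) / 4 = ((m / 4 : ℝ≥0) : ℝ≥0∞) := by
      rw [ENNReal.coe_div (by norm_num)]; rfl
    rw [this, ← ENNReal.coe_add, ENNReal.coe_lt_coe, ← NNReal.coe_lt_coe]
    push_cast
    have : (0 : ℝ) < m := hm'
    linarith
  exact absurd (hN1.trans h2) (not_le.2 h3)

end Energy


/-! ### Second moment method for zeros of a random function. -/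

section RandomZeros

theorem lintegral_enorm_rpow_inv_lt_top {ρ : ℝ} (hρ : ρ < 1) :
    ∫⁻ u in Ioc (-2 : ℝ) 2, (‖u‖ₑ ^ ρ)⁻¹ < ⊤ := by
  have h1 : IntervalIntegrable (fun u : ℝ => |u| ^ (-ρ)) volume 0 2 := by
    refine (intervalIntegral.intervalIntegrable_rpow' (r := -ρ) (by linarith)).congr
      (f := fun u : ℝ => u ^ (-ρ)) fun u hu => ?_
    rw [uIoc_of_le zero_le_two] at hu
    simp only [abs_of_pos hu.1]
  have h2 : IntervalIntegrable (fun u : ℝ => |u| ^ (-ρ)) volume (-2) 0 := by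
    have := (IntervalIntegrable.iff_comp_neg (by finiteness)).1 h1
    simpa using this.symm
  have h3 : IntegrableOn (fun u : ℝ => |u| ^ (-ρ)) (Ioc (-2) 2) :=
    (intervalIntegrable_iff_integrableOn_Ioc_of_le (by norm_num)).1 (h2.trans h1)
  refine lt_of_le_of_lt (le_of_eq (lintegral_congr_ae ?_)) h3.2
  filter_upwards [(Measure.ae_ne volume (0 : ℝ)).filter_mono
    (Measure.restrict_le_self.absolutelyContinuous.ae_le)] with u hu
  have hu' : 0 < |u| := abs_pos.2 hu
  rw [Real.enorm_eq_ofReal_abs u, Real.enorm_eq_ofReal (Real.rpow_nonneg (abs_nonneg u) _),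
    ENNReal.ofReal_rpow_of_pos hu', ← ENNReal.ofReal_inv_of_pos (by positivity),
    Real.rpow_neg hu'.le]

/-- After translation by `s`, each inner integral is bounded by the integral of `|u| ^ (-ρ)` over
`(-2, 2]`. -/
theorem energy_Icc_lt_top {α β ρ : ℝ} (hαβ : β - α ≤ 1) (hρ : ρ < 1) :
    energy ρ (Icc α β) < ⊤ := by
  have hm : Measurable fun p : ℝ × ℝ => (edist p.1 p.2 ^ ρ)⁻¹ := by fun_prop
  set c := ∫⁻ u in Ioc (-2 : ℝ) 2, (‖u‖ₑ ^ ρ)⁻¹ with hc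
  have h1 : ∀ s ∈ Icc α β, ∫⁻ t in Icc α β, (edist s t ^ ρ)⁻¹ ≤ c := by
    intro s hs
    rw [hc, ← lintegral_indicator measurableSet_Icc, ← lintegral_indicator measurableSet_Ioc,
      ← lintegral_sub_right_eq_self (indicator (Ioc (-2 : ℝ) 2) fun u => (‖u‖ₑ ^ ρ)⁻¹) s]
    refine lintegral_mono fun t => ?_
    by_cases ht : t ∈ Icc α β
    · have h2 : t - s ∈ Ioc (-2 : ℝ) 2 :=
        ⟨by linarith [ht.1, hs.2], by linarith [ht.2, hs.1]⟩
      rw [indicator_of_mem ht, indicator_of_mem h2, edist_comm, edist_eq_enorm_sub]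
    · rw [indicator_of_notMem ht]; exact zero_le
  rw [energy, ← Measure.prod_restrict, lintegral_prod _ hm.aemeasurable]
  calc ∫⁻ s in Icc α β, ∫⁻ t in Icc α β, (edist s t ^ ρ)⁻¹
      ≤ ∫⁻ _ in Icc α β, c := setLIntegral_mono' measurableSet_Icc h1
    _ = c * volume (Icc α β) := setLIntegral_const _ _
    _ < ⊤ := ENNReal.mul_lt_top (lintegral_enorm_rpow_inv_lt_top hρ) measure_Icc_lt_top

variable {Ω : Type*} [MeasurableSpace Ω] {P : Measure Ω} [IsProbabilityMeasure P]

/-- A Paley–Zygmund inequality for the set where `X` is large and its energy `E ≥ X ^ 2` is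
bounded. -/
theorem exists_measure_ge {m E₀ : ℝ≥0∞} (hm0 : m ≠ 0) (hm : m ≠ ⊤) (hE : E₀ ≠ ⊤) :
    ∃ a T p : ℝ≥0∞, a ≠ 0 ∧ T ≠ ⊤ ∧ p ≠ 0 ∧ ∀ X E : Ω → ℝ≥0∞, Measurable X → Measurable E →
      (∀ ω, X ω ^ 2 ≤ E ω) → m ≤ ∫⁻ ω, X ω ∂P → ∫⁻ ω, E ω ∂P ≤ E₀ →
      p ≤ P {ω | a ≤ X ω ∧ E ω ≤ T} := by
  obtain ⟨κ, hκ0, hκt, hκ⟩ : ∃ κ : ℝ≥0∞, κ ≠ 0 ∧ κ ≠ ⊤ ∧ 2 * κ * E₀ ≤ m / 4 := by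
    have h8 : m / 4 / 2 ≠ 0 := (ENNReal.div_pos (ENNReal.div_pos hm0 (by norm_num)).ne'
      (by norm_num)).ne'
    have h8' : m / 4 / 2 ≠ ⊤ := (ENNReal.div_lt_top (ENNReal.div_lt_top hm (by norm_num)).ne
      (by norm_num)).ne
    refine ⟨m / 4 / 2 / (E₀ + 1), ?_, ?_, ?_⟩
    · exact (ENNReal.div_pos h8 (by simp [hE])).ne'
    · exact (ENNReal.div_lt_top h8' (by simp)).ne
    · calc 2 * (m / 4 / 2 / (E₀ + 1)) * E₀ ≤ 2 * (m / 4 / 2 / (E₀ + 1)) * (E₀ + 1) := by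
            gcongr
            exact le_add_of_nonneg_right zero_le_one
        _ = m / 4 := by
            rw [mul_assoc, ENNReal.div_mul_cancel (by simp) (by simp [hE]),
              ENNReal.mul_div_cancel (by norm_num) (by norm_num)]
  have hm4 : m / 4 ≠ 0 := (ENNReal.div_pos hm0 (by norm_num)).ne'
  have hm2 : m / 2 ≠ 0 := (ENNReal.div_pos hm0 (by norm_num)).ne'
  refine ⟨m / 4, κ⁻¹ ^ 2, κ * (m / 2), hm4, ENNReal.pow_ne_top (ENNReal.inv_ne_top.2 hκ0),
    mul_ne_zero hκ0 hm2, fun X E hX hEm hXE hmX hEE => ?_⟩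
  set G := {ω | m / 4 ≤ X ω ∧ E ω ≤ κ⁻¹ ^ 2} with hG
  have hGm : MeasurableSet G :=
    (measurableSet_le measurable_const hX).inter (measurableSet_le hEm measurable_const)
  -- Three cases: `X < m / 4`; or `E > κ⁻²`, where `κ⁻¹ ≤ κ * E`; or `ω ∈ G`, where `X ≤ κ⁻¹ + κ *
  -- E`. After integration the first two terms use up `m / 2`, which leaves `m / 2` for `κ⁻¹ * P G`.
  -- The last summand is zero.
  have hpt : ∀ ω, X ω ≤ m / 4 + 2 * κ * E ω + κ⁻¹ * G.indicator 1 ω + κ * E ω * 0 := by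
    intro ω
    rw [mul_zero, add_zero]
    have h1 : X ω ≤ κ⁻¹ + κ * E ω := by
      have := ENNReal.le_inv_mul_add_mul_sq (x := X ω) (d := 1) hκ0 hκt
      rw [mul_one, inv_one, one_mul] at this
      exact this.trans (by gcongr; exact hXE ω)
    by_cases h2 : X ω < m / 4
    · exact h2.le.trans (by rw [add_assoc]; exact le_self_add)
    by_cases h3 : E ω ≤ κ⁻¹ ^ 2
    · rw [indicator_of_mem (show ω ∈ G from ⟨not_lt.1 h2, h3⟩), Pi.one_apply, mul_one]
      calc X ω ≤ κ⁻¹ + κ * E ω := h1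
        _ = 1 * κ * E ω + κ⁻¹ := by rw [add_comm, one_mul]
        _ ≤ 2 * κ * E ω + κ⁻¹ := by gcongr; exact one_le_two
        _ ≤ m / 4 + 2 * κ * E ω + κ⁻¹ := by gcongr; exact le_add_self
    · have h4 : κ⁻¹ ≤ κ * E ω := by
        calc κ⁻¹ = κ * κ⁻¹ ^ 2 := by
              rw [pow_two, ← mul_assoc, ENNReal.mul_inv_cancel hκ0 hκt, one_mul]
          _ ≤ κ * E ω := by gcongr; exact (not_le.1 h3).le
      calc X ω ≤ κ⁻¹ + κ * E ω := h1
        _ ≤ κ * E ω + κ * E ω := by gcongr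
        _ = 2 * κ * E ω := by ring
        _ ≤ m / 4 + 2 * κ * E ω := le_add_self
        _ ≤ _ := le_self_add
  simp only [mul_zero, add_zero] at hpt
  have h1 : ∫⁻ ω, X ω ∂P ≤ m / 4 + 2 * κ * ∫⁻ ω, E ω ∂P + κ⁻¹ * P G := by
    refine (lintegral_mono hpt).trans (le_of_eq ?_)
    rw [lintegral_add_left (by fun_prop), lintegral_add_left (by fun_prop), lintegral_const,
      measure_univ, mul_one, lintegral_const_mul _ hEm, lintegral_const_mul _
      (measurable_one.indicator hGm), lintegral_indicator_one hGm]
  have h2 : m / 2 + m / 2 ≤ m / 2 + κ⁻¹ * P G := by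
    rw [ENNReal.add_halves]
    calc m ≤ _ := hmX.trans h1
      _ ≤ m / 4 + 2 * κ * E₀ + κ⁻¹ * P G := by gcongr
      _ ≤ m / 4 + m / 4 + κ⁻¹ * P G := by gcongr
      _ = m / 2 + κ⁻¹ * P G := by
        congr 1
        rw [← ENNReal.add_halves (m / 2)]
        have : m / 2 / 2 = m / 4 := by
          rw [div_eq_mul_inv, div_eq_mul_inv, div_eq_mul_inv, mul_assoc,
            ← ENNReal.mul_inv (by norm_num) (by norm_num)]
          norm_num
        rw [this]
  have h3 : m / 2 ≤ κ⁻¹ * P G :=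
    (ENNReal.add_le_add_iff_left (ENNReal.div_lt_top hm (by norm_num)).ne).1 h2
  calc κ * (m / 2) ≤ κ * (κ⁻¹ * P G) := by gcongr
    _ = P G := by rw [← mul_assoc, ENNReal.mul_inv_cancel hκ0 hκt, one_mul]

/-- The reverse Fatou inequality for events, by continuity from above of a finite measure. -/
theorem measure_frequently_ge {G : ℕ → Set Ω} (hG : ∀ n, MeasurableSet (G n)) {p : ℝ≥0∞}
    (h : ∀ n > 0, p ≤ P (G n)) : MeasurableSet {ω | ∃ᶠ n in atTop, ω ∈ G n} ∧
      p ≤ P {ω | ∃ᶠ n in atTop, ω ∈ G n} := by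
  have h1 : {ω | ∃ᶠ n in atTop, ω ∈ G n} = ⋂ n, ⋃ i ≥ n, G i := by
    ext ω; simp [frequently_atTop]
  have h2 : ∀ n, MeasurableSet (⋃ i ≥ n, G i) := fun n =>
    MeasurableSet.iUnion fun i => MeasurableSet.iUnion fun _ => hG i
  rw [h1]
  refine ⟨MeasurableSet.iInter h2, ?_⟩
  have h3 : Antitone fun n => ⋃ i ≥ n, G i := fun a b hab =>
    biUnion_subset_biUnion_left fun i (hi : i ≥ b) => hab.trans hi
  refine ge_of_tendsto' (tendsto_measure_iInter_atTop (fun n => (h2 n).nullMeasurableSet) h3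
    ⟨0, measure_ne_top _ _⟩) fun n => (h (n + 1) (by omega)).trans (measure_mono ?_)
  exact subset_biUnion_of_mem (u := G) (show n + 1 ≥ n by omega)

/-- By Fubini, the one-point bound keeps the mean of the scaled mass away from `0`, and the
two-point bound dominates the mean scaled `γ`-energy by the `(h + γ)`-energy of the interval, finite
because `h + γ < 1`. `exists_measure_ge` turns this into events of probability bounded below
uniformly in `N`, and their limsup has positive probability. -/
theorem exists_frequently_energy {Y : ℝ → Ω → ℝ} (hY : Measurable fun p : Ω × ℝ => Y p.2 p.1)
    {α β h γ c C : ℝ} (hαβ : α < β) (hαβ1 : β - α ≤ 1) (hc : 0 < c) (hC : 0 < C) (hh : 0 < h)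
    (hγ : 0 < γ) (hhγ : h + γ < 1)
    (h1 : ∀ s ∈ Icc α β, ∀ N : ℕ, 0 < N → ENNReal.ofReal (c / N) ≤ P {ω | |Y s ω| < 1 / N})
    (h2 : ∀ s ∈ Icc α β, ∀ t ∈ Icc α β, s < t → ∀ N : ℕ, 0 < N →
      P {ω | |Y s ω| < 1 / N ∧ |Y t ω| < 1 / N} ≤
        ENNReal.ofReal (C / N ^ 2) * (edist s t ^ h)⁻¹) :
    ∃ a T : ℝ≥0∞, a ≠ 0 ∧ T ≠ ⊤ ∧ ∃ D : Set Ω, MeasurableSet D ∧ 0 < P D ∧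
      ∀ ω ∈ D, ∃ᶠ N : ℕ in atTop, a ≤ N * volume {s ∈ Icc α β | |Y s ω| < 1 / N} ∧
        N ^ 2 * energy γ {s ∈ Icc α β | |Y s ω| < 1 / N} ≤ T := by
  set S : ℕ → Ω → Set ℝ := fun N ω => {s ∈ Icc α β | |Y s ω| < 1 / N} with hS
  have hA : ∀ N : ℕ, MeasurableSet {q : Ω × ℝ | q.2 ∈ S N q.1} := fun N =>
    (measurable_snd measurableSet_Icc).inter (measurableSet_lt hY.abs measurable_const)
  have hA2 : ∀ N : ℕ, MeasurableSet {q : Ω × ℝ × ℝ | q.2 ∈ S N q.1 ×ˢ S N q.1} := fun N =>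
    MeasurableSet.inter
      ((measurable_fst.prodMk (measurable_fst.comp measurable_snd)) (hA N))
      ((measurable_fst.prodMk (measurable_snd.comp measurable_snd)) (hA N))
  have hSm : ∀ N ω, MeasurableSet (S N ω) := fun N ω => measurable_prodMk_left (hA N)
  set k : ℝ × ℝ → ℝ≥0∞ := fun p => (edist p.1 p.2 ^ γ)⁻¹ with hk
  have hkm : Measurable k := by fun_prop
  set X : ℕ → Ω → ℝ≥0∞ := fun N ω => N * volume (S N ω) with hX
  set En : ℕ → Ω → ℝ≥0∞ := fun N ω => N ^ 2 * energy γ (S N ω) with hEn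
  have hXm : ∀ N, Measurable (X N) := fun N => (measurable_measure_prodMk_left (hA N)).const_mul _
  set F : ℕ → Ω × ℝ × ℝ → ℝ≥0∞ := fun N =>
    {q : Ω × ℝ × ℝ | q.2 ∈ S N q.1 ×ˢ S N q.1}.indicator fun q => k q.2 with hF
  have hFm : ∀ N, Measurable (F N) := fun N => (hkm.comp measurable_snd).indicator (hA2 N)
  have hen : ∀ N ω, energy γ (S N ω) = ∫⁻ p, F N (ω, p) ∂((volume : Measure ℝ).prod volume) := by
    intro N ω
    rw [energy, ← lintegral_indicator ((hSm N ω).prod (hSm N ω))]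
    rfl
  have hEm : ∀ N, Measurable (En N) := fun N => by
    simp only [hEn, hen]
    exact (hFm N).lintegral_prod_right'.const_mul _
  have hXE : ∀ N ω, X N ω ^ 2 ≤ En N ω := by
    intro N ω
    have h3 : volume (S N ω) ^ 2 ≤ energy γ (S N ω) := by
      refine le_trans ?_ (le_energy hγ.le (hSm N ω) (inter_subset_left : S N ω ⊆ Icc α β))
      rw [Real.ediam_Icc]
      refine le_mul_of_one_le_left' (ENNReal.one_le_inv.2 ?_)
      refine ENNReal.rpow_le_one ?_ hγ.le
      rw [← ENNReal.ofReal_one]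
      exact ENNReal.ofReal_le_ofReal hαβ1
    simp only [hX, hEn, mul_pow]
    gcongr
  have hmean : ∀ N > 0, ENNReal.ofReal c * ENNReal.ofReal (β - α) ≤ ∫⁻ ω, X N ω ∂P := by
    intro N hN
    have hN' : (0 : ℝ) < N := by exact_mod_cast hN
    have h3 : ∫⁻ ω, volume (S N ω) ∂P = ∫⁻ s, P {ω | s ∈ S N ω} := by
      have e1 := Measure.prod_apply (μ := P) (ν := (volume : Measure ℝ)) (hA N)
      have e2 := Measure.prod_apply_symm (μ := P) (ν := (volume : Measure ℝ)) (hA N)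
      rw [e1] at e2
      exact e2
    have h4 : ENNReal.ofReal (c / N) * ENNReal.ofReal (β - α) ≤ ∫⁻ s, P {ω | s ∈ S N ω} := by
      rw [← Real.volume_Icc, ← setLIntegral_const]
      refine le_trans (setLIntegral_mono' measurableSet_Icc (g := fun s => P {ω | s ∈ S N ω})
        fun s hs => ?_) (setLIntegral_le_lintegral _ _)
      refine (h1 s hs N hN).trans (measure_mono fun ω hω => ⟨hs, hω⟩)
    simp only [hX]
    rw [lintegral_const_mul' _ _ (by simp), h3]
    calc ENNReal.ofReal c * ENNReal.ofReal (β - α)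
        = N * (ENNReal.ofReal (c / N) * ENNReal.ofReal (β - α)) := by
          rw [← mul_assoc, ← ENNReal.ofReal_natCast, ← ENNReal.ofReal_mul hN'.le,
            mul_div_cancel₀ _ hN'.ne']
      _ ≤ _ := by gcongr
  have henergy : ∀ N > 0, ∫⁻ ω, En N ω ∂P ≤ ENNReal.ofReal C * energy (h + γ) (Icc α β) := by
    intro N hN
    have hN' : (0 : ℝ) < N := by exact_mod_cast hN
    have h3 : ∫⁻ ω, energy γ (S N ω) ∂P =
        ∫⁻ p, ∫⁻ ω, F N (ω, p) ∂P ∂((volume : Measure ℝ).prod volume) := by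
      simp only [hen]
      exact lintegral_lintegral_swap (f := fun ω p => F N (ω, p)) (hFm N).aemeasurable
    -- On the diagonal the right side is infinite, as `0 ^ h = 0` for `h > 0`.
    have hsymm : ∀ s ∈ Icc α β, ∀ t ∈ Icc α β, P {ω | |Y s ω| < 1 / N ∧ |Y t ω| < 1 / N} ≤
        ENNReal.ofReal (C / N ^ 2) * (edist s t ^ h)⁻¹ := by
      intro s hs t ht
      rcases lt_trichotomy s t with hlt | rfl | hlt
      · exact h2 s hs t ht hlt N hN
      · rw [edist_self, ENNReal.zero_rpow_of_pos hh, ENNReal.inv_zero, ENNReal.mul_top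
          (ENNReal.ofReal_pos.2 (by positivity)).ne']
        exact le_top
      · rw [edist_comm]
        simpa only [and_comm] using h2 t ht s hs hlt N hN
    have h4 : ∀ p, ∫⁻ ω, F N (ω, p) ∂P ≤ (Icc α β ×ˢ Icc α β).indicator
        (fun p => ENNReal.ofReal (C / N ^ 2) * (edist p.1 p.2 ^ (h + γ))⁻¹) p := by
      intro p
      by_cases hp : p ∈ Icc α β ×ˢ Icc α β
      · have h5 : ∀ ω, F N (ω, p) = {ω | p ∈ S N ω ×ˢ S N ω}.indicator (fun _ => k p) ω :=
          fun ω => rfl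
        have hm : MeasurableSet {ω | p ∈ S N ω ×ˢ S N ω} := measurable_prodMk_right (hA2 N)
        rw [indicator_of_mem hp]
        simp only [h5]
        rw [lintegral_indicator_const hm]
        calc k p * P {ω | p ∈ S N ω ×ˢ S N ω}
            ≤ k p * (ENNReal.ofReal (C / N ^ 2) * (edist p.1 p.2 ^ h)⁻¹) := by
              gcongr
              refine (measure_mono fun ω hω => ?_).trans (hsymm p.1 hp.1 p.2 hp.2)
              exact ⟨hω.1.2, hω.2.2⟩
          _ = ENNReal.ofReal (C / N ^ 2) * ((edist p.1 p.2 ^ h)⁻¹ * (edist p.1 p.2 ^ γ)⁻¹) := by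
              simp only [hk]; ring
          _ = _ := by
              rw [ENNReal.rpow_add_of_nonneg _ _ hh.le hγ.le, ENNReal.mul_inv]
              · right; exact (ENNReal.rpow_lt_top_of_nonneg hγ.le (edist_ne_top _ _)).ne
              · left; exact (ENNReal.rpow_lt_top_of_nonneg hh.le (edist_ne_top _ _)).ne
      · rw [indicator_of_notMem hp]
        refine le_of_eq ((lintegral_congr fun ω => ?_).trans lintegral_zero)
        refine indicator_of_notMem (fun hq => hp ?_) _
        exact ⟨hq.1.1, hq.2.1⟩
    simp only [hEn]
    rw [lintegral_const_mul' _ _ (by simp), h3]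
    calc (N : ℝ≥0∞) ^ 2 * ∫⁻ p, ∫⁻ ω, F N (ω, p) ∂P ∂((volume : Measure ℝ).prod volume)
        ≤ N ^ 2 * ∫⁻ p, (Icc α β ×ˢ Icc α β).indicator
          (fun p => ENNReal.ofReal (C / N ^ 2) * (edist p.1 p.2 ^ (h + γ))⁻¹) p
            ∂((volume : Measure ℝ).prod volume) := by
          gcongr with p
          exact h4 p
      _ = N ^ 2 * (ENNReal.ofReal (C / N ^ 2) * energy (h + γ) (Icc α β)) := by
          rw [lintegral_indicator (measurableSet_Icc.prod measurableSet_Icc),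
            lintegral_const_mul' _ _ ENNReal.ofReal_ne_top, energy]
      _ = _ := by
          rw [← mul_assoc, ← ENNReal.ofReal_natCast, ← ENNReal.ofReal_pow hN'.le,
            ← ENNReal.ofReal_mul (by positivity), mul_div_cancel₀ _ (by positivity)]
  have hm0 : ENNReal.ofReal c * ENNReal.ofReal (β - α) ≠ 0 :=
    mul_ne_zero (ENNReal.ofReal_pos.2 hc).ne' (ENNReal.ofReal_pos.2 (sub_pos.2 hαβ)).ne'
  obtain ⟨a, T, p, ha, hT, hp, hPZ⟩ := exists_measure_ge (P := P) hm0
    (ENNReal.mul_ne_top ENNReal.ofReal_ne_top ENNReal.ofReal_ne_top)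
    (E₀ := ENNReal.ofReal C * energy (h + γ) (Icc α β))
    (ENNReal.mul_ne_top ENNReal.ofReal_ne_top
      (energy_Icc_lt_top hαβ1 hhγ).ne)
  have hG : ∀ N, MeasurableSet {ω | a ≤ X N ω ∧ En N ω ≤ T} := fun N =>
    (measurableSet_le measurable_const (hXm N)).inter (measurableSet_le (hEm N) measurable_const)
  obtain ⟨hD1, hD2⟩ := measure_frequently_ge hG fun N hN =>
    hPZ (X N) (En N) (hXm N) (hEm N) (hXE N) (hmean N hN) (henergy N hN)
  exact ⟨a, T, ha, hT, _, hD1, (pos_iff_ne_zero.2 hp).trans_le hD2, fun ω hω => hω⟩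

end RandomZeros


/-! ### Kernels of difference quotients in `θ`. -/

section QuotientKernel

/-- The kernel of a difference quotient of the field in its second variable. -/
noncomputable def quotKernel (t θ δ : ℝ) : ℝ → ℝ :=
  δ⁻¹ • (fieldKernel t (θ + δ) - fieldKernel t θ)

theorem memLp_quotKernel {θ δ : ℝ} (hθ : θ ∈ Ioo (0 : ℝ) 1) (hδ : θ + δ ∈ Ioo (0 : ℝ) 1) (t : ℝ) :
    MemLp (quotKernel t θ δ) 2 volume :=
  ((memLp_fieldKernel hδ t).sub (memLp_fieldKernel hθ t)).const_smul _

theorem quotKernel_eq_zero {t θ δ x : ℝ} (ht : 0 ≤ t) (hx : t ≤ x) : quotKernel t θ δ x = 0 := by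
  have h1 : ¬ 0 < t - x := by linarith
  have h2 : ¬ 0 < -x := by linarith
  simp [quotKernel, fieldKernel, posPartPow, h1, h2]

/-- For `x` in the window, `a ≤ t` makes `x` positive, so the quotient is `u ^ (θ - 1/2) * ((u ^ δ -
1) / δ)` with `u = t - x`. Since `log u ≤ -1` and `δ < 0`, `u ^ δ ≥ 1 + δ * log u ≥ 1 - δ`, so the
second factor has modulus at least `1`, uniformly in `δ`. -/
theorem le_abs_quotKernel {t θ δ x a : ℝ} (hδ : δ < 0) (hat : a ≤ t) (ha : a ≤ Real.exp (-1))
    (hx : x ∈ Ioo (t - a) t) : (t - x) ^ (θ - 1 / 2) ≤ |quotKernel t θ δ x| := by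
  have hu : 0 < t - x := sub_pos.2 hx.2
  have h2 : ¬ 0 < -x := by linarith [hx.1]
  have h1 : quotKernel t θ δ x = (t - x) ^ (θ - 1 / 2) * (((t - x) ^ δ - 1) / δ) := by
    simp only [quotKernel, Pi.smul_apply, Pi.sub_apply, fieldKernel, posPartPow, if_pos hu,
      if_neg h2, smul_eq_mul, sub_zero]
    rw [show θ + δ - 1 / 2 = (θ - 1 / 2) + δ by ring, Real.rpow_add hu]
    ring
  have hlog : Real.log (t - x) ≤ -1 := by
    rw [Real.log_le_iff_le_exp hu]
    linarith [hx.1]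
  have h3 : δ * Real.log (t - x) + 1 ≤ (t - x) ^ δ := by
    rw [Real.rpow_def_of_pos hu, mul_comm]
    exact Real.add_one_le_exp _
  have h4 : 1 ≤ |((t - x) ^ δ - 1) / δ| := by
    rw [abs_div, abs_of_neg hδ, one_le_div (by linarith)]
    refine le_trans ?_ (le_abs_self _)
    nlinarith
  rw [h1, abs_mul, abs_of_pos (Real.rpow_pos_of_pos hu _)]
  exact le_mul_of_one_le_right (Real.rpow_nonneg hu.le _) h4

theorem le_norm_toLp_quotKernel {t θ δ a : ℝ} (hθ : θ ∈ Ioo (0 : ℝ) 1)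
    (hδ' : θ + δ ∈ Ioo (0 : ℝ) 1) (hδ : δ < 0) (ha0 : 0 < a) (hat : a ≤ t)
    (ha : a ≤ Real.exp (-1)) : a ^ θ / 2 ≤ ‖(memLp_quotKernel hθ hδ' t).toLp‖ := by
  refine (le_norm_toLp_indicator (memLp_quotKernel hθ hδ' t) ha0 hθ
    fun x hx => le_abs_quotKernel hδ hat ha hx).trans ?_
  rw [Lp.norm_toLp, Lp.norm_toLp]
  exact ENNReal.toReal_mono (memLp_quotKernel hθ hδ' t).2.ne (eLpNorm_indicator_le _)

end QuotientKernel

/-! ### Passing Gaussian bounds to limits. -/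

section Probability

variable {Ω : Type*} [MeasurableSpace Ω] {P : Measure Ω}

/-- Fatou's lemma for events; it transfers uniform bounds for the difference quotients to the
derivative in `θ`. -/
theorem measure_le_of_eventually_mem {A : Set Ω} {s : ℕ → Set Ω} {c : ℝ≥0∞}
    (h : ∀ᵐ ω ∂P, ω ∈ A → ∀ᶠ n in atTop, ω ∈ s n) (hs : ∀ n, P (s n) ≤ c) : P A ≤ c := by
  have hm : Monotone fun n => ⋂ i ≥ n, s i := fun a b hab =>
    biInter_subset_biInter_left fun i (hi : i ≥ b) => hab.trans hi
  calc P A ≤ P (⋃ n, ⋂ i ≥ n, s i) := by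
        refine measure_mono_ae ?_
        filter_upwards [h] with ω hω hA
        obtain ⟨n, hn⟩ := eventually_atTop.1 (hω hA)
        exact mem_iUnion.2 ⟨n, mem_iInter₂.2 fun i hi => hn i hi⟩
    _ = ⨆ n, P (⋂ i ≥ n, s i) := hm.measure_iUnion
    _ ≤ c := iSup_le fun n =>
        (measure_mono (biInter_subset_of_mem (show n ≥ n from le_rfl))).trans (hs n)

theorem le_gaussianReal_interval {σ₀ σ₁ : ℝ} (h0 : 0 < σ₀) {σ : ℝ≥0} (h1 : σ₀ ≤ σ) (h2 : σ ≤ σ₁)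
    {r : ℝ} (hr : r ≤ 1) :
    ENNReal.ofReal (2 * (√(2 * Real.pi * σ₁ ^ 2))⁻¹ * Real.exp (-1 / (2 * σ₀ ^ 2)) * r) ≤
      gaussianReal 0 (σ ^ 2) {x | |x| ≤ r} := by
  have hσ : (0 : ℝ) < σ := h0.trans_le h1
  have hv : σ ^ 2 ≠ 0 := pow_ne_zero 2 (by exact_mod_cast hσ.ne')
  rw [gaussianReal_apply 0 hv]
  have hset : {x : ℝ | |x| ≤ r} = Icc (-r) r := by ext x; simp [abs_le]
  have hb : ∀ x ∈ Icc (-r) r, ENNReal.ofReal ((√(2 * Real.pi * σ₁ ^ 2))⁻¹ *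
      Real.exp (-1 / (2 * σ₀ ^ 2))) ≤ gaussianPDF 0 (σ ^ 2) x := by
    intro x hx
    rw [gaussianPDF]
    refine ENNReal.ofReal_le_ofReal ?_
    rw [gaussianPDFReal]
    have hx2 : x ^ 2 ≤ 1 := by
      have := abs_le.2 hx
      rw [← sq_abs]
      exact pow_le_one₀ (abs_nonneg x) (this.trans hr)
    push_cast
    gcongr ?_ * Real.exp ?_
    · gcongr
    · rw [sub_zero, neg_div, neg_div, neg_le_neg_iff]
      gcongr
  calc _ = ENNReal.ofReal ((√(2 * Real.pi * σ₁ ^ 2))⁻¹ * Real.exp (-1 / (2 * σ₀ ^ 2))) *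
        volume (Icc (-r) r) := by
        rw [Real.volume_Icc, ← ENNReal.ofReal_mul (by positivity)]
        congr 1; ring
    _ = ∫⁻ x in Icc (-r) r, ENNReal.ofReal ((√(2 * Real.pi * σ₁ ^ 2))⁻¹ *
          Real.exp (-1 / (2 * σ₀ ^ 2))) := (setLIntegral_const _ _).symm
    _ ≤ _ := by rw [hset]; exact setLIntegral_mono' measurableSet_Icc hb

variable {E : Type*} [NormedAddCommGroup E] [InnerProductSpace ℝ E] {I : E →L[ℝ] Lp ℝ 2 P}

theorem IsIsonormal.measure_preimage (hI : IsIsonormal I) (f : E) {s : Set ℝ}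
    (hs : MeasurableSet s) : P {ω | I f ω ∈ s} = gaussianReal 0 (‖f‖₊ ^ 2) s := by
  rw [← hI f, Measure.map_apply (Lp.stronglyMeasurable (I f)).measurable hs]
  rfl

/-- A Gaussian variable which is bounded by `q` on a set of probability larger than `1 / 2` has a
standard deviation at most `2 q`. -/
theorem IsIsonormal.norm_le_of_half_lt (hI : IsIsonormal I) {f : E} {q : ℝ} (hq : 0 ≤ q)
    (h : 1 / 2 < P {ω | |I f ω| < q}) : ‖f‖ ≤ 2 * q := by
  rcases eq_or_ne f 0 with rfl | hf
  · rw [norm_zero]; positivity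
  have hσ : 0 < ‖f‖₊ := nnnorm_pos.2 hf
  have hm : MeasurableSet {x : ℝ | |x| < q} := measurableSet_lt (by fun_prop) measurable_const
  have h1 : P {ω | |I f ω| < q} = gaussianReal 0 (‖f‖₊ ^ 2) {x | |x| < q} :=
    hI.measure_preimage f hm
  have h2 := gaussianReal_interval_le hσ 0 q
  simp only [add_zero] at h2
  rw [h1] at h
  have h3 := h.trans_le h2
  have h4 : (1 / 2 : ℝ≥0∞) = ENNReal.ofReal (1 / 2) := by
    rw [ENNReal.ofReal_div_of_pos two_pos]; simp
  rw [h4, ENNReal.ofReal_lt_ofReal_iff_of_nonneg (by norm_num), coe_nnnorm,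
    lt_div_iff₀ (norm_pos_iff.2 hf)] at h3
  linarith

end Probability


/-! ### One-point and two-point estimates for the derivative along `H`. -/

section ThetaDerivative

variable {Ω : Type*} [MeasurableSpace Ω] {P : Measure Ω}
  {I : Lp ℝ 2 (volume : Measure ℝ) →L[ℝ] Lp ℝ 2 P} {W : ℝ → Ω → ℝ} {B : ℝ → ℝ → Ω → ℝ}
  {E : Set Ω} {H : ℝ → ℝ}

/-- Negative steps which tend to `0` and keep `θ + thetaStep θ n` in `[θ / 2, θ)`. -/
noncomputable def thetaStep (θ : ℝ) (n : ℕ) : ℝ := -θ / (n + 2)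

theorem thetaStep_neg {θ : ℝ} (hθ : 0 < θ) (n : ℕ) : thetaStep θ n < 0 := by
  unfold thetaStep
  exact div_neg_of_neg_of_pos (by linarith) (by positivity)

theorem half_le_add_thetaStep {θ : ℝ} (hθ : 0 < θ) (n : ℕ) : θ / 2 ≤ θ + thetaStep θ n := by
  have : θ / (n + 2) ≤ θ / 2 :=
    div_le_div_of_nonneg_left hθ.le two_pos (by linarith [(Nat.cast_nonneg n : (0 : ℝ) ≤ n)])
  unfold thetaStep
  rw [neg_div]
  linarith

theorem add_thetaStep_mem {θ : ℝ} (hθ : θ ∈ Ioo (0 : ℝ) 1) (n : ℕ) :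
    θ + thetaStep θ n ∈ Ioo (0 : ℝ) 1 :=
  ⟨by linarith [half_le_add_thetaStep hθ.1 n, hθ.1], by linarith [thetaStep_neg hθ.1 n, hθ.2]⟩

theorem tendsto_thetaStep {θ : ℝ} (hθ : 0 < θ) : Tendsto (thetaStep θ) atTop (𝓝[≠] 0) := by
  refine tendsto_nhdsWithin_iff.2 ⟨?_, Eventually.of_forall fun n => (thetaStep_neg hθ n).ne⟩
  exact Tendsto.div_atTop tendsto_const_nhds
    (tendsto_atTop_add_const_right _ _ tendsto_natCast_atTop_atTop)

theorem IsRegularRealization.tendsto_quotient {b : ℝ → ℝ → ℝ} (hb : IsRegularRealization b)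
    (s : ℝ) {θ : ℝ} (hθ : θ ∈ Ioo (0 : ℝ) 1) :
    Tendsto (fun n => (thetaStep θ n)⁻¹ * (b s (θ + thetaStep θ n) - b s θ)) atTop
      (𝓝 (partialTheta 1 b s θ)) :=
  (hb.hasDerivAt s hθ).tendsto_slope_zero.comp (tendsto_thetaStep hθ.1)

theorem IsRegularRealization.continuousOn_partialTheta {b : ℝ → ℝ → ℝ}
    (hb : IsRegularRealization b) (n : ℕ) :
    ContinuousOn (fun p : ℝ × ℝ => partialTheta n b p.1 p.2) (univ ×ˢ Ioo (0 : ℝ) 1) :=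
  continuousOn_of_holder (hb.holder n)

theorem IsRegularModification.continuous_thetaDerivAlong (hreg : IsRegularModification P W B E)
    (hH : Continuous H) (hH1 : ∀ t, H t ∈ Ioo (0 : ℝ) 1) {ω : Ω} (hω : ω ∈ E) :
    Continuous (thetaDerivAlong B H ω) :=
  ((hreg.regular ω hω).continuousOn_partialTheta 1).comp_continuous
    (continuous_id.prodMk hH) fun t => ⟨mem_univ _, hH1 t⟩

theorem toLp_quotKernel_ae_eq
    (hB : ∀ (t θ : ℝ) (hθ : θ ∈ Ioo (0 : ℝ) 1), B t θ =ᵐ[P] I (memLp_fieldKernel hθ t).toLp)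
    {θ δ : ℝ} (hθ : θ ∈ Ioo (0 : ℝ) 1) (hδ : θ + δ ∈ Ioo (0 : ℝ) 1) (t : ℝ) :
    ∀ᵐ ω ∂P, I (memLp_quotKernel hθ hδ t).toLp ω = δ⁻¹ * (B t (θ + δ) ω - B t θ ω) := by
  have h1 : (memLp_quotKernel hθ hδ t).toLp =
      δ⁻¹ • ((memLp_fieldKernel hδ t).toLp - (memLp_fieldKernel hθ t).toLp) := by
    rw [← MemLp.toLp_sub, ← MemLp.toLp_const_smul]; rfl
  rw [h1, map_smul, map_sub]
  filter_upwards [Lp.coeFn_smul δ⁻¹ (I (memLp_fieldKernel hδ t).toLp -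
    I (memLp_fieldKernel hθ t).toLp), Lp.coeFn_sub (I (memLp_fieldKernel hδ t).toLp)
    (I (memLp_fieldKernel hθ t).toLp), hB t _ hδ, hB t _ hθ] with ω h2 h3 h4 h5
  rw [h2, Pi.smul_apply, h3, Pi.sub_apply, smul_eq_mul, h4, h5]

variable [IsProbabilityMeasure P]

theorem IsRegularModification.ae_mem (hreg : IsRegularModification P W B E) :
    ∀ᵐ ω ∂P, ω ∈ E := by
  rw [ae_iff]
  exact (prob_compl_eq_zero_iff hreg.measurableSet).2 hreg.measure_eq_one

theorem IsRegularModification.ae_tendsto_toLp_quotKernel (hreg : IsRegularModification P W B E)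
    (hB : ∀ (t θ : ℝ) (hθ : θ ∈ Ioo (0 : ℝ) 1), B t θ =ᵐ[P] I (memLp_fieldKernel hθ t).toLp)
    (hH1 : ∀ t, H t ∈ Ioo (0 : ℝ) 1) (s : ℝ) :
    ∀ᵐ ω ∂P, Tendsto (fun n =>
      I (memLp_quotKernel (hH1 s) (add_thetaStep_mem (hH1 s) n) s).toLp ω) atTop
      (𝓝 (thetaDerivAlong B H ω s)) := by
  have h1 : ∀ᵐ ω ∂P, ∀ n, I (memLp_quotKernel (hH1 s) (add_thetaStep_mem (hH1 s) n) s).toLp ω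
      = (thetaStep (H s) n)⁻¹ * (B s (H s + thetaStep (H s) n) ω - B s (H s) ω) :=
    ae_all_iff.2 fun n => toLp_quotKernel_ae_eq hB (hH1 s) (add_thetaStep_mem (hH1 s) n) s
  filter_upwards [h1, hreg.ae_mem] with ω h2 h3
  simp only [h2]
  exact (hreg.regular ω h3).tendsto_quotient s (hH1 s)

/-- Small ball estimate for the derivative of the field at finitely many points. -/
theorem IsRegularModification.measure_thetaDerivAlong_lt_le
    (hreg : IsRegularModification P W B E) (hI : IsIsonormal I)
    (hB : ∀ (t θ : ℝ) (hθ : θ ∈ Ioo (0 : ℝ) 1), B t θ =ᵐ[P] I (memLp_fieldKernel hθ t).toLp)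
    (hH1 : ∀ t, H t ∈ Ioo (0 : ℝ) 1) {T a : ℕ → ℝ} (r : ℝ) (L : ℕ)
    (ha0 : ∀ l < L, 0 < a l) (haT : ∀ l < L, a l ≤ T l) (ha : ∀ l < L, a l ≤ Real.exp (-1))
    (hT : ∀ l < L, ∀ i < l, T i ≤ T l - a l) :
    P {ω | ∀ l < L, |thetaDerivAlong B H ω (T l)| < r} ≤
      ∏ l ∈ Finset.range L, ENNReal.ofReal (r / (a l ^ H (T l) / 2)) := by
  refine measure_le_of_eventually_mem (s := fun n => {ω | ∀ l < L,
    |I (memLp_quotKernel (hH1 (T l)) (add_thetaStep_mem (hH1 (T l)) n) (T l)).toLp ω| < r})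
    ?_ fun n => ?_
  · have h1 : ∀ᵐ ω ∂P, ∀ l, Tendsto (fun n =>
        I (memLp_quotKernel (hH1 (T l)) (add_thetaStep_mem (hH1 (T l)) n) (T l)).toLp ω) atTop
        (𝓝 (thetaDerivAlong B H ω (T l))) :=
      ae_all_iff.2 fun l => hreg.ae_tendsto_toLp_quotKernel hB hH1 (T l)
    filter_upwards [h1] with ω h2 h3
    have h4 : ∀ l ∈ Finset.range L, ∀ᶠ n in atTop, |I (memLp_quotKernel (hH1 (T l))
        (add_thetaStep_mem (hH1 (T l)) n) (T l)).toLp ω| < r := fun l hl =>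
      (h2 l).abs.eventually_lt_const (h3 l (Finset.mem_range.1 hl))
    filter_upwards [(Finset.range L).eventually_all.2 h4] with n hn l hl
    exact hn l (Finset.mem_range.2 hl)
  · exact hI.measure_small_ball_kernel_le
      (fun l => memLp_quotKernel (hH1 (T l)) (add_thetaStep_mem (hH1 (T l)) n) (T l)) r L ha0
      (fun l _ => hH1 (T l)) hT
      (fun l hl x hx => quotKernel_eq_zero ((ha0 l hl).le.trans (haT l hl)) hx)
      fun l hl x hx => le_abs_quotKernel (thetaStep_neg (hH1 (T l)).1 n) (haT l hl) (ha l hl) hx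

/-- The small ball estimate at the single point `s`, with radius tending to `0`. -/
theorem IsRegularModification.measure_thetaDerivAlong_eq_zero
    (hreg : IsRegularModification P W B E) (hI : IsIsonormal I)
    (hB : ∀ (t θ : ℝ) (hθ : θ ∈ Ioo (0 : ℝ) 1), B t θ =ᵐ[P] I (memLp_fieldKernel hθ t).toLp)
    (hH1 : ∀ t, H t ∈ Ioo (0 : ℝ) 1) {s : ℝ} (hs : 0 < s) :
    ∀ᵐ ω ∂P, thetaDerivAlong B H ω s ≠ 0 := by
  rw [ae_iff]
  set a := min s (Real.exp (-1)) with ha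
  have ha0 : 0 < a := lt_min hs (Real.exp_pos _)
  have hlim : Tendsto (fun n : ℕ => ENNReal.ofReal (1 / (n + 1 : ℝ) / (a ^ H s / 2))) atTop
      (𝓝 0) := by
    have := ENNReal.tendsto_ofReal ((tendsto_one_div_add_atTop_nhds_zero_nat (𝕜 := ℝ)).div_const
      (a ^ H s / 2))
    simpa using this
  refine le_antisymm (ge_of_tendsto' hlim fun n => ?_) zero_le
  have h1 := hreg.measure_thetaDerivAlong_lt_le hI hB hH1 (T := fun _ => s) (a := fun _ => a)
    (1 / (n + 1)) 1 (fun _ _ => ha0) (fun _ _ => min_le_left _ _) (fun _ _ => min_le_right _ _)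
    (by omega)
  rw [Finset.prod_range_one] at h1
  refine (measure_mono fun ω hω l _ => ?_).trans h1
  have : thetaDerivAlong B H ω s = 0 := not_not.1 hω
  rw [this, abs_zero]
  positivity

/-- The window at `t` reaches back exactly to `s`, so the fresh noise has deviation of order `(t -
s) ^ H t ≥ (t - s) ^ h`; at `s` a window of fixed length suffices. The interval is short enough for
both windows to be admissible. -/
theorem IsRegularModification.measure_pair_lt_le
    (hreg : IsRegularModification P W B E) (hI : IsIsonormal I)
    (hB : ∀ (t θ : ℝ) (hθ : θ ∈ Ioo (0 : ℝ) 1), B t θ =ᵐ[P] I (memLp_fieldKernel hθ t).toLp)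
    (hH1 : ∀ t, H t ∈ Ioo (0 : ℝ) 1) {α β h : ℝ} (hα : 0 < α) (hαβ : β - α ≤ Real.exp (-1))
    (hHh : ∀ s ∈ Icc α β, H s ≤ h) :
    ∃ C > 0, ∀ s ∈ Icc α β, ∀ t ∈ Icc α β, s < t → ∀ N : ℕ, 0 < N →
      P {ω | |thetaDerivAlong B H ω s| < 1 / N ∧ |thetaDerivAlong B H ω t| < 1 / N} ≤
        ENNReal.ofReal (C / N ^ 2) * (edist s t ^ h)⁻¹ := by
  set a := min α (Real.exp (-1)) with ha
  have ha0 : 0 < a := lt_min hα (Real.exp_pos _)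
  have he1 : Real.exp (-1) ≤ 1 := Real.exp_le_one_iff.2 (by norm_num)
  have ha1 : a ≤ 1 := (min_le_right _ _).trans he1
  refine ⟨4 / a, by positivity, fun s hs t ht hst N hN => ?_⟩
  have hN' : (0 : ℝ) < N := by exact_mod_cast hN
  have hd : 0 < t - s := sub_pos.2 hst
  have hd1 : t - s ≤ Real.exp (-1) := by linarith [hs.1, ht.2]
  have h1 := hreg.measure_thetaDerivAlong_lt_le hI hB hH1
    (T := fun l => if l = 0 then s else t) (a := fun l => if l = 0 then a else t - s)
    (1 / N) 2 (fun l _ => by split_ifs <;> assumption) (fun l _ => ?_) (fun l _ => ?_)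
    fun l hl i hi => ?_
  · rw [Finset.prod_range_succ, Finset.prod_range_one] at h1
    simp only [if_true, one_ne_zero, if_false] at h1
    have h2 : {ω | |thetaDerivAlong B H ω s| < 1 / N ∧ |thetaDerivAlong B H ω t| < 1 / N} ⊆
        {ω | ∀ l < 2, |thetaDerivAlong B H ω (if l = 0 then s else t)| < 1 / N} := by
      intro ω hω l _
      split_ifs
      exacts [hω.1, hω.2]
    refine (measure_mono h2).trans (h1.trans ?_)
    have h3 : edist s t ^ h = ENNReal.ofReal ((t - s) ^ h) := by
      rw [edist_comm, edist_dist, Real.dist_eq, abs_of_pos hd, ENNReal.ofReal_rpow_of_pos hd]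
    rw [h3, ← ENNReal.ofReal_inv_of_pos (by positivity), ← ENNReal.ofReal_mul (by positivity),
      ← ENNReal.ofReal_mul (by positivity)]
    refine ENNReal.ofReal_le_ofReal ?_
    have h4 : a ≤ a ^ H s := by
      calc a = a ^ (1 : ℝ) := (Real.rpow_one a).symm
        _ ≤ a ^ H s := Real.rpow_le_rpow_of_exponent_ge ha0 ha1 (hH1 s).2.le
    have h5 : (t - s) ^ h ≤ (t - s) ^ H t :=
      Real.rpow_le_rpow_of_exponent_ge hd (hd1.trans he1) (hHh t ht)
    calc 1 / N / (a ^ H s / 2) * (1 / N / ((t - s) ^ H t / 2))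
        ≤ 1 / N / (a / 2) * (1 / N / ((t - s) ^ h / 2)) := by gcongr
      _ = 4 / a / N ^ 2 * ((t - s) ^ h)⁻¹ := by field_simp; ring
  · split_ifs
    · exact (min_le_left _ _).trans hs.1
    · linarith [hs.1]
  · split_ifs
    · exact min_le_right _ _
    · exact hd1
  · obtain rfl : l = 1 := by omega
    obtain rfl : i = 0 := by omega
    simp

end ThetaDerivative


/-! ### Dimension of the zero set of the derivative along `H`. -/

section ZeroSet

variable {Ω : Type*} [MeasurableSpace Ω] {P : Measure Ω}
  {I : Lp ℝ 2 (volume : Measure ℝ) →L[ℝ] Lp ℝ 2 P} {W : ℝ → Ω → ℝ} {B : ℝ → ℝ → Ω → ℝ}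
  {E : Set Ω} {H : ℝ → ℝ}

theorem IsRegularModification.dimH_ne_zero (hreg : IsRegularModification P W B E)
    (hH : Continuous H) (hH1 : ∀ t, H t ∈ Ioo (0 : ℝ) 1) {J : Set ℝ} (hJo : IsOpen J) {s : ℝ}
    (hs : s ∈ J) {ω : Ω} (hω : ω ∈ E) (hne : thetaDerivAlong B H ω s ≠ 0) :
    dimH {s ∈ J | thetaDerivAlong B H ω s ≠ 0} = 1 := by
  have h1 : {s ∈ J | thetaDerivAlong B H ω s ≠ 0} ∈ 𝓝 s :=
    (hJo.inter (isOpen_ne_fun (hreg.continuous_thetaDerivAlong hH hH1 hω)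
      continuous_const)).mem_nhds ⟨hs, hne⟩
  rw [Real.dimH_of_mem_nhds h1]
  simp

theorem IsRegularRealization.exists_quotient_bound {b : ℝ → ℝ → ℝ} (hb : IsRegularRealization b)
    (hH : Continuous H) (hH1 : ∀ t, H t ∈ Ioo (0 : ℝ) 1) (α β : ℝ) :
    ∃ q : ℕ, ∀ s ∈ Icc α β, ∀ n,
      |(thetaStep (H s) n)⁻¹ * (b s (H s + thetaStep (H s) n) - b s (H s))| ≤ q := by
  rcases (Icc α β).eq_empty_or_nonempty with he | hne
  · exact ⟨0, fun s hs => by simp [he] at hs⟩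
  obtain ⟨s₀, hs₀, hmin⟩ := isCompact_Icc.exists_isMinOn hne hH.continuousOn
  obtain ⟨s₁, hs₁, hmax⟩ := isCompact_Icc.exists_isMaxOn hne hH.continuousOn
  have hsub : Icc (H s₀ / 2) (H s₁) ⊆ Ioo 0 1 := fun θ hθ =>
    ⟨by linarith [hθ.1, (hH1 s₀).1], by linarith [hθ.2, (hH1 s₁).2]⟩
  obtain ⟨C, hC⟩ := (isCompact_Icc.prod isCompact_Icc).exists_bound_of_continuousOn
    ((hb.continuousOn_partialTheta 1).mono (prod_mono (subset_univ (Icc α β)) hsub))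
  obtain ⟨q, hq⟩ := exists_nat_ge C
  refine ⟨q, fun s hs n => ?_⟩
  have hmins : H s₀ ≤ H s := hmin hs
  have hmaxs : H s ≤ H s₁ := hmax hs
  have hneg := thetaStep_neg (hH1 s).1 n
  have hhalf := half_le_add_thetaStep (hH1 s).1 n
  have hp := (hH1 s).1
  have hmv := (convex_Icc (H s₀ / 2) (H s₁)).norm_image_sub_le_of_norm_hasDerivWithin_le
    (f := b s) (f' := fun θ => partialTheta 1 b s θ) (C := C) (x := H s)
    (y := H s + thetaStep (H s) n)
    (fun θ hθ => (hb.hasDerivAt s (hsub hθ)).hasDerivWithinAt)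
    (fun θ hθ => hC (s, θ) ⟨hs, hθ⟩) ⟨by linarith, hmaxs⟩ ⟨by linarith, by linarith⟩
  rw [add_sub_cancel_left, Real.norm_eq_abs, Real.norm_eq_abs] at hmv
  rw [abs_mul, abs_inv, inv_mul_le_iff₀ (abs_pos.2 hneg.ne)]
  refine hmv.trans ?_
  rw [mul_comm]
  gcongr

/-- A random function with continuous paths has a jointly measurable version with the same paths on
an event of probability one. -/
theorem exists_jointly_measurable {Y : ℝ → Ω → ℝ} (hPE : ∀ᵐ ω ∂P, ω ∈ E)
    (hcont : ∀ ω ∈ E, Continuous fun s => Y s ω) (hY : ∀ s, AEMeasurable (Y s) P) :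
    ∃ (E' : Set Ω) (Y' : ℝ → Ω → ℝ), E' ⊆ E ∧ MeasurableSet E' ∧ (∀ᵐ ω ∂P, ω ∈ E') ∧
      (Measurable fun p : Ω × ℝ => Y' p.2 p.1) ∧ ∀ ω ∈ E', ∀ s, Y' s ω = Y s ω := by
  have h1 : ∀ᵐ ω ∂P, ω ∈ E ∧ ∀ q : ℚ, Y q ω = (hY q).mk (Y q) ω :=
    hPE.and (ae_all_iff.2 fun q => (hY q).ae_eq_mk)
  obtain ⟨E', hE'1, hE'2, hE'3⟩ := h1.exists_measurable_mem
  -- Multiplying by the indicator makes every path continuous, also outside `E'`, so measurability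
  -- at rational times passes to joint measurability.
  set Y' : ℝ → Ω → ℝ := fun s => E'.indicator (Y s) with hY'
  have hc : ∀ ω, Continuous fun s => Y' s ω := by
    intro ω
    by_cases hω : ω ∈ E'
    · simp only [hY', indicator_of_mem hω]; exact hcont ω (hE'3 ω hω).1
    · simp only [hY', indicator_of_notMem hω]; exact continuous_const
  have hq : ∀ q : ℚ, Measurable (Y' q) := by
    intro q
    have : Y' q = E'.indicator ((hY q).mk (Y q)) :=
      indicator_congr fun ω hω => (hE'3 ω hω).2 q
    rw [this]
    exact (hY q).measurable_mk.indicator hE'2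
  have hm : ∀ s, Measurable (Y' s) := by
    intro s
    obtain ⟨u, hu⟩ := mem_closure_iff_seq_limit.1 (Rat.denseRange_cast (𝕜 := ℝ) s)
    choose v hv using hu.1
    refine measurable_of_tendsto_metrizable (f := fun n => Y' (u n)) (fun n => ?_) ?_
    · rw [← hv n]; exact hq (v n)
    · rw [tendsto_pi_nhds]
      intro ω
      exact ((hc ω).tendsto s).comp hu.2
  refine ⟨E', Y', fun ω hω => (hE'3 ω hω).1, hE'2, hE'1, ?_, fun ω hω s => indicator_of_mem hω _⟩
  exact (measurable_uncurry_of_continuous_of_measurable hc hm).comp measurable_swap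

/-- The uniform variance bound is deduced from the paths: on `E` the quotients are bounded over all
`s` and `n`, so for some `q` they are all at most `q` with probability above `1/2`, which no
Gaussian of large variance allows. -/
theorem IsRegularModification.exists_norm_quotKernel_le (hreg : IsRegularModification P W B E)
    (hI : IsIsonormal I)
    (hB : ∀ (t θ : ℝ) (hθ : θ ∈ Ioo (0 : ℝ) 1), B t θ =ᵐ[P] I (memLp_fieldKernel hθ t).toLp)
    (hH : Continuous H) (hH1 : ∀ t, H t ∈ Ioo (0 : ℝ) 1) (α β : ℝ) :
    ∃ σ > 0, ∀ s ∈ Icc α β, ∀ n,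
      ‖(memLp_quotKernel (hH1 s) (add_thetaStep_mem (hH1 s) n) s).toLp‖ ≤ σ := by
  set G : ℕ → Set Ω := fun q => {ω | ∀ s ∈ Icc α β, ∀ n,
    |(thetaStep (H s) n)⁻¹ * (B s (H s + thetaStep (H s) n) ω - B s (H s) ω)| ≤ q} with hG
  have hmono : Monotone G := fun q q' hq ω hω s hs n =>
    (hω s hs n).trans (by exact_mod_cast hq)
  have hE : E ⊆ ⋃ q, G q := fun ω hω => by
    obtain ⟨q, hq⟩ := (hreg.regular ω hω).exists_quotient_bound hH hH1 α β
    exact mem_iUnion.2 ⟨q, hq⟩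
  have hsup : (1 / 2 : ℝ≥0∞) < ⨆ q, P (G q) := by
    rw [← hmono.measure_iUnion]
    refine lt_of_lt_of_le ?_ (measure_mono hE)
    rw [hreg.measure_eq_one, one_div]
    exact ENNReal.one_half_lt_one
  obtain ⟨q, hq⟩ := lt_iSup_iff.1 hsup
  refine ⟨2 * (q + 1), by positivity, fun s hs n => hI.norm_le_of_half_lt (by positivity)
    (hq.trans_le (measure_mono_ae ?_))⟩
  filter_upwards [toLp_quotKernel_ae_eq hB (hH1 s) (add_thetaStep_mem (hH1 s) n) s] with ω h1 h2
  change |_| < _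
  rw [h1]
  exact (h2 s hs n).trans_lt (by linarith)

variable [IsProbabilityMeasure P]

/-- The difference quotients have deviations bounded above and away from `0`, so their densities
near `0` are bounded below; the bound passes to the derivative through complements. -/
theorem IsRegularModification.exists_measure_thetaDerivAlong_ge
    (hreg : IsRegularModification P W B E) (hI : IsIsonormal I)
    (hB : ∀ (t θ : ℝ) (hθ : θ ∈ Ioo (0 : ℝ) 1), B t θ =ᵐ[P] I (memLp_fieldKernel hθ t).toLp)
    (hH : Continuous H) (hH1 : ∀ t, H t ∈ Ioo (0 : ℝ) 1) {α : ℝ} (hα : 0 < α) (β : ℝ) :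
    ∃ c > 0, ∀ s ∈ Icc α β, ∀ N : ℕ, 0 < N →
      ENNReal.ofReal (c / N) ≤ P {ω | |thetaDerivAlong B H ω s| < 1 / N} := by
  obtain ⟨σ₁, hσ₁, hle⟩ := hreg.exists_norm_quotKernel_le hI hB hH hH1 α β
  set a := min α (Real.exp (-1)) with ha
  have ha0 : 0 < a := lt_min hα (Real.exp_pos _)
  have ha1 : a ≤ 1 := (min_le_right _ _).trans (Real.exp_le_one_iff.2 (by norm_num))
  set c := 2 * (√(2 * Real.pi * σ₁ ^ 2))⁻¹ * Real.exp (-1 / (2 * (a / 2) ^ 2)) with hc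
  have hc0 : 0 < c := by positivity
  refine ⟨c / 2, by positivity, fun s hs N hN => ?_⟩
  have hN' : (1 : ℝ) ≤ N := by exact_mod_cast hN
  -- A radius strictly below `1 / N`: if the limit is at least `1 / N` in modulus, the quotients
  -- eventually exceed `r`.
  set r : ℝ := 1 / (2 * N) with hr
  have hr1 : r ≤ 1 := by rw [hr, div_le_one (by positivity)]; linarith
  have hrN : r < 1 / N := by
    rw [hr]; exact one_div_lt_one_div_of_lt (by linarith) (by linarith)
  set p := ENNReal.ofReal (c * r) with hp
  have hpr : ENNReal.ofReal (c / 2 / N) = p := by rw [hp, hr]; congr 1; field_simp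
  rw [hpr]
  set f : ℕ → Lp ℝ 2 (volume : Measure ℝ) := fun n =>
    (memLp_quotKernel (hH1 s) (add_thetaStep_mem (hH1 s) n) s).toLp with hf
  have h1 : ∀ n, p ≤ P {ω | |I (f n) ω| ≤ r} := by
    intro n
    have hm : MeasurableSet {x : ℝ | |x| ≤ r} := measurableSet_le (by fun_prop) measurable_const
    have h2 : P {ω | |I (f n) ω| ≤ r} = gaussianReal 0 (‖f n‖₊ ^ 2) {x | |x| ≤ r} :=
      hI.measure_preimage (f n) hm
    rw [h2]
    refine le_gaussianReal_interval (by positivity) ?_ (hle s hs n) hr1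
    refine le_trans ?_ (le_norm_toLp_quotKernel (hH1 s) (add_thetaStep_mem (hH1 s) n)
      (thetaStep_neg (hH1 s).1 n) ha0 ((min_le_left _ _).trans hs.1) (min_le_right _ _))
    gcongr
    calc a = a ^ (1 : ℝ) := (Real.rpow_one a).symm
      _ ≤ a ^ H s := Real.rpow_le_rpow_of_exponent_ge ha0 ha1 (hH1 s).2.le
  have h2 : P {ω | |thetaDerivAlong B H ω s| < 1 / N}ᶜ ≤ 1 - p := by
    refine measure_le_of_eventually_mem (s := fun n => {ω | |I (f n) ω| ≤ r}ᶜ) ?_ fun n => ?_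
    · filter_upwards [hreg.ae_tendsto_toLp_quotKernel hB hH1 s] with ω h3 h4
      have h5 : r < |thetaDerivAlong B H ω s| := hrN.trans_le (not_lt.1 h4)
      filter_upwards [h3.abs.eventually_const_lt h5] with n hn
      exact not_le.2 hn
    · have hm : MeasurableSet {ω | |I (f n) ω| ≤ r} :=
        measurableSet_le (Lp.stronglyMeasurable (I (f n))).measurable.abs measurable_const
      rw [prob_compl_eq_one_sub hm]
      exact tsub_le_tsub_left (h1 n) 1
  have hp1 : p ≤ 1 := (h1 0).trans prob_le_one
  have h3 : p + (1 - p) ≤ P {ω | |thetaDerivAlong B H ω s| < 1 / N} + (1 - p) := by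
    rw [add_tsub_cancel_of_le hp1]
    calc (1 : ℝ≥0∞) = P ({ω | |thetaDerivAlong B H ω s| < 1 / N} ∪
          {ω | |thetaDerivAlong B H ω s| < 1 / N}ᶜ) := by rw [union_compl_self, measure_univ]
      _ ≤ _ := (measure_union_le _ _).trans (by gcongr)
  exact (ENNReal.add_le_add_iff_right (ENNReal.sub_ne_top ENNReal.one_ne_top)).1 h3

theorem IsRegularModification.aemeasurable_thetaDerivAlong
    (hreg : IsRegularModification P W B E)
    (hB : ∀ (t θ : ℝ) (hθ : θ ∈ Ioo (0 : ℝ) 1), B t θ =ᵐ[P] I (memLp_fieldKernel hθ t).toLp)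
    (hH1 : ∀ t, H t ∈ Ioo (0 : ℝ) 1) (s : ℝ) :
    AEMeasurable (fun ω => thetaDerivAlong B H ω s) P :=
  aemeasurable_of_tendsto_metrizable_ae' (fun n => (Lp.stronglyMeasurable (I
    (memLp_quotKernel (hH1 s) (add_thetaStep_mem (hH1 s) n) s).toLp)).measurable.aemeasurable)
    (hreg.ae_tendsto_toLp_quotKernel hB hH1 s)

theorem IsRegularModification.exists_event_le_dimH
    (hreg : IsRegularModification P W B E) (hI : IsIsonormal I)
    (hB : ∀ (t θ : ℝ) (hθ : θ ∈ Ioo (0 : ℝ) 1), B t θ =ᵐ[P] I (memLp_fieldKernel hθ t).toLp)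
    (hH : Continuous H) (hH1 : ∀ t, H t ∈ Ioo (0 : ℝ) 1) {J : Set ℝ} (hJo : IsOpen J)
    (hJne : J.Nonempty) (hJ0 : J ⊆ Ioi 0) {γ : ℝ} (hγ0 : 0 < γ) (hγ : γ + sInf (H '' J) < 1) :
    ∃ D ⊆ E, MeasurableSet D ∧ 0 < P D ∧
      ∀ ω ∈ D, ENNReal.ofReal γ ≤ dimH {s ∈ J | thetaDerivAlong B H ω s = 0} := by
  -- The midpoint between `sInf (H '' J)` and `1 - γ`: values of `H` below `h` exist in `J`, and
  -- still `h + γ < 1`.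
  set h := (sInf (H '' J) + (1 - γ)) / 2 with hh
  obtain ⟨_, ⟨s₁, hs₁, rfl⟩, hs₁h⟩ := exists_lt_of_csInf_lt (hJne.image H)
    (show sInf (H '' J) < h by rw [hh]; linarith)
  have hinf : 0 ≤ sInf (H '' J) := Real.sInf_nonneg (by rintro _ ⟨s, -, rfl⟩; exact (hH1 s).1.le)
  have hh0 : 0 < h := (hH1 s₁).1.trans hs₁h
  have hhγ : h + γ < 1 := by rw [hh]; linarith
  have hopen : IsOpen (J ∩ {s | H s < h}) := hJo.inter (isOpen_lt hH continuous_const)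
  obtain ⟨ρ, hρ, hball⟩ := Metric.isOpen_iff.1 hopen s₁ ⟨hs₁, hs₁h⟩
  -- The interval stays where `H < h`, and its length is at most `exp (-1)` as the two-point
  -- estimate requires.
  set β := s₁ + min (ρ / 2) (Real.exp (-1)) with hβ
  have hm0 : 0 < min (ρ / 2) (Real.exp (-1)) := lt_min (half_pos hρ) (Real.exp_pos _)
  have hm1 : min (ρ / 2) (Real.exp (-1)) ≤ Real.exp (-1) := min_le_right _ _
  have hm2 : min (ρ / 2) (Real.exp (-1)) ≤ ρ / 2 := min_le_left _ _
  have he1 : Real.exp (-1) ≤ 1 := Real.exp_le_one_iff.2 (by norm_num)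
  have hsub : Icc s₁ β ⊆ J ∩ {s | H s < h} := fun s hs => hball (by
    rw [Metric.mem_ball, Real.dist_eq, abs_of_nonneg (sub_nonneg.2 hs.1)]
    linarith [hs.2])
  obtain ⟨E', Y', hE'E, hE'm, hE'1, hYm, hYe⟩ := exists_jointly_measurable
    (Y := fun s ω => thetaDerivAlong B H ω s) hreg.ae_mem
    (fun ω hω => hreg.continuous_thetaDerivAlong hH hH1 hω)
    (hreg.aemeasurable_thetaDerivAlong hB hH1)
  obtain ⟨c, hc, hlow⟩ := hreg.exists_measure_thetaDerivAlong_ge hI hB hH hH1 (hJ0 hs₁) β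
  obtain ⟨C, hC, hup⟩ := hreg.measure_pair_lt_le hI hB hH1 (hJ0 hs₁)
    (show β - s₁ ≤ Real.exp (-1) by linarith) fun s hs => (hsub hs).2.le
  obtain ⟨a, T, ha, hT, D, hDm, hD0, hD⟩ := exists_frequently_energy (P := P) hYm
    (show s₁ < β by linarith) (by linarith) hc hC hh0 hγ0 hhγ
    (fun s hs N hN => (hlow s hs N hN).trans (measure_mono_ae (by
      filter_upwards [hE'1] with ω hω h1
      change |Y' s ω| < 1 / N
      rw [hYe ω hω]; exact h1)))
    fun s hs t ht hst N hN => le_trans (measure_mono_ae (by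
      filter_upwards [hE'1] with ω hω h1
      change |thetaDerivAlong B H ω s| < 1 / N ∧ |thetaDerivAlong B H ω t| < 1 / N
      rw [← hYe ω hω, ← hYe ω hω]; exact h1)) (hup s hs t ht hst N hN)
  refine ⟨D ∩ E', inter_subset_right.trans hE'E, hDm.inter hE'm, hD0.trans_le (measure_mono_ae ?_),
    fun ω hω => ?_⟩
  · filter_upwards [hE'1] with ω h1 h2 using ⟨h2, h1⟩
  · have h1 := hD ω hω.1
    simp only [hYe ω hω.2] at h1
    have h2 := hausdorffMeasure_ne_zero_of_energy hγ0 (by linarith) isCompact_Icc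
      (hreg.continuous_thetaDerivAlong hH hH1 (hE'E hω.2)) ha hT h1
    rw [← Real.coe_toNNReal γ hγ0.le] at h2
    exact (le_dimH_of_hausdorffMeasure_ne_zero h2).trans
      (dimH_mono fun s hs => ⟨(hsub hs.1).1, hs.2⟩)

end ZeroSet


/-! ### Assembly of the theorem. -/

theorem mainTheorem1 {Ω : Type*} [MeasurableSpace Ω] (P : Measure Ω) [IsProbabilityMeasure P]
    (W : ℝ → Ω → ℝ) (hW : IsTwoSidedBrownianMotion P W) :
    (∃ (B : ℝ → ℝ → Ω → ℝ) (Ωs : Set Ω), IsRegularModification P W B Ωs) ∧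
    ∀ (B : ℝ → ℝ → Ω → ℝ) (Ωs : Set Ω), IsRegularModification P W B Ωs →
    ∀ (H : ℝ → ℝ) (J : Set ℝ),
      Continuous H → (∀ t, H t ∈ Ioo (0 : ℝ) 1) →
      IsOpen J → J.OrdConnected → J.Nonempty → J ⊆ Ioi 0 →
      (∀ s ∈ J, ¬ DifferentiableAt ℝ H s) →
      (∀ s ∈ J, pointwiseHolderExponent H s < ENNReal.ofReal (H s) ∧
        ENNReal.ofReal (H s) < 2 * pointwiseHolderExponent H s) →
      -- (i)
      (∀ ω ∈ Ωs, ∀ s ∈ J, thetaDerivAlong B H ω s ≠ 0 →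
        pointwiseHolderExponent (mBm B H ω) s = pointwiseHolderExponent H s) ∧
      -- (ii)
      (∀ ω ∈ Ωs, ∀ s ∈ J, thetaDerivAlong B H ω s = 0 →
        pointwiseHolderExponent (mBm B H ω) s = ENNReal.ofReal (H s)) ∧
      (∃ Ωss : Set Ω, Ωss ⊆ Ωs ∧ MeasurableSet Ωss ∧ P Ωss = 1 ∧
        -- (iii)
        (∀ ω ∈ Ωss,
          dimH {s ∈ J | thetaDerivAlong B H ω s ≠ 0} = 1 ∧
          dimH {s ∈ J |
            pointwiseHolderExponent (mBm B H ω) s = pointwiseHolderExponent H s} = 1) ∧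
        -- (iv)
        0 < 1 - sInf (H '' J) ∧
        ∀ η > 0, ∃ D : Set Ω, D ⊆ Ωss ∧ MeasurableSet D ∧ 0 < P D ∧
          ∀ ω ∈ D,
            ENNReal.ofReal (1 - η - sInf (H '' J)) ≤
              dimH {s ∈ J | thetaDerivAlong B H ω s = 0} ∧
            ENNReal.ofReal (1 - η - sInf (H '' J)) ≤
              dimH {s ∈ J | pointwiseHolderExponent (mBm B H ω) s = ENNReal.ofReal (H s)}) ∧
      -- no deterministic function is indistinguishable from the pointwise exponent on `J`
      (∀ a : ℝ → ℝ≥0∞,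
        ¬ ∀ᵐ ω ∂P, ∀ s ∈ J, pointwiseHolderExponent (mBm B H ω) s = a s) := by

  refine ⟨exists_isRegularModification hW, fun B Ωs hreg H J hH hH1 hJo _ hJne hJ0 _ hexp => ?_⟩
  obtain ⟨I, hI, hiff⟩ := hW.exists_wiener
  have hB : ∀ (t θ : ℝ) (hθ : θ ∈ Ioo (0 : ℝ) 1), B t θ =ᵐ[P] I (memLp_fieldKernel hθ t).toLp :=
    fun t θ hθ => ((hiff _ _).1 (hreg.isFieldModification t θ hθ)).choose_spec
  have h_i : ∀ ω ∈ Ωs, ∀ s ∈ J, thetaDerivAlong B H ω s ≠ 0 →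
      pointwiseHolderExponent (mBm B H ω) s = pointwiseHolderExponent H s := fun ω hω s hs hne =>
    (hreg.regular ω hω).pointwiseHolderExponent_of_ne_zero hH hH1 (hexp s hs).1 hne
  have h_ii : ∀ ω ∈ Ωs, ∀ s ∈ J, thetaDerivAlong B H ω s = 0 →
      pointwiseHolderExponent (mBm B H ω) s = ENNReal.ofReal (H s) := fun ω hω s hs hz =>
    (hreg.regular ω hω).pointwiseHolderExponent_of_eq_zero hH hH1 (hexp s hs).2 hz
  have hne : ∀ s ∈ J, ∀ᵐ ω ∂P, thetaDerivAlong B H ω s ≠ 0 := fun s hs =>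
    hreg.measure_thetaDerivAlong_eq_zero hI hB hH1 (hJ0 hs)
  have hinf : sInf (H '' J) < 1 := by
    obtain ⟨s, hs⟩ := hJne
    have hbdd : BddBelow (H '' J) := ⟨0, by rintro _ ⟨t, -, rfl⟩; exact (hH1 t).1.le⟩
    exact (csInf_le hbdd (mem_image_of_mem H hs)).trans_lt (hH1 s).2
  obtain ⟨s₀, hs₀⟩ := id hJne
  -- One fixed time `s₀` suffices for (iii): where the derivative is nonzero at `s₀`, it is nonzero
  -- on a neighbourhood of `s₀`.
  obtain ⟨F, hF1, hF2, hF3⟩ := (hreg.ae_mem.and (hne s₀ hs₀)).exists_measurable_mem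
  have hFP : P F = 1 := prob_compl_eq_zero_iff hF2 |>.1 hF1
  have hle1 : ∀ A : Set ℝ, dimH A ≤ 1 := fun A => by
    rw [← Real.dimH_univ]; exact dimH_mono (subset_univ A)
  refine ⟨h_i, h_ii, ⟨F, fun ω hω => (hF3 ω hω).1, hF2, hFP, fun ω hω => ?_, by linarith,
    fun η hη => ?_⟩, fun a ha => ?_⟩
  · have h1 := hreg.dimH_ne_zero hH hH1 hJo hs₀ (hF3 ω hω).1 (hF3 ω hω).2
    refine ⟨h1, le_antisymm (hle1 _) ?_⟩
    rw [← h1]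
    exact dimH_mono fun s hs => ⟨hs.1, h_i ω (hF3 ω hω).1 s hs.1 hs.2⟩
  · rcases le_or_gt (1 - η - sInf (H '' J)) 0 with hγ | hγ
    · refine ⟨F, subset_rfl, hF2, by simp [hFP], fun ω _ => ?_⟩
      rw [ENNReal.ofReal_of_nonpos hγ]
      exact ⟨zero_le, zero_le⟩
    · obtain ⟨D, -, hDm, hD0, hD⟩ := hreg.exists_event_le_dimH hI hB hH hH1 hJo hJne hJ0 hγ
        (by linarith)
      refine ⟨D ∩ F, inter_subset_right, hDm.inter hF2, ?_, fun ω hω => ?_⟩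
      · refine hD0.trans_le (measure_mono_ae ?_)
        filter_upwards [hF1] with ω h1 h2 using ⟨h2, h1⟩
      · refine ⟨hD ω hω.1, (hD ω hω.1).trans (dimH_mono fun s hs => ?_)⟩
        exact ⟨hs.1, h_ii ω (hF3 ω hω.2).1 s hs.1 hs.2⟩
  -- Any positive dimension would do: it yields a zero `s` on some path, forcing `a s = H s`. At
  -- this now fixed `s` the derivative is almost surely nonzero, forcing `a s = α_H(s)`, contrary to
  -- `α_H(s) < H s`.
  · obtain ⟨D, hDΩ, -, hD0, hD⟩ := hreg.exists_event_le_dimH hI hB hH hH1 hJo hJne hJ0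
      (γ := (1 - sInf (H '' J)) / 2) (by linarith) (by linarith)
    obtain ⟨ω, hωD, hωa⟩ := ((frequently_ae_mem_iff.2 hD0.ne').and_eventually ha).exists
    obtain ⟨s, hs, hz⟩ : {s ∈ J | thetaDerivAlong B H ω s = 0}.Nonempty := by
      rw [nonempty_iff_ne_empty]
      intro he
      have h1 := hD ω hωD
      rw [he, dimH_empty, nonpos_iff_eq_zero, ENNReal.ofReal_eq_zero] at h1
      linarith
    have h1 := h_ii ω (hDΩ hωD) s hs hz
    rw [hωa s hs] at h1
    obtain ⟨ω', h2, h3, h4⟩ := (ha.and (hreg.ae_mem.and (hne s hs))).exists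
    have h5 := h_i ω' h3 s hs h4
    rw [h2 s hs, h1] at h5
    exact (hexp s hs).1.ne h5.symm
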